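/- All rings are unital and associative. Let $\alpha:R\to A$ and $\beta:S\to B$ be ring maps; $A$- and $B$-modules are regarded as $R$- and $S$-modules along them. **Herds.** Let $T$ be a $B$-$A$ bimodule. An $A$-$B$ bimodule $\widehat T$ is a *formal dual* of $T$, via an $A$-bimodule map $\mathrm{ev}:\widehat T\otimes_S T\to A$ and a $B$-bimodule map $\widehat{\mathrm{ev}}:T\otimes_R\widehat T\to B$, if $\widehat{\mathrm{ev}}(x\otimes\hat x)\,y=x\,\mathrm{ev}(\hat x\otimes y)$ and $\mathrm{ev}(\hat x\otimes x)\,\hat y=\hat x\,\widehat{\mathrm{ev}}(x\otimes\hat y)$ for all $x,y\in T$, $\hat x,\hat y\in\widehat T$. A *$B$-$A$ herd* is such a $T$ together with an $S$-$R$ bimodule map $\gamma:T\to T\otimes_R\widehat T\otimes_S T$, written $x\mapsto x^{(1)}\otimes x^{(2)}\otimes x^{(3)}$ (summation understood), such that $\widehat{\mathrm{ev}}(x^{(1)}\otimes x^{(2)})\otimes x^{(3)}=1_B\otimes x$ in $B\otimes_S T$, $x^{(1)}\otimes\mathrm{ev}(x^{(2)}\otimes x^{(3)})=x\otimes 1_A$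 in $T\otimes_R A$, and $(\gamma\otimes\widehat T\otimes T)\circ\gamma=(T\otimes\widehat T\otimes\gamma)\circ\gamma$. The herd is *tame* if $\mathrm{ev}$ and $\widehat{\mathrm{ev}}$ are surjective and $T$ is faithfully flat as a right $R$-module and as a left $S$-module. Let $C\subseteq\widehat T\otimes_S T$ be the $R$-bimodule equaliser of $(\mathrm{ev}\otimes\widehat T\otimes T)\circ(\widehat T\otimes\gamma)$ and $\alpha\otimes\widehat T\otimes T$ (maps to $A\otimes_R\widehat T\otimes_S T$), and let $D\subseteq T\otimes_R\widehat T$ be the $S$-bimodule equaliser of $(T\otimes\widehat T\otimes\widehat{\mathrm{ev}})\circ(\gamma\otimes\widehat T)$ and $T\otimes\widehat T\otimes\beta$ (maps to $T\otimes_R\widehat T\otimes_S B$). Let $\overline T=(C\otimes_R\widehat T)\cap(\widehat T\otimes_S D)$, the intersection of the images in $\widehat T\otimes_S T\otimes_R\widehat T$, an $R$-$S$ bimodule. **Coherds.** Let $C$ be an $R$-coring, $D$ an $S$-coring and $X$ a $D$-$C$ bicomodule with coactions $\rho^{D,X}:X\to D\otimes_S X$ and $\rho^{X,C}:X\to X\otimes_R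 C$. A $C$-$D$ bicomodule $\overline X$ is a *companion* of $X$, via a $C$-bicomodule map $\mathrm{cov}:C\to\overline X\otimes_S X$ and a $D$-bicomodule map $\overline{\mathrm{cov}}:D\to X\otimes_R\overline X$, if $$(X\otimes\mathrm{cov})\circ\rho^{X,C}=(\overline{\mathrm{cov}}\otimes X)\circ\rho^{D,X},\qquad(\mathrm{cov}\otimes\overline X)\circ\rho^{C,\overline X}=(\overline X\otimes\overline{\mathrm{cov}})\circ\rho^{\overline X,D}.$$ With such a companion, $X$ is a *$D$-$C$ bicomodule coherd* via an $S$-$R$ bimodule map $\chi:X\otimes_R\overline X\otimes_S X\to X$ if $\chi\circ(X\otimes\mathrm{cov})=X\otimes\varepsilon_C$, $\chi\circ(\overline{\mathrm{cov}}\otimes X)=\varepsilon_D\otimes X$ and $\chi\circ(\chi\otimes\overline X\otimes X)=\chi\circ(X\otimes\overline X\otimes\chi)$. **Theorem.** Let $(T,\gamma)$ be a tame $B$-$A$ herd with formal dual $\widehat T$. Then $\alpha$ and $\beta$ are injective, and the maps from $C\otimes_R\widehat T$, $\widehat T\otimes_S D$, $C\otimes_R C$, $D\otimes_S D$, $T\otimes_R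 C$, $D\otimes_S T$, $C\otimes_R\overline T$, $\overline T\otimes_S D$, $\overline T\otimes_S T$ and $T\otimes_R\overline T$ to tensor products of copies of $T$ and $\widehat T$, induced by the inclusions of $C$, $D$ and $\overline T$, are injective. Under the resulting identifications: 1. $C$ is an $R$-coring with $\Delta_C=(\widehat T\otimes\gamma)|_C$ and $\varepsilon_C=\mathrm{ev}|_C$, and $D$ is an $S$-coring with $\Delta_D=(\gamma\otimes\widehat T)|_D$ and $\varepsilon_D=\widehat{\mathrm{ev}}|_D$; $T$ is a $D$-$C$ bicomodule with both coactions given by $\gamma$; and $\overline T$ is a $C$-$D$ bicomodule with both coactions given by the restriction of $\widehat T\otimes\gamma\otimes\widehat T$. 2. For these structures, $\overline T$ is a companion of $T$ with $\mathrm{cov}=\Delta_C$ and $\overline{\mathrm{cov}}=\Delta_D$. 3. With this companion, $T$ is a $D$-$C$ bicomodule coherd via $$\chi\Big(x\otimes\sum_i\hat x_i\otimes y_i\otimes\hat y_i\otimes z\Big)=\sum_i\widehat{\mathrm{ev}}(x\otimes\hat x_i)\,y_i\,\mathrm{ev}(\hat y_i\otimes z)$$ for all $x,z\in T$ and $\sum_i\hat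 x_i\otimes y_i\otimes\hat y_i\in\overline T$. -/

import Mathlib

open scoped TensorProduct
open MulOpposite (op)

universe u

noncomputable section

namespace BimoduleHerds

/-! ## Tensor products over a (not necessarily commutative) ring -/

/-- The subgroup of `M ⊗[ℤ] N` generated by all `m r ⊗ n - m ⊗ r n`. -/
def balancedRel (R M N : Type u) [Ring R] [AddCommGroup M] [AddCommGroup N]
    [Module Rᵐᵒᵖ M] [Module R N] : AddSubgroup (M ⊗[ℤ] N) :=
  AddSubgroup.closure
    {z | ∃ (r : R) (m : M) (n : N), z = (op r • m) ⊗ₜ[ℤ] n - m ⊗ₜ[ℤ] (r • n)}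

/-- The tensor product `M ⊗_R N` of a right `R`-module `M` and a left `R`-module `N`.
Right modules are modules over the opposite ring: `op r • m` is `m r`. -/
def BTensor (R M N : Type u) [Ring R] [AddCommGroup M] [AddCommGroup N]
    [Module Rᵐᵒᵖ M] [Module R N] : Type u :=
  (M ⊗[ℤ] N) ⧸ balancedRel R M N

namespace BTensor

section

variable {R M N P : Type u} [Ring R] [AddCommGroup M] [AddCommGroup N] [AddCommGroup P]
  [Module Rᵐᵒᵖ M] [Module R N]

instance : AddCommGroup (BTensor R M N) :=
  inferInstanceAs (AddCommGroup ((M ⊗[ℤ] N) ⧸ balancedRel R M N))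

variable (R) in
/-- The simple tensor `m ⊗ n` in `M ⊗_R N`. -/
def tmul (m : M) (n : N) : BTensor R M N :=
  QuotientAddGroup.mk' (balancedRel R M N) (m ⊗ₜ[ℤ] n)

theorem add_tmul (m m' : M) (n : N) : tmul R (m + m') n = tmul R m n + tmul R m' n := by
  simp only [tmul, TensorProduct.add_tmul, map_add]
  rfl

theorem tmul_add (m : M) (n n' : N) : tmul R m (n + n') = tmul R m n + tmul R m n' := by
  simp only [tmul, TensorProduct.tmul_add, map_add]
  rfl

theorem smul_tmul (r : R) (m : M) (n : N) : tmul R (op r • m) n = tmul R m (r • n) := by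
  have h : (op r • m) ⊗ₜ[ℤ] n - m ⊗ₜ[ℤ] (r • n) ∈ balancedRel R M N :=
    AddSubgroup.subset_closure ⟨r, m, n, rfl⟩
  have h2 := (QuotientAddGroup.eq_zero_iff (N := balancedRel R M N) _).2 h
  rw [QuotientAddGroup.mk_sub] at h2
  exact sub_eq_zero.1 h2

theorem induction_on {p : BTensor R M N → Prop} (z : BTensor R M N) (h0 : p 0)
    (ht : ∀ m n, p (tmul R m n)) (ha : ∀ x y, p x → p y → p (x + y)) : p z := by
  obtain ⟨w, rfl⟩ := QuotientAddGroup.mk'_surjective (balancedRel R M N) z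
  induction w using TensorProduct.induction_on with
  | zero => rw [map_zero]; exact h0
  | tmul m n => exact ht m n
  | add x y hx hy => rw [map_add]; exact ha _ _ hx hy

/-- The additive map out of `M ⊗_R N` induced by a balanced biadditive map. -/
def lift (f : M →+ N →+ P) (hf : ∀ (r : R) m n, f (op r • m) n = f m (r • n)) :
    BTensor R M N →+ P :=
  QuotientAddGroup.lift (balancedRel R M N)
    (TensorProduct.liftAddHom f (fun c m n => by simp)) (by
      rw [balancedRel, AddSubgroup.closure_le]
      rintro _ ⟨r, m, n, rfl⟩
      simp [hf])

@[simp] theorem lift_tmul (f : M →+ N →+ P)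
    (hf : ∀ (r : R) m n, f (op r • m) n = f m (r • n)) (m : M) (n : N) :
    lift f hf (tmul R m n) = f m n := rfl

theorem hom_ext {f g : BTensor R M N →+ P} (h : ∀ m n, f (tmul R m n) = g (tmul R m n)) :
    f = g := by
  ext z
  induction z using induction_on with
  | h0 => simp
  | ht m n => exact h m n
  | ha x y hx hy => rw [map_add, map_add, hx, hy]

/-- The biadditive map `(m, n) ↦ m ⊗ n`. -/
def mkHom (R M N : Type u) [Ring R] [AddCommGroup M] [AddCommGroup N]
    [Module Rᵐᵒᵖ M] [Module R N] : M →+ N →+ BTensor R M N :=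
  AddMonoidHom.mk' (fun m => AddMonoidHom.mk' (fun n => tmul R m n) (tmul_add m))
    (fun m m' => by ext n; exact add_tmul m m' n)

@[simp] theorem mkHom_apply (m : M) (n : N) : mkHom R M N m n = tmul R m n := rfl

end

section

variable {R M N M' N' : Type u} [Ring R] [AddCommGroup M] [AddCommGroup N]
  [AddCommGroup M'] [AddCommGroup N'] [Module Rᵐᵒᵖ M] [Module R N] [Module Rᵐᵒᵖ M'] [Module R N']

/-- The map `f ⊗ g : M ⊗_R N → M' ⊗_R N'` for `R`-linear `f` and `g`. -/
def map (f : M →ₗ[Rᵐᵒᵖ] M') (g : N →ₗ[R] N') : BTensor R M N →+ BTensor R M' N' :=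
  lift (((mkHom R M' N').comp f.toAddMonoidHom).compr₂ (AddMonoidHom.id _) |>.compl₂
      g.toAddMonoidHom) (fun r m n => by simp [smul_tmul])

@[simp] theorem map_tmul (f : M →ₗ[Rᵐᵒᵖ] M') (g : N →ₗ[R] N') (m : M) (n : N) :
    map f g (tmul R m n) = tmul R (f m) (g n) := rfl

end

section

variable {K R M N : Type u} [Ring K] [Ring R] [AddCommGroup M] [AddCommGroup N]
  [Module Rᵐᵒᵖ M] [Module R N]

/-- Left multiplication by `k` on a bimodule, as a right linear map. -/
def lsmul [Module K M] [SMulCommClass K Rᵐᵒᵖ M] (k : K) : M →ₗ[Rᵐᵒᵖ] M where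
  toFun m := k • m
  map_add' := smul_add k
  map_smul' r m := smul_comm k r m

/-- Right multiplication by `l` on a bimodule, as a left linear map. -/
def rsmul {L : Type u} [Ring L] [Module Lᵐᵒᵖ N] [SMulCommClass R Lᵐᵒᵖ N] (l : Lᵐᵒᵖ) :
    N →ₗ[R] N where
  toFun n := l • n
  map_add' := smul_add l
  map_smul' r n := (smul_comm r l n).symm

/-- The left `K`-module structure of `M ⊗_R N` for a `K`-`R` bimodule `M`:
`k (m ⊗ n) = k m ⊗ n`. -/
@[reducible] def leftModule [Module K M] [SMulCommClass K Rᵐᵒᵖ M] : Module K (BTensor R M N) where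
  smul k z := map (lsmul k) LinearMap.id z
  one_smul z := by
    change map (lsmul 1) LinearMap.id z = z
    induction z using induction_on with
    | h0 => simp
    | ht m n => simp [lsmul]
    | ha x y hx hy => rw [map_add, hx, hy]
  mul_smul a b z := by
    change map (lsmul (a * b)) LinearMap.id z
      = map (lsmul a) LinearMap.id (map (lsmul b) LinearMap.id z)
    induction z using induction_on with
    | h0 => simp
    | ht m n => simp [lsmul, mul_smul]
    | ha x y hx hy => simp only [map_add, hx, hy]
  smul_zero k := map_zero (map (lsmul k) LinearMap.id)
  smul_add k x y := map_add (map (lsmul k) LinearMap.id) x y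
  add_smul a b z := by
    change map (lsmul (a + b)) LinearMap.id z
      = map (lsmul a) LinearMap.id z + map (lsmul b) LinearMap.id z
    induction z using induction_on with
    | h0 => simp
    | ht m n => simp [lsmul, add_smul, add_tmul]
    | ha x y hx hy => simp only [map_add, hx, hy]; abel
  zero_smul z := by
    change map (lsmul 0) LinearMap.id z = 0
    induction z using induction_on with
    | h0 => simp
    | ht m n =>
      have h : tmul R (0 : M) n = 0 := map_zero ((mkHom R M N).flip n)
      simp [lsmul, h]
    | ha x y hx hy => simp only [map_add, hx, hy, add_zero]

/-- The right `L`-module structure of `M ⊗_R N` for an `R`-`L` bimodule `N`: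
`(m ⊗ n) l = m ⊗ n l`. -/
@[reducible] def rightModule {L : Type u} [Ring L] [Module Lᵐᵒᵖ N] [SMulCommClass R Lᵐᵒᵖ N] :
    Module Lᵐᵒᵖ (BTensor R M N) where
  smul l z := map LinearMap.id (rsmul l) z
  one_smul z := by
    change map LinearMap.id (rsmul 1) z = z
    induction z using induction_on with
    | h0 => simp
    | ht m n => simp [rsmul]
    | ha x y hx hy => rw [map_add, hx, hy]
  mul_smul a b z := by
    change map LinearMap.id (rsmul (a * b)) z
      = map LinearMap.id (rsmul a) (map LinearMap.id (rsmul b) z)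
    induction z using induction_on with
    | h0 => simp
    | ht m n => simp [rsmul, mul_smul]
    | ha x y hx hy => simp only [map_add, hx, hy]
  smul_zero l := map_zero (map LinearMap.id (rsmul l))
  smul_add l x y := map_add (map LinearMap.id (rsmul l)) x y
  add_smul a b z := by
    change map LinearMap.id (rsmul (a + b)) z
      = map LinearMap.id (rsmul a) z + map LinearMap.id (rsmul b) z
    induction z using induction_on with
    | h0 => simp
    | ht m n => simp [rsmul, add_smul, tmul_add]
    | ha x y hx hy => simp only [map_add, hx, hy]; abel
  zero_smul z := by
    change map LinearMap.id (rsmul 0) z = 0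
    induction z using induction_on with
    | h0 => simp
    | ht m n =>
      have h : tmul R m (0 : N) = 0 := map_zero (mkHom R M N m)
      simp [rsmul, h]
    | ha x y hx hy => simp only [map_add, hx, hy, add_zero]

end

end BTensor

/-- A right `R`-module `M` is faithfully flat if `M ⊗_R -` preserves and reflects exactness of
sequences of left `R`-modules. -/
def FaithfullyFlatRight (R M : Type u) [Ring R] [AddCommGroup M] [Module Rᵐᵒᵖ M] : Prop :=
  ∀ (N₁ N₂ N₃ : Type u) [AddCommGroup N₁] [AddCommGroup N₂] [AddCommGroup N₃]
    [Module R N₁] [Module R N₂] [Module R N₃] (f : N₁ →ₗ[R] N₂) (g : N₂ →ₗ[R] N₃),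
    Function.Exact f g ↔
      Function.Exact (BTensor.map (LinearMap.id : M →ₗ[Rᵐᵒᵖ] M) f)
        (BTensor.map (LinearMap.id : M →ₗ[Rᵐᵒᵖ] M) g)

/-- A left `S`-module `M` is faithfully flat if `- ⊗_S M` preserves and reflects exactness of
sequences of right `S`-modules. -/
def FaithfullyFlatLeft (S M : Type u) [Ring S] [AddCommGroup M] [Module S M] : Prop :=
  ∀ (N₁ N₂ N₃ : Type u) [AddCommGroup N₁] [AddCommGroup N₂] [AddCommGroup N₃]
    [Module Sᵐᵒᵖ N₁] [Module Sᵐᵒᵖ N₂] [Module Sᵐᵒᵖ N₃]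
    (f : N₁ →ₗ[Sᵐᵒᵖ] N₂) (g : N₂ →ₗ[Sᵐᵒᵖ] N₃),
    Function.Exact f g ↔
      Function.Exact (BTensor.map f (LinearMap.id : M →ₗ[S] M))
        (BTensor.map g (LinearMap.id : M →ₗ[S] M))

/-! ## Bimodules -/

/-- A `K`-`L` bimodule. -/
structure Bimodule (K L : Type u) [Ring K] [Ring L] where
  carrier : Type u
  [addCommGroup : AddCommGroup carrier]
  [leftModule : Module K carrier]
  [rightModule : Module Lᵐᵒᵖ carrier]
  [smulComm : SMulCommClass K Lᵐᵒᵖ carrier]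

namespace Bimodule

attribute [instance] addCommGroup leftModule rightModule smulComm

instance (K L : Type u) [Ring K] [Ring L] : CoeSort (Bimodule K L) (Type u) := ⟨carrier⟩

section

variable {K L : Type u} [Ring K] [Ring L]

/-- Homomorphisms of `K`-`L` bimodules. -/
structure Hom (X Y : Bimodule K L) extends X →+ Y where
  map_smul' : ∀ (k : K) (x : X), toFun (k • x) = k • toFun x
  map_op_smul' : ∀ (l : Lᵐᵒᵖ) (x : X), toFun (l • x) = l • toFun x

instance (X Y : Bimodule K L) : FunLike (Hom X Y) X Y where
  coe f := f.toFun
  coe_injective f g h := by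
    obtain ⟨f, _, _⟩ := f
    obtain ⟨g, _, _⟩ := g
    congr 1
    exact DFunLike.coe_injective h

instance (X Y : Bimodule K L) : AddMonoidHomClass (Hom X Y) X Y where
  map_add f := f.map_add'
  map_zero f := f.map_zero'

/-- A bimodule map as a left linear map. -/
def Hom.left {X Y : Bimodule K L} (f : Hom X Y) : X →ₗ[K] Y where
  toFun := f
  map_add' := map_add f
  map_smul' := f.map_smul'

/-- A bimodule map as a right linear map. -/
def Hom.right {X Y : Bimodule K L} (f : Hom X Y) : X →ₗ[Lᵐᵒᵖ] Y where
  toFun := f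
  map_add' := map_add f
  map_smul' := f.map_op_smul'

/-- The identity map. -/
def Hom.id (X : Bimodule K L) : Hom X X :=
  { AddMonoidHom.id X with
    map_smul' := fun _ _ => rfl
    map_op_smul' := fun _ _ => rfl }

/-- The composition `g ∘ f`. -/
def Hom.comp {X Y Z : Bimodule K L} (g : Hom Y Z) (f : Hom X Y) : Hom X Z :=
  { g.toAddMonoidHom.comp f.toAddMonoidHom with
    map_smul' := fun k x => by
      change g (f (k • x)) = k • g (f x)
      rw [show f (k • x) = k • f x from f.map_smul' k x]
      exact g.map_smul' k _
    map_op_smul' := fun l x => by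
      change g (f (l • x)) = l • g (f x)
      rw [show f (l • x) = l • f x from f.map_op_smul' l x]
      exact g.map_op_smul' l _ }

end

/-- A ring as a bimodule over itself. -/
abbrev reg (K : Type u) [Ring K] : Bimodule K K where
  carrier := K

/-- Restriction of scalars of a bimodule along ring maps on both sides. -/
def restrict {K L K' L' : Type u} [Ring K] [Ring L] [Ring K'] [Ring L']
    (X : Bimodule K L) (f : K' →+* K) (g : L' →+* L) : Bimodule K' L' :=
  letI : Module K' X := Module.compHom X f
  letI : Module L'ᵐᵒᵖ X := Module.compHom X (RingHom.op g)
  { carrier := X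
    smulComm := ⟨fun k l x => smul_comm (f k) (RingHom.op g l) x⟩ }

/-- A ring map `f : K' → K` as a `K'`-bimodule map. -/
def unitHom {K K' : Type u} [Ring K] [Ring K'] (f : K' →+* K) :
    Hom (reg K') ((reg K).restrict f f) :=
  { f.toAddMonoidHom with
    map_smul' := fun k x => map_mul f k x
    map_op_smul' := fun l x => map_mul f x l.unop }

section

variable {K L M N : Type u} [Ring K] [Ring L] [Ring M] [Ring N]

/-- The tensor product over `L` of a `K`-`L` bimodule and an `L`-`M` bimodule. -/
def tensor (X : Bimodule K L) (Y : Bimodule L M) : Bimodule K M :=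
  letI : Module K (BTensor L X Y) := BTensor.leftModule
  letI : Module Mᵐᵒᵖ (BTensor L X Y) := BTensor.rightModule
  { carrier := BTensor L X Y
    smulComm := ⟨fun k l z => by
      induction z using BTensor.induction_on with
      | h0 => simp
      | ht x y => rfl
      | ha x y hx hy => simp only [smul_add, hx, hy]⟩ }

end

end Bimodule

/-- The tensor product of bimodules over the middle ring. -/
infixr:70 " ⊗ᵇ " => Bimodule.tensor

namespace Bimodule

section

variable {K L M N : Type u} [Ring K] [Ring L] [Ring M] [Ring N]

/-- The simple tensor `x ⊗ y`. -/
def tmul {X : Bimodule K L} {Y : Bimodule L M} (x : X) (y : Y) : (X ⊗ᵇ Y : Bimodule K M) :=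
  BTensor.tmul L x y

theorem tmul_add {X : Bimodule K L} {Y : Bimodule L M} (x : X) (y y' : Y) :
    tmul x (y + y') = tmul x y + tmul x y' := BTensor.tmul_add x y y'

theorem add_tmul {X : Bimodule K L} {Y : Bimodule L M} (x x' : X) (y : Y) :
    tmul (x + x') y = tmul x y + tmul x' y := BTensor.add_tmul x x' y

theorem smul_tmul {X : Bimodule K L} {Y : Bimodule L M} (r : L) (x : X) (y : Y) :
    tmul (op r • x) y = tmul x (r • y) := BTensor.smul_tmul r x y

theorem induction_on {X : Bimodule K L} {Y : Bimodule L M}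
    {p : (X ⊗ᵇ Y : Bimodule K M) → Prop} (z : (X ⊗ᵇ Y : Bimodule K M)) (h0 : p 0)
    (ht : ∀ x y, p (tmul x y)) (ha : ∀ x y, p x → p y → p (x + y)) : p z :=
  BTensor.induction_on z h0 ht ha

theorem addHom_ext {X : Bimodule K L} {Y : Bimodule L M} {G : Type u} [AddCommGroup G]
    {f g : (X ⊗ᵇ Y : Bimodule K M) →+ G} (h : ∀ x y, f (tmul x y) = g (tmul x y)) : f = g :=
  BTensor.hom_ext h

/-- A balanced biadditive map that is linear on both outer sides induces a bimodule map on the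
tensor product. -/
def lift {X : Bimodule K L} {Y : Bimodule L M} {Z : Bimodule K M} (f : X →+ Y →+ Z)
    (hf : ∀ (r : L) x y, f (op r • x) y = f x (r • y))
    (hl : ∀ (k : K) x y, f (k • x) y = k • f x y)
    (hr : ∀ (l : Mᵐᵒᵖ) x y, f x (l • y) = l • f x y) : Hom (X ⊗ᵇ Y) Z :=
  { BTensor.lift f hf with
    map_smul' := fun k z => by
      change BTensor.lift f hf (BTensor.map (BTensor.lsmul k) LinearMap.id z)
        = k • BTensor.lift f hf z
      induction z using BTensor.induction_on with
      | h0 => simp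
      | ht x y => exact hl k x y
      | ha x y hx hy => simp only [map_add, smul_add, hx, hy]
    map_op_smul' := fun l z => by
      change BTensor.lift f hf (BTensor.map LinearMap.id (BTensor.rsmul l) z)
        = l • BTensor.lift f hf z
      induction z using BTensor.induction_on with
      | h0 => simp
      | ht x y => exact hr l x y
      | ha x y hx hy => simp only [map_add, smul_add, hx, hy] }

/-- The bimodule map `f ⊗ g`. -/
def tensorHom {X X' : Bimodule K L} {Y Y' : Bimodule L M} (f : Hom X X') (g : Hom Y Y') :
    Hom (X ⊗ᵇ Y) (X' ⊗ᵇ Y') :=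
  { BTensor.map f.right g.left with
    map_smul' := fun k z => by
      change BTensor.map f.right g.left (BTensor.map (BTensor.lsmul k) LinearMap.id z)
        = BTensor.map (BTensor.lsmul k) LinearMap.id (BTensor.map f.right g.left z)
      induction z using BTensor.induction_on with
      | h0 => simp
      | ht x y => exact congrArg (fun t => BTensor.tmul L t (g y)) (f.map_smul' k x)
      | ha x y hx hy => simp only [map_add, hx, hy]
    map_op_smul' := fun l z => by
      change BTensor.map f.right g.left (BTensor.map LinearMap.id (BTensor.rsmul l) z)
        = BTensor.map LinearMap.id (BTensor.rsmul l) (BTensor.map f.right g.left z)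
      induction z using BTensor.induction_on with
      | h0 => simp
      | ht x y => exact congrArg (fun t => BTensor.tmul L (f x) t) (g.map_op_smul' l y)
      | ha x y hx hy => simp only [map_add, hx, hy] }

@[simp] theorem tensorHom_tmul {X X' : Bimodule K L} {Y Y' : Bimodule L M}
    (f : Hom X X') (g : Hom Y Y') (x : X) (y : Y) :
    tensorHom f g (tmul x y) = tmul (f x) (g y) := rfl

/-- The biadditive map `(x, y) ↦ x ⊗ y`. -/
def mkHom (X : Bimodule K L) (Y : Bimodule L M) : X →+ Y →+ (X ⊗ᵇ Y : Bimodule K M) :=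
  BTensor.mkHom L X Y

/-- For fixed `z`, the map `x ⊗ y ↦ x ⊗ (y ⊗ z)`. -/
def assocAux (X : Bimodule K L) (Y : Bimodule L M) (Z : Bimodule M N) (z : Z) :
    (X ⊗ᵇ Y : Bimodule K M) →+ (X ⊗ᵇ (Y ⊗ᵇ Z) : Bimodule K N) :=
  BTensor.lift ((mkHom X (Y ⊗ᵇ Z)).compl₂ ((mkHom Y Z).flip z))
    (fun r x y => smul_tmul (Y := Y ⊗ᵇ Z) r x (tmul y z))

/-- For fixed `x`, the map `y ⊗ z ↦ (x ⊗ y) ⊗ z`. -/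
def assocInvAux (X : Bimodule K L) (Y : Bimodule L M) (Z : Bimodule M N) (x : X) :
    (Y ⊗ᵇ Z : Bimodule L N) →+ ((X ⊗ᵇ Y) ⊗ᵇ Z : Bimodule K N) :=
  BTensor.lift ((mkHom (X ⊗ᵇ Y) Z).comp (mkHom X Y x))
    (fun r y z => smul_tmul (X := X ⊗ᵇ Y) r (tmul x y) z)

/-- The associativity map `(x ⊗ y) ⊗ z ↦ x ⊗ (y ⊗ z)`. -/
def assoc (X : Bimodule K L) (Y : Bimodule L M) (Z : Bimodule M N) :
    Hom ((X ⊗ᵇ Y) ⊗ᵇ Z) (X ⊗ᵇ (Y ⊗ᵇ Z)) :=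
  lift (AddMonoidHom.flip (AddMonoidHom.mk' (assocAux X Y Z) (fun z z' => by
      refine addHom_ext fun x y => ?_
      exact (congrArg (fun t => tmul x t) (tmul_add y z z')).trans (tmul_add x _ _))))
    (fun r w z => by
      change assocAux X Y Z z (op r • w) = assocAux X Y Z (r • z) w
      induction w using induction_on with
      | h0 => rw [smul_zero, map_zero, map_zero]
      | ht x y => exact congrArg (fun t => tmul x t) (smul_tmul r y z)
      | ha x y hx hy => rw [smul_add, map_add, map_add, hx, hy])
    (fun k w z => by
      change assocAux X Y Z z (k • w) = k • assocAux X Y Z z w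
      induction w using induction_on with
      | h0 => simp only [smul_zero, map_zero]
      | ht x y => rfl
      | ha x y hx hy => simp only [smul_add, map_add, hx, hy])
    (fun l w z => by
      change assocAux X Y Z (l • z) w = l • assocAux X Y Z z w
      induction w using induction_on with
      | h0 => simp only [smul_zero, map_zero]
      | ht x y => rfl
      | ha x y hx hy => simp only [smul_add, map_add, hx, hy])

/-- The inverse associativity map `x ⊗ (y ⊗ z) ↦ (x ⊗ y) ⊗ z`. -/
def assocInv (X : Bimodule K L) (Y : Bimodule L M) (Z : Bimodule M N) :
    Hom (X ⊗ᵇ (Y ⊗ᵇ Z)) ((X ⊗ᵇ Y) ⊗ᵇ Z) :=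
  lift (AddMonoidHom.mk' (assocInvAux X Y Z) (fun x x' => by
      refine addHom_ext fun y z => ?_
      exact (congrArg (fun t => tmul t z) (add_tmul x x' y)).trans (add_tmul _ _ z)))
    (fun r x w => by
      change assocInvAux X Y Z (op r • x) w = assocInvAux X Y Z x (r • w)
      induction w using induction_on with
      | h0 => rw [smul_zero, map_zero, map_zero]
      | ht y z => exact congrArg (fun t => tmul t z) (smul_tmul r x y)
      | ha x y hx hy => rw [smul_add, map_add, map_add, hx, hy])
    (fun k x w => by
      change assocInvAux X Y Z (k • x) w = k • assocInvAux X Y Z x w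
      induction w using induction_on with
      | h0 => simp only [smul_zero, map_zero]
      | ht x y => rfl
      | ha x y hx hy => simp only [smul_add, map_add, hx, hy])
    (fun l x w => by
      change assocInvAux X Y Z x (l • w) = l • assocInvAux X Y Z x w
      induction w using induction_on with
      | h0 => simp only [smul_zero, map_zero]
      | ht x y => rfl
      | ha x y hx hy => simp only [smul_add, map_add, hx, hy])

@[simp] theorem assoc_tmul (X : Bimodule K L) (Y : Bimodule L M) (Z : Bimodule M N)
    (x : X) (y : Y) (z : Z) :
    assoc X Y Z (tmul (tmul x y) z) = tmul x (tmul y z) := rfl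

@[simp] theorem assocInv_tmul (X : Bimodule K L) (Y : Bimodule L M) (Z : Bimodule M N)
    (x : X) (y : Y) (z : Z) :
    assocInv X Y Z (tmul x (tmul y z)) = tmul (tmul x y) z := rfl

/-- The isomorphism `K ⊗_K X → X`, `k ⊗ x ↦ k x`. -/
def lunit (X : Bimodule K L) : Hom (reg K ⊗ᵇ X) X :=
  lift (AddMonoidHom.mk' (fun k : K => AddMonoidHom.mk' (fun x : X => k • x) (smul_add k))
      (fun k k' => by ext x; exact add_smul k k' x))
    (fun r k x => mul_smul k r x)
    (fun r k x => mul_smul r k x)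
    (fun l k x => smul_comm k l x)

/-- The map `X → K ⊗_K X`, `x ↦ 1 ⊗ x`. -/
def lunitInv (X : Bimodule K L) : Hom X (reg K ⊗ᵇ X) :=
  { mkHom (reg K) X (1 : K) with
    map_smul' := fun k x => by
      change BTensor.tmul K (1 : K) (k • x) = BTensor.tmul K (k * 1 : K) x
      rw [← BTensor.smul_tmul, mul_one]
      exact congrArg (fun t : K => BTensor.tmul K t x) (one_mul k)
    map_op_smul' := fun _ _ => rfl }

/-- The isomorphism `X ⊗_L L → X`, `x ⊗ l ↦ x l`. -/
def runit (X : Bimodule K L) : Hom (X ⊗ᵇ reg L) X :=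
  lift (AddMonoidHom.flip
      (AddMonoidHom.mk' (fun l : L => AddMonoidHom.mk' (fun x : X => op l • x) (smul_add (op l)))
        (fun l l' => by ext x; exact add_smul (op l) (op l') x)))
    (fun r x l => (mul_smul (op l) (op r) x).symm)
    (fun k x l => (smul_comm k (op l) x).symm)
    (fun m x l => mul_smul m (op l) x)

/-- The map `X → X ⊗_L L`, `x ↦ x ⊗ 1`. -/
def runitInv (X : Bimodule K L) : Hom X (X ⊗ᵇ reg L) :=
  { (mkHom X (reg L)).flip (1 : L) with
    map_smul' := fun _ _ => rfl
    map_op_smul' := fun l x => by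
      change BTensor.tmul L (op l.unop • x) (1 : L) = BTensor.tmul L x (1 * l.unop : L)
      rw [BTensor.smul_tmul]
      exact congrArg (fun t : L => BTensor.tmul L x t) ((mul_one _).trans (one_mul _).symm) }

end

/-! ### Sub-bimodules -/

/-- A sub-bimodule. -/
structure SubBimodule {K L : Type u} [Ring K] [Ring L] (X : Bimodule K L) extends AddSubgroup X where
  smul_mem' : ∀ (k : K) {x : X}, x ∈ carrier → k • x ∈ carrier
  op_smul_mem' : ∀ (l : Lᵐᵒᵖ) {x : X}, x ∈ carrier → l • x ∈ carrier

section

variable {K L : Type u} [Ring K] [Ring L]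

/-- A sub-bimodule, viewed as a bimodule. -/
def SubBimodule.toBimodule {X : Bimodule K L} (U : SubBimodule X) : Bimodule K L :=
  letI : Module K U.toAddSubgroup :=
    { smul := fun k x => ⟨k • x.1, U.smul_mem' k x.2⟩
      one_smul := fun x => Subtype.ext (one_smul K x.1)
      mul_smul := fun a b x => Subtype.ext (mul_smul a b x.1)
      smul_zero := fun a => Subtype.ext (smul_zero a)
      smul_add := fun a x y => Subtype.ext (smul_add a x.1 y.1)
      add_smul := fun a b x => Subtype.ext (add_smul a b x.1)
      zero_smul := fun x => Subtype.ext (zero_smul K x.1) }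
  letI : Module Lᵐᵒᵖ U.toAddSubgroup :=
    { smul := fun k x => ⟨k • x.1, U.op_smul_mem' k x.2⟩
      one_smul := fun x => Subtype.ext (one_smul Lᵐᵒᵖ x.1)
      mul_smul := fun a b x => Subtype.ext (mul_smul a b x.1)
      smul_zero := fun a => Subtype.ext (smul_zero a)
      smul_add := fun a x y => Subtype.ext (smul_add a x.1 y.1)
      add_smul := fun a b x => Subtype.ext (add_smul a b x.1)
      zero_smul := fun x => Subtype.ext (zero_smul Lᵐᵒᵖ x.1) }
  { carrier := U.toAddSubgroup
    smulComm := ⟨fun k l x => Subtype.ext (smul_comm k l x.1)⟩ }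

/-- The inclusion of a sub-bimodule. -/
def SubBimodule.incl {X : Bimodule K L} (U : SubBimodule X) : Hom U.toBimodule X :=
  { U.toAddSubgroup.subtype with
    map_smul' := fun _ _ => rfl
    map_op_smul' := fun _ _ => rfl }

/-- The equaliser `{x | f x = g x}` of two bimodule maps. -/
def SubBimodule.equaliser {X Y : Bimodule K L} (f g : Hom X Y) : SubBimodule X where
  carrier := {x | f x = g x}
  add_mem' {a b} ha hb := by
    change f (a + b) = g (a + b)
    rw [map_add, map_add, show f a = g a from ha, show f b = g b from hb]
  zero_mem' := by
    change f 0 = g 0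
    rw [map_zero, map_zero]
  neg_mem' {a} ha := by
    change f (-a) = g (-a)
    rw [map_neg, map_neg, show f a = g a from ha]
  smul_mem' k {x} hx := by
    change f (k • x) = g (k • x)
    exact (f.map_smul' k x).trans ((congrArg (k • ·) hx).trans (g.map_smul' k x).symm)
  op_smul_mem' l {x} hx := by
    change f (l • x) = g (l • x)
    exact (f.map_op_smul' l x).trans ((congrArg (l • ·) hx).trans (g.map_op_smul' l x).symm)

/-- The image of a bimodule map. -/
def SubBimodule.range {X Y : Bimodule K L} (f : Hom X Y) : SubBimodule Y :=
  { f.toAddMonoidHom.range with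
    smul_mem' := by
      rintro k _ ⟨x, rfl⟩
      exact ⟨k • x, f.map_smul' k x⟩
    op_smul_mem' := by
      rintro l _ ⟨x, rfl⟩
      exact ⟨l • x, f.map_op_smul' l x⟩ }

/-- The intersection of two sub-bimodules. -/
def SubBimodule.inter {X : Bimodule K L} (U V : SubBimodule X) : SubBimodule X :=
  { U.toAddSubgroup ⊓ V.toAddSubgroup with
    smul_mem' := fun k _ hx => ⟨U.smul_mem' k hx.1, V.smul_mem' k hx.2⟩
    op_smul_mem' := fun l _ hx => ⟨U.op_smul_mem' l hx.1, V.op_smul_mem' l hx.2⟩ }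

end

end Bimodule

open Bimodule

/-! ## Corings, bicomodules, companions, coherds -/

/-- An `R`-coring structure on an `R`-bimodule `C`. -/
structure Coring {R : Type u} [Ring R] (C : Bimodule R R) where
  comul : Hom C (C ⊗ᵇ C)
  counit : Hom C (reg R)
  coassoc : (assoc C C C).comp ((tensorHom comul (.id C)).comp comul)
    = (tensorHom (.id C) comul).comp comul
  counit_left : (lunit C).comp ((tensorHom counit (.id C)).comp comul) = .id C
  counit_right : (runit C).comp ((tensorHom (.id C) counit).comp comul) = .id C

/-- A `D`-`C` bicomodule structure on an `S`-`R` bimodule `X`. -/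
structure Bicomodule {R S : Type u} [Ring R] [Ring S] {D : Bimodule S S} {C : Bimodule R R}
    (cD : Coring D) (cC : Coring C) (X : Bimodule S R) where
  lcoact : Hom X (D ⊗ᵇ X)
  rcoact : Hom X (X ⊗ᵇ C)
  lcoassoc : (assoc D D X).comp ((tensorHom cD.comul (.id X)).comp lcoact)
    = (tensorHom (.id D) lcoact).comp lcoact
  lcounit : (lunit X).comp ((tensorHom cD.counit (.id X)).comp lcoact) = .id X
  rcoassoc : (assoc X C C).comp ((tensorHom rcoact (.id C)).comp rcoact)
    = (tensorHom (.id X) cC.comul).comp rcoact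
  rcounit : (runit X).comp ((tensorHom (.id X) cC.counit).comp rcoact) = .id X
  coact_comm : (assoc D X C).comp ((tensorHom lcoact (.id C)).comp rcoact)
    = (tensorHom (.id D) rcoact).comp lcoact

/-- `f` is a map of left `C`-comodules, for the coactions `lX` and `lY`. -/
def LeftColinear {R M : Type u} [Ring R] [Ring M] {C : Bimodule R R} {X Y : Bimodule R M}
    (lX : Hom X (C ⊗ᵇ X)) (lY : Hom Y (C ⊗ᵇ Y)) (f : Hom X Y) : Prop :=
  lY.comp f = (tensorHom (.id C) f).comp lX

/-- `f` is a map of right `C`-comodules, for the coactions `rX` and `rY`. -/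
def RightColinear {R M : Type u} [Ring R] [Ring M] {C : Bimodule R R} {X Y : Bimodule M R}
    (rX : Hom X (X ⊗ᵇ C)) (rY : Hom Y (Y ⊗ᵇ C)) (f : Hom X Y) : Prop :=
  rY.comp f = (tensorHom f (.id C)).comp rX

/-- The left coaction `Y ⊗ X → C ⊗ (Y ⊗ X)` induced by a left coaction on `Y`. -/
def tensorLcoact {R M N : Type u} [Ring R] [Ring M] [Ring N] {C : Bimodule R R}
    {Y : Bimodule R M} (X : Bimodule M N) (l : Hom Y (C ⊗ᵇ Y)) :
    Hom (Y ⊗ᵇ X) (C ⊗ᵇ (Y ⊗ᵇ X)) :=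
  (assoc C Y X).comp (tensorHom l (.id X))

/-- The right coaction `Y ⊗ X → (Y ⊗ X) ⊗ C` induced by a right coaction on `X`. -/
def tensorRcoact {R M N : Type u} [Ring R] [Ring M] [Ring N] {C : Bimodule R R}
    (Y : Bimodule N M) {X : Bimodule M R} (r : Hom X (X ⊗ᵇ C)) :
    Hom (Y ⊗ᵇ X) ((Y ⊗ᵇ X) ⊗ᵇ C) :=
  (assocInv Y X C).comp (tensorHom (.id Y) r)

/-- The structure making the `C`-`D` bicomodule `Y` a companion of the `D`-`C` bicomodule `X`. -/
structure Companion {R S : Type u} [Ring R] [Ring S] {D : Bimodule S S} {C : Bimodule R R}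
    {cD : Coring D} {cC : Coring C} {X : Bimodule S R} {Y : Bimodule R S}
    (bX : Bicomodule cD cC X) (bY : Bicomodule cC cD Y) where
  cov : Hom C (Y ⊗ᵇ X)
  covBar : Hom D (X ⊗ᵇ Y)
  cov_left : LeftColinear cC.comul (tensorLcoact X bY.lcoact) cov
  cov_right : RightColinear cC.comul (tensorRcoact Y bX.rcoact) cov
  covBar_left : LeftColinear cD.comul (tensorLcoact Y bX.lcoact) covBar
  covBar_right : RightColinear cD.comul (tensorRcoact X bY.rcoact) covBar
  diag_X : (tensorHom (.id X) cov).comp bX.rcoact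
    = (assoc X Y X).comp ((tensorHom covBar (.id X)).comp bX.lcoact)
  diag_Y : (assoc Y X Y).comp ((tensorHom cov (.id Y)).comp bY.lcoact)
    = (tensorHom (.id Y) covBar).comp bY.rcoact

/-- The structure making a `D`-`C` bicomodule `X` with a companion `Y` a bicomodule coherd. -/
structure Coherd {R S : Type u} [Ring R] [Ring S] {D : Bimodule S S} {C : Bimodule R R}
    {cD : Coring D} {cC : Coring C} {X : Bimodule S R} {Y : Bimodule R S}
    {bX : Bicomodule cD cC X} {bY : Bicomodule cC cD Y} (c : Companion bX bY) where
  chi : Hom (X ⊗ᵇ (Y ⊗ᵇ X)) X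
  chi_cov : chi.comp (tensorHom (.id X) c.cov) = (runit X).comp (tensorHom (.id X) cC.counit)
  chi_covBar : chi.comp ((assoc X Y X).comp (tensorHom c.covBar (.id X)))
    = (lunit X).comp (tensorHom cD.counit (.id X))
  chi_assoc : chi.comp (tensorHom (.id X) (tensorHom (.id Y) chi))
    = chi.comp ((tensorHom chi (.id (Y ⊗ᵇ X))).comp
        ((assocInv X (Y ⊗ᵇ X) (Y ⊗ᵇ X)).comp (tensorHom (.id X) (assocInv Y X (Y ⊗ᵇ X)))))

/-! ## Bimodule herds -/

section

variable {R S A B : Type u} [Ring R] [Ring S] [Ring A] [Ring B]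

/-- The structure making the `A`-`B` bimodule `That` a formal dual of the `B`-`A` bimodule `T`,
relative to the ring maps `α : R → A` and `β : S → B`. All `A`- and `B`-modules are regarded as
`R`- and `S`-modules along these maps. -/
structure FormalDual (α : R →+* A) (β : S →+* B) (T : Bimodule B A) (That : Bimodule A B) where
  /-- The `A`-bimodule map `That ⊗_S T → A`. -/
  ev : Hom (That.restrict (.id A) β ⊗ᵇ T.restrict β (.id A)) (reg A)
  /-- The `B`-bimodule map `T ⊗_R That → B`. -/
  evHat : Hom (T.restrict (.id B) α ⊗ᵇ That.restrict α (.id B)) (reg B)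
  diag_T : ∀ (x : T) (v : That) (y : T),
    (evHat (tmul (X := T.restrict (.id B) α) (Y := That.restrict α (.id B)) x v) : B) • y
      = op (ev (tmul (X := That.restrict (.id A) β) (Y := T.restrict β (.id A)) v y) : A) • x
  diag_That : ∀ (v : That) (x : T) (w : That),
    (ev (tmul (X := That.restrict (.id A) β) (Y := T.restrict β (.id A)) v x) : A) • w
      = op (evHat (tmul (X := T.restrict (.id B) α) (Y := That.restrict α (.id B)) x w) : B) • v

namespace FormalDual

variable {α : R →+* A} {β : S →+* B} {T : Bimodule B A} {That : Bimodule A B}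

/-- `T` as an `S`-`R` bimodule. -/
abbrev t (_P : FormalDual α β T That) : Bimodule S R := T.restrict β α

/-- The formal dual as an `R`-`S` bimodule. -/
abbrev h (_P : FormalDual α β T That) : Bimodule R S := That.restrict α β

/-- `A` as an `R`-bimodule. -/
abbrev a (_P : FormalDual α β T That) : Bimodule R R := (reg A).restrict α α

/-- `B` as an `S`-bimodule. -/
abbrev b (_P : FormalDual α β T That) : Bimodule S S := (reg B).restrict β β

/-- The evaluation map as a map of `R`-bimodules. -/
def evR (P : FormalDual α β T That) : Hom (P.h ⊗ᵇ P.t) P.a where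
  toFun := P.ev
  map_zero' := map_zero P.ev
  map_add' := map_add P.ev
  map_smul' r z := P.ev.map_smul' (α r) z
  map_op_smul' r z := P.ev.map_op_smul' (RingHom.op α r) z

/-- The coevaluation map as a map of `S`-bimodules. -/
def evHatS (P : FormalDual α β T That) : Hom (P.t ⊗ᵇ P.h) P.b where
  toFun := P.evHat
  map_zero' := map_zero P.evHat
  map_add' := map_add P.evHat
  map_smul' r z := P.evHat.map_smul' (β r) z
  map_op_smul' r z := P.evHat.map_op_smul' (RingHom.op β r) z

/-- The value `ev (v ⊗ x)`. -/
def pair (P : FormalDual α β T That) (v : That) (x : T) : A :=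
  P.ev (tmul (X := That.restrict (.id A) β) (Y := T.restrict β (.id A)) v x)

/-- The value of the coevaluation map at `x ⊗ v`. -/
def pairHat (P : FormalDual α β T That) (x : T) (v : That) : B :=
  P.evHat (tmul (X := T.restrict (.id B) α) (Y := That.restrict α (.id B)) x v)

end FormalDual

/-- A shepherd: the structure making `T`, with a given formal dual as its pen, a bimodule herd. -/
structure Shepherd {α : R →+* A} {β : S →+* B} {T : Bimodule B A} {That : Bimodule A B}
    (P : FormalDual α β T That) where
  γ : Hom P.t (P.t ⊗ᵇ (P.h ⊗ᵇ P.t))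
  coev : (tensorHom P.evHatS (.id P.t)).comp ((assocInv P.t P.h P.t).comp γ)
    = (tensorHom (unitHom β) (.id P.t)).comp (lunitInv P.t)
  ev : (tensorHom (.id P.t) P.evR).comp γ
    = (tensorHom (.id P.t) (unitHom α)).comp (runitInv P.t)
  coassoc : (tensorHom (.id P.t) (assoc P.h P.t (P.h ⊗ᵇ P.t))).comp
      ((assoc P.t (P.h ⊗ᵇ P.t) (P.h ⊗ᵇ P.t)).comp
        ((tensorHom γ (.id (P.h ⊗ᵇ P.t))).comp γ))
    = (tensorHom (.id P.t) (tensorHom (.id P.h) γ)).comp γ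

namespace Shepherd

variable {α : R →+* A} {β : S →+* B} {T : Bimodule B A} {That : Bimodule A B}
  {P : FormalDual α β T That}

/-- A herd is tame if both evaluation maps are surjective and `T` is faithfully flat as a right
`R`-module and as a left `S`-module. -/
structure Tame (_G : Shepherd P) : Prop where
  ev_surjective : Function.Surjective P.ev
  evHat_surjective : Function.Surjective P.evHat
  flat_right : FaithfullyFlatRight R P.t
  flat_left : FaithfullyFlatLeft S P.t

variable (G : Shepherd P)

/-- The map `v ⊗ x ↦ v ⊗ γ(x)`. -/
def hγ : Hom (P.h ⊗ᵇ P.t) (P.h ⊗ᵇ (P.t ⊗ᵇ (P.h ⊗ᵇ P.t))) :=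
  tensorHom (.id P.h) G.γ

/-- The map `x ⊗ v ↦ γ(x) ⊗ v`, with the result written as an element of
`T ⊗ (That ⊗ (T ⊗ That))`. -/
def γh : Hom (P.t ⊗ᵇ P.h) (P.t ⊗ᵇ (P.h ⊗ᵇ (P.t ⊗ᵇ P.h))) :=
  (tensorHom (.id P.t) (assoc P.h P.t P.h)).comp
    ((assoc P.t (P.h ⊗ᵇ P.t) P.h).comp (tensorHom G.γ (.id P.h)))

/-- The map `v ⊗ x ⊗ w ↦ v ⊗ γ(x) ⊗ w`. -/
def hγh : Hom (P.h ⊗ᵇ (P.t ⊗ᵇ P.h)) (P.h ⊗ᵇ (P.t ⊗ᵇ (P.h ⊗ᵇ (P.t ⊗ᵇ P.h)))) :=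
  tensorHom (.id P.h) G.γh

/-- The sub-bimodule `C` of `That ⊗_S T`: the equaliser of
`(ev ⊗ That ⊗ T) ∘ (That ⊗ γ)` and `α ⊗ That ⊗ T`. -/
def subC : SubBimodule (P.h ⊗ᵇ P.t) :=
  SubBimodule.equaliser
    ((tensorHom P.evR (.id (P.h ⊗ᵇ P.t))).comp ((assocInv P.h P.t (P.h ⊗ᵇ P.t)).comp G.hγ))
    ((tensorHom (unitHom α) (.id (P.h ⊗ᵇ P.t))).comp (lunitInv (P.h ⊗ᵇ P.t)))

/-- The map `x ⊗ v ↦ x⁽¹⁾ ⊗ x⁽²⁾ ⊗ evHat (x⁽³⁾ ⊗ v)`. -/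
def γEvHat : Hom (P.t ⊗ᵇ P.h) (P.t ⊗ᵇ (P.h ⊗ᵇ P.b)) :=
  (tensorHom (.id P.t) (tensorHom (.id P.h) P.evHatS)).comp G.γh

/-- The sub-bimodule `D` of `T ⊗_R That`: the equaliser of
`(T ⊗ That ⊗ evHat) ∘ (γ ⊗ That)` and `T ⊗ That ⊗ β`. -/
def subD : SubBimodule (P.t ⊗ᵇ P.h) :=
  SubBimodule.equaliser G.γEvHat
    (tensorHom (.id P.t) ((tensorHom (.id P.h) (unitHom β)).comp (runitInv P.h)))

/-- The `R`-bimodule `C`. -/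
def C : Bimodule R R := G.subC.toBimodule

/-- The `S`-bimodule `D`. -/
def D : Bimodule S S := G.subD.toBimodule

/-- The inclusion of `C` in `That ⊗_S T`. -/
def ιC : Hom G.C (P.h ⊗ᵇ P.t) := G.subC.incl

/-- The inclusion of `D` in `T ⊗_R That`. -/
def ιD : Hom G.D (P.t ⊗ᵇ P.h) := G.subD.incl

/-- The map `C ⊗_R That → That ⊗_S T ⊗_R That`. -/
def leftIncl : Hom (G.C ⊗ᵇ P.h) (P.h ⊗ᵇ (P.t ⊗ᵇ P.h)) :=
  (assoc P.h P.t P.h).comp (tensorHom G.ιC (.id P.h))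

/-- The map `That ⊗_S D → That ⊗_S T ⊗_R That`. -/
def rightIncl : Hom (P.h ⊗ᵇ G.D) (P.h ⊗ᵇ (P.t ⊗ᵇ P.h)) :=
  tensorHom (.id P.h) G.ιD

/-- The sub-bimodule `(C ⊗_R That) ∩ (That ⊗_S D)` of `That ⊗_S T ⊗_R That`. -/
def subTbar : SubBimodule (P.h ⊗ᵇ (P.t ⊗ᵇ P.h)) :=
  (SubBimodule.range G.leftIncl).inter (SubBimodule.range G.rightIncl)

/-- The `R`-`S` bimodule `(C ⊗_R That) ∩ (That ⊗_S D)`. -/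
def Tbar : Bimodule R S := G.subTbar.toBimodule

/-- The inclusion of `Tbar` in `That ⊗_S T ⊗_R That`. -/
def ιTbar : Hom G.Tbar (P.h ⊗ᵇ (P.t ⊗ᵇ P.h)) := G.subTbar.incl

/-! The inclusions of the tensor products of `C`, `D`, `T` and `Tbar` in tensor products of
copies of `T` and `That`, the latter bracketed to the right. -/

/-- `C ⊗ C → That ⊗ T ⊗ That ⊗ T`. -/
def inclCC : Hom (G.C ⊗ᵇ G.C) (P.h ⊗ᵇ (P.t ⊗ᵇ (P.h ⊗ᵇ P.t))) :=
  (assoc P.h P.t (P.h ⊗ᵇ P.t)).comp (tensorHom G.ιC G.ιC)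

/-- `D ⊗ D → T ⊗ That ⊗ T ⊗ That`. -/
def inclDD : Hom (G.D ⊗ᵇ G.D) (P.t ⊗ᵇ (P.h ⊗ᵇ (P.t ⊗ᵇ P.h))) :=
  (assoc P.t P.h (P.t ⊗ᵇ P.h)).comp (tensorHom G.ιD G.ιD)

/-- `T ⊗ C → T ⊗ That ⊗ T`. -/
def inclTC : Hom (P.t ⊗ᵇ G.C) (P.t ⊗ᵇ (P.h ⊗ᵇ P.t)) :=
  tensorHom (.id P.t) G.ιC

/-- `D ⊗ T → T ⊗ That ⊗ T`. -/
def inclDT : Hom (G.D ⊗ᵇ P.t) (P.t ⊗ᵇ (P.h ⊗ᵇ P.t)) :=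
  (assoc P.t P.h P.t).comp (tensorHom G.ιD (.id P.t))

/-- `C ⊗ Tbar → That ⊗ T ⊗ That ⊗ T ⊗ That`. -/
def inclCTbar : Hom (G.C ⊗ᵇ G.Tbar) (P.h ⊗ᵇ (P.t ⊗ᵇ (P.h ⊗ᵇ (P.t ⊗ᵇ P.h)))) :=
  (assoc P.h P.t (P.h ⊗ᵇ (P.t ⊗ᵇ P.h))).comp (tensorHom G.ιC G.ιTbar)

/-- `Tbar ⊗ D → That ⊗ T ⊗ That ⊗ T ⊗ That`. -/
def inclTbarD : Hom (G.Tbar ⊗ᵇ G.D) (P.h ⊗ᵇ (P.t ⊗ᵇ (P.h ⊗ᵇ (P.t ⊗ᵇ P.h)))) :=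
  (tensorHom (.id P.h) (assoc P.t P.h (P.t ⊗ᵇ P.h))).comp
    ((assoc P.h (P.t ⊗ᵇ P.h) (P.t ⊗ᵇ P.h)).comp (tensorHom G.ιTbar G.ιD))

/-- `Tbar ⊗ T → That ⊗ T ⊗ That ⊗ T`. -/
def inclTbarT : Hom (G.Tbar ⊗ᵇ P.t) (P.h ⊗ᵇ (P.t ⊗ᵇ (P.h ⊗ᵇ P.t))) :=
  (tensorHom (.id P.h) (assoc P.t P.h P.t)).comp
    ((assoc P.h (P.t ⊗ᵇ P.h) P.t).comp (tensorHom G.ιTbar (.id P.t)))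

/-- `T ⊗ Tbar → T ⊗ That ⊗ T ⊗ That`. -/
def inclTTbar : Hom (P.t ⊗ᵇ G.Tbar) (P.t ⊗ᵇ (P.h ⊗ᵇ (P.t ⊗ᵇ P.h))) :=
  tensorHom (.id P.t) G.ιTbar

/-- All these inclusions, and the ring maps `α` and `β`, are injective. -/
structure InclusionsInjective : Prop where
  α : Function.Injective α
  β : Function.Injective β
  left : Function.Injective G.leftIncl
  right : Function.Injective G.rightIncl
  CC : Function.Injective G.inclCC
  DD : Function.Injective G.inclDD
  TC : Function.Injective G.inclTC
  DT : Function.Injective G.inclDT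
  CTbar : Function.Injective G.inclCTbar
  TbarD : Function.Injective G.inclTbarD
  TbarT : Function.Injective G.inclTbarT
  TTbar : Function.Injective G.inclTTbar

/-- The coring structure on `C` is the one given by `Δ(v ⊗ x) = v ⊗ γ(x)` and `ε = ev`. -/
structure IsCoringC (cC : Coring G.C) : Prop where
  comul : ∀ c : G.C, G.inclCC (cC.comul c) = G.hγ (G.ιC c)
  counit : ∀ c : G.C, unitHom α (cC.counit c) = P.evR (G.ιC c)

/-- The coring structure on `D` is the one given by `Δ(x ⊗ v) = γ(x) ⊗ v` and
`ε = evHat`. -/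
structure IsCoringD (cD : Coring G.D) : Prop where
  comul : ∀ d : G.D, G.inclDD (cD.comul d) = G.γh (G.ιD d)
  counit : ∀ d : G.D, unitHom β (cD.counit d) = P.evHatS (G.ιD d)

end Shepherd

end

end BimoduleHerds

end

open BimoduleHerds BimoduleHerds.Bimodule

/-! The axioms to be proved are formal consequences of those of `γ`. The difficulty is that `C`, `D`
and `Tbar` are cut out by equations inside tensor products of `T` and `That`, and a subobject need
not stay one after tensoring. Faithfully flat descent overcomes this. Write γ(x) = x₁ ⊗ x₂ ⊗ x₃.

Tensored on the left with `T` over `R`, the fork defining `C` becomes a split equaliser. The action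
T ⊗ A → T undoes the unit A-factor. Coassociativity and the axiom for ev show that γ takes values in
T ⊗ C, which gives the retraction x ⊗ v ⊗ y ↦ x ev(v ⊗ y₁) ⊗ (y₂ ⊗ y₃). Split equalisers survive all
further tensoring, and T ⊗ - reflects equalisers, so C ⊗ Z is the expected equaliser for every Z
(`isEq_tail_ιC`). Symmetrically, Z ⊗ D is one for every Z (`isEq_whiskerLeft_ιD`). On the opposite
sides only T ⊗ C and D ⊗ T are shown to be stable under tensoring, which suffices for the products
that occur. The same argument for R → A ⇉ A ⊗ A gives injectivity of α and ev(C) ⊆ α(R), and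
likewise for β.

`Tbar` is then an equaliser inside That ⊗ D and also inside C ⊗ That. It follows that γ ⊗ That maps
D into T ⊗ Tbar and That ⊗ γ maps C into Tbar ⊗ T. These are the companion maps, and they also
supply retractions splitting T ⊗ Tbar → T ⊗ That ⊗ D and Tbar ⊗ T → C ⊗ That ⊗ T
(`isSplit_whiskerLeft_κD`, `isSplit_tail_κC`). Hence all the required products embed.

Each structure map is now the unique factorisation of an insertion of γ, or of an evaluation,
through an injective map, and each axiom is checked after embedding. Coassociativity, colinearity
and the companion diagrams all become coassociativity of γ. The counit laws become the two
evaluation axioms or the equations defining C, D and Tbar. Finally χ is the restriction of a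
contraction defined on all of T ⊗ That ⊗ T ⊗ That ⊗ T, whose associativity uses only the
compatibility of the two evaluations (`contract_contract`). -/

noncomputable section

/-! ### Calculus of whiskering, associativity and unit maps for bimodules. -/

namespace BimoduleHerds

namespace Bimodule

/-- Whiskering a bimodule map on the left. -/
notation:71 N:72 " ◁ᵇ " f:71 => tensorHom (Hom.id N) f

/-- Whiskering a bimodule map on the right. -/
notation:71 f:71 " ▷ᵇ " N:72 => tensorHom f (Hom.id N)

section

variable {K L M N O Q : Type u} [Ring K] [Ring L] [Ring M] [Ring N] [Ring O] [Ring Q]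

@[simp] theorem Hom.id_apply (X : Bimodule K L) (x : X) : Hom.id X x = x := rfl

@[simp] theorem Hom.comp_apply {X Y Z : Bimodule K L} (g : Hom Y Z) (f : Hom X Y) (x : X) :
    g.comp f x = g (f x) := rfl

theorem Hom.ext {X Y : Bimodule K L} {f g : Hom X Y} (h : ∀ x, f x = g x) : f = g :=
  DFunLike.ext f g h

theorem Hom.congr {X Y : Bimodule K L} {f g : Hom X Y} (h : f = g) (x : X) : f x = g x :=
  DFunLike.congr_fun h x

theorem Hom.map_smul {X Y : Bimodule K L} (f : Hom X Y) (k : K) (x : X) : f (k • x) = k • f x :=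
  f.map_smul' k x

theorem Hom.map_op_smul {X Y : Bimodule K L} (f : Hom X Y) (l : Lᵐᵒᵖ) (x : X) :
    f (l • x) = l • f x :=
  f.map_op_smul' l x

theorem zero_tmul {X : Bimodule K L} {Y : Bimodule L M} (y : Y) : tmul (0 : X) y = 0 :=
  _root_.map_zero ((mkHom X Y).flip y)

theorem tmul_zero {X : Bimodule K L} {Y : Bimodule L M} (x : X) : tmul x (0 : Y) = 0 :=
  _root_.map_zero (mkHom X Y x)

theorem induction_right {X : Bimodule K L} {Y : Bimodule L M} {Z : Bimodule M N}
    {p : (X ⊗ᵇ (Y ⊗ᵇ Z) : Bimodule K N) → Prop} (w : (X ⊗ᵇ (Y ⊗ᵇ Z) : Bimodule K N)) (h0 : p 0)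
    (ht : ∀ x y z, p (tmul x (tmul y z))) (ha : ∀ x y, p x → p y → p (x + y)) : p w := by
  induction w using induction_on with
  | h0 => exact h0
  | ha x y hx hy => exact ha x y hx hy
  | ht x w =>
    induction w using induction_on with
    | h0 => rw [tmul_zero]; exact h0
    | ha y y' hy hy' => rw [tmul_add]; exact ha _ _ hy hy'
    | ht y z => exact ht x y z

theorem induction_left {X : Bimodule K L} {Y : Bimodule L M} {Z : Bimodule M N}
    {p : ((X ⊗ᵇ Y) ⊗ᵇ Z : Bimodule K N) → Prop} (w : ((X ⊗ᵇ Y) ⊗ᵇ Z : Bimodule K N)) (h0 : p 0)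
    (ht : ∀ x y z, p (tmul (tmul x y) z)) (ha : ∀ x y, p x → p y → p (x + y)) : p w := by
  induction w using induction_on with
  | h0 => exact h0
  | ha x y hx hy => exact ha x y hx hy
  | ht w z =>
    induction w using induction_on with
    | h0 => rw [zero_tmul]; exact h0
    | ha y y' hy hy' => rw [add_tmul]; exact ha _ _ hy hy'
    | ht x y => exact ht x y z

theorem tensorHom_id (X : Bimodule K L) (Y : Bimodule L M) (z : (X ⊗ᵇ Y : Bimodule K M)) :
    tensorHom (Hom.id X) (Hom.id Y) z = z := by
  induction z using induction_on with
  | h0 => rw [map_zero]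
  | ht x y => rfl
  | ha x y hx hy => rw [map_add, hx, hy]

/-! Equations between compositions may be whiskered. -/

theorem whiskerLeft_comp (X : Bimodule K L) {Y Y' Y'' : Bimodule L M}
    {g : Hom Y' Y''} {f : Hom Y Y'} {k : Hom Y Y''} (h : ∀ y, g (f y) = k y)
    (z : (X ⊗ᵇ Y : Bimodule K M)) : (X ◁ᵇ g) ((X ◁ᵇ f) z) = (X ◁ᵇ k) z := by
  induction z using induction_on with
  | h0 => simp only [map_zero]
  | ht x y => exact congrArg (tmul x) (h y)
  | ha x y hx hy => simp only [map_add, hx, hy]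

theorem whiskerLeft_comm (X : Bimodule K L) {Y Y₁ Y₂ Y₃ : Bimodule L M}
    {g : Hom Y₁ Y₃} {f : Hom Y Y₁} {k : Hom Y₂ Y₃} {l : Hom Y Y₂} (h : ∀ y, g (f y) = k (l y))
    (z : (X ⊗ᵇ Y : Bimodule K M)) : (X ◁ᵇ g) ((X ◁ᵇ f) z) = (X ◁ᵇ k) ((X ◁ᵇ l) z) := by
  induction z using induction_on with
  | h0 => simp only [map_zero]
  | ht x y => exact congrArg (tmul x) (h y)
  | ha x y hx hy => simp only [map_add, hx, hy]

theorem whiskerLeft_cancel (X : Bimodule K L) {Y Y' : Bimodule L M}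
    {g : Hom Y' Y} {f : Hom Y Y'} (h : ∀ y, g (f y) = y)
    (z : (X ⊗ᵇ Y : Bimodule K M)) : (X ◁ᵇ g) ((X ◁ᵇ f) z) = z :=
  (whiskerLeft_comp X (k := Hom.id Y) h z).trans (tensorHom_id _ _ z)

theorem whiskerRight_comp (X : Bimodule L M) {Y Y' Y'' : Bimodule K L}
    {g : Hom Y' Y''} {f : Hom Y Y'} {k : Hom Y Y''} (h : ∀ y, g (f y) = k y)
    (z : (Y ⊗ᵇ X : Bimodule K M)) : (g ▷ᵇ X) ((f ▷ᵇ X) z) = (k ▷ᵇ X) z := by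
  induction z using induction_on with
  | h0 => simp only [map_zero]
  | ht y x => exact congrArg (fun t => tmul t x) (h y)
  | ha x y hx hy => simp only [map_add, hx, hy]

theorem whiskerRight_comm (X : Bimodule L M) {Y Y₁ Y₂ Y₃ : Bimodule K L}
    {g : Hom Y₁ Y₃} {f : Hom Y Y₁} {k : Hom Y₂ Y₃} {l : Hom Y Y₂} (h : ∀ y, g (f y) = k (l y))
    (z : (Y ⊗ᵇ X : Bimodule K M)) : (g ▷ᵇ X) ((f ▷ᵇ X) z) = (k ▷ᵇ X) ((l ▷ᵇ X) z) := by
  induction z using induction_on with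
  | h0 => simp only [map_zero]
  | ht y x => exact congrArg (fun t => tmul t x) (h y)
  | ha x y hx hy => simp only [map_add, hx, hy]

theorem whiskerRight_cancel (X : Bimodule L M) {Y Y' : Bimodule K L}
    {g : Hom Y' Y} {f : Hom Y Y'} (h : ∀ y, g (f y) = y)
    (z : (Y ⊗ᵇ X : Bimodule K M)) : (g ▷ᵇ X) ((f ▷ᵇ X) z) = z :=
  (whiskerRight_comp X (k := Hom.id Y) h z).trans (tensorHom_id _ _ z)

theorem whisker_exchange {X X' : Bimodule K L} {Y Y' : Bimodule L M} (f : Hom X X') (g : Hom Y Y')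
    (z : (X ⊗ᵇ Y : Bimodule K M)) : (f ▷ᵇ Y') ((X ◁ᵇ g) z) = (X' ◁ᵇ g) ((f ▷ᵇ Y) z) := by
  induction z using induction_on with
  | h0 => simp only [map_zero]
  | ht x y => rfl
  | ha x y hx hy => simp only [map_add, hx, hy]

theorem tensorHom_eq_right {X X' : Bimodule K L} {Y Y' : Bimodule L M} (f : Hom X X') (g : Hom Y Y')
    (z : (X ⊗ᵇ Y : Bimodule K M)) : tensorHom f g z = (f ▷ᵇ Y') ((X ◁ᵇ g) z) := by
  induction z using induction_on with
  | h0 => simp only [map_zero]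
  | ht x y => rfl
  | ha x y hx hy => simp only [map_add, hx, hy]

theorem assoc_assocInv (X : Bimodule K L) (Y : Bimodule L M) (Z : Bimodule M N)
    (w : (X ⊗ᵇ (Y ⊗ᵇ Z) : Bimodule K N)) : assoc X Y Z (assocInv X Y Z w) = w := by
  induction w using induction_right with
  | h0 => simp only [map_zero]
  | ht x y z => rfl
  | ha x y hx hy => simp only [map_add, hx, hy]

theorem assocInv_assoc (X : Bimodule K L) (Y : Bimodule L M) (Z : Bimodule M N)
    (w : ((X ⊗ᵇ Y) ⊗ᵇ Z : Bimodule K N)) : assocInv X Y Z (assoc X Y Z w) = w := by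
  induction w using induction_left with
  | h0 => simp only [map_zero]
  | ht x y z => rfl
  | ha x y hx hy => simp only [map_add, hx, hy]

theorem assoc_naturality {X X' : Bimodule K L} {Y Y' : Bimodule L M} {Z Z' : Bimodule M N}
    (f : Hom X X') (g : Hom Y Y') (h : Hom Z Z') (w : ((X ⊗ᵇ Y) ⊗ᵇ Z : Bimodule K N)) :
    assoc X' Y' Z' (tensorHom (tensorHom f g) h w)
      = tensorHom f (tensorHom g h) (assoc X Y Z w) := by
  induction w using induction_left with
  | h0 => simp only [map_zero]
  | ht x y z => rfl
  | ha x y hx hy => simp only [map_add, hx, hy]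

theorem assocInv_naturality {X X' : Bimodule K L} {Y Y' : Bimodule L M} {Z Z' : Bimodule M N}
    (f : Hom X X') (g : Hom Y Y') (h : Hom Z Z') (w : (X ⊗ᵇ (Y ⊗ᵇ Z) : Bimodule K N)) :
    assocInv X' Y' Z' (tensorHom f (tensorHom g h) w)
      = tensorHom (tensorHom f g) h (assocInv X Y Z w) := by
  induction w using induction_right with
  | h0 => simp only [map_zero]
  | ht x y z => rfl
  | ha x y hx hy => simp only [map_add, hx, hy]

theorem assoc_naturality_right (X : Bimodule K L) (Y : Bimodule L M) {Z Z' : Bimodule M N}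
    (h : Hom Z Z') (w : ((X ⊗ᵇ Y) ⊗ᵇ Z : Bimodule K N)) :
    assoc X Y Z' (((X ⊗ᵇ Y) ◁ᵇ h) w) = (X ◁ᵇ Y ◁ᵇ h) (assoc X Y Z w) := by
  induction w using induction_left with
  | h0 => simp only [map_zero]
  | ht x y z => rfl
  | ha x y hx hy => simp only [map_add, hx, hy]

theorem lunitInv_lunit (X : Bimodule K L) (z : (reg K ⊗ᵇ X : Bimodule K L)) :
    lunitInv X (lunit X z) = z := by
  induction z using induction_on with
  | h0 => simp only [map_zero]
  | ha x y hx hy => simp only [map_add, hx, hy]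
  | ht k x =>
    refine ((lunitInv X).map_smul k x).trans ?_
    exact congrArg (fun t => tmul (X := reg K) t x) (mul_one (M := K) k)

theorem runitInv_runit (X : Bimodule K L) (z : (X ⊗ᵇ reg L : Bimodule K L)) :
    runitInv X (runit X z) = z := by
  induction z using induction_on with
  | h0 => simp only [map_zero]
  | ha x y hx hy => simp only [map_add, hx, hy]
  | ht x k =>
    refine ((runitInv X).map_op_smul (op k) x).trans ?_
    exact congrArg (tmul (Y := reg L) x) (one_mul (M := L) k)

theorem whiskerLeft_comp_apply (X : Bimodule K L) {Y Y' Y'' : Bimodule L M} (g : Hom Y' Y'')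
    (f : Hom Y Y') (z : (X ⊗ᵇ Y : Bimodule K M)) :
    (X ◁ᵇ (g.comp f)) z = (X ◁ᵇ g) ((X ◁ᵇ f) z) :=
  (whiskerLeft_comp X (fun _ => rfl) z).symm

theorem whiskerRight_comp_apply (X : Bimodule L M) {Y Y' Y'' : Bimodule K L} (g : Hom Y' Y'')
    (f : Hom Y Y') (z : (Y ⊗ᵇ X : Bimodule K M)) :
    ((g.comp f) ▷ᵇ X) z = (g ▷ᵇ X) ((f ▷ᵇ X) z) :=
  (whiskerRight_comp X (fun _ => rfl) z).symm

/-- The lift of a bimodule map through an injective bimodule map containing its image. -/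
def liftThrough {X Y Z : Bimodule K L} (i : Hom X Y) (hi : Function.Injective i) (f : Hom Z Y)
    (h : ∀ z, f z ∈ Set.range i) : Hom Z X where
  -- Preimages are chosen pointwise. Injectivity of `i` makes them unique, so every linearity law is
  -- checked after applying `i`.
  toFun z := (h z).choose
  map_zero' := hi (by rw [(h 0).choose_spec, map_zero, map_zero])
  map_add' x y := hi (by
    rw [(h (x + y)).choose_spec, map_add, map_add, (h x).choose_spec, (h y).choose_spec])
  map_smul' k x := hi (by
    rw [(h (k • x)).choose_spec, i.map_smul, f.map_smul, (h x).choose_spec])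
  map_op_smul' l x := hi (by
    rw [(h (l • x)).choose_spec, i.map_op_smul, f.map_op_smul, (h x).choose_spec])

theorem liftThrough_apply {X Y Z : Bimodule K L} (i : Hom X Y) (hi : Function.Injective i)
    (f : Hom Z Y) (h : ∀ z, f z ∈ Set.range i) (z : Z) : i (liftThrough i hi f h z) = f z :=
  (h z).choose_spec

/-! ### Maps extended by a tensor factor on the right, with values in right-bracketed products -/

/-- The map `f ⊗ Z`, for `f` with values in a product of two factors. -/
def tail₂ {X : Bimodule K N} {Y₁ : Bimodule K L} {Y₂ : Bimodule L N}
    (f : Hom X (Y₁ ⊗ᵇ Y₂)) (Z : Bimodule N O) : Hom (X ⊗ᵇ Z) (Y₁ ⊗ᵇ (Y₂ ⊗ᵇ Z)) :=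
  (assoc Y₁ Y₂ Z).comp (f ▷ᵇ Z)

/-- The map `f ⊗ Z`, for `f` with values in a product of three factors. -/
def tail₃ {X : Bimodule K N} {Y₁ : Bimodule K L} {Y₂ : Bimodule L M} {Y₃ : Bimodule M N}
    (f : Hom X (Y₁ ⊗ᵇ (Y₂ ⊗ᵇ Y₃))) (Z : Bimodule N O) :
    Hom (X ⊗ᵇ Z) (Y₁ ⊗ᵇ (Y₂ ⊗ᵇ (Y₃ ⊗ᵇ Z))) :=
  (Y₁ ◁ᵇ assoc Y₂ Y₃ Z).comp ((assoc Y₁ (Y₂ ⊗ᵇ Y₃) Z).comp (f ▷ᵇ Z))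

/-- The map `f ⊗ Z`, for `f` defined on a product of two factors. -/
def head₂ {X : Bimodule K N} {Y₁ : Bimodule K L} {Y₂ : Bimodule L N}
    (f : Hom (Y₁ ⊗ᵇ Y₂) X) (Z : Bimodule N O) : Hom (Y₁ ⊗ᵇ (Y₂ ⊗ᵇ Z)) (X ⊗ᵇ Z) :=
  (f ▷ᵇ Z).comp (assocInv Y₁ Y₂ Z)

/-- The rebracketing `y₁ ⊗ (y₂ ⊗ (y₃ ⊗ z)) ↦ (y₁ ⊗ (y₂ ⊗ y₃)) ⊗ z`. -/
def untail₃ (Y₁ : Bimodule K L) (Y₂ : Bimodule L M) (Y₃ : Bimodule M N) (Z : Bimodule N O) :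
    Hom (Y₁ ⊗ᵇ (Y₂ ⊗ᵇ (Y₃ ⊗ᵇ Z))) ((Y₁ ⊗ᵇ (Y₂ ⊗ᵇ Y₃)) ⊗ᵇ Z) :=
  (assocInv Y₁ (Y₂ ⊗ᵇ Y₃) Z).comp (Y₁ ◁ᵇ assocInv Y₂ Y₃ Z)

theorem untail₃_tail₃ {X : Bimodule K N} {Y₁ : Bimodule K L} {Y₂ : Bimodule L M}
    {Y₃ : Bimodule M N} (f : Hom X (Y₁ ⊗ᵇ (Y₂ ⊗ᵇ Y₃))) {Z : Bimodule N O}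
    (w : (X ⊗ᵇ Z : Bimodule K O)) : untail₃ Y₁ Y₂ Y₃ Z (tail₃ f Z w) = (f ▷ᵇ Z) w := by
  refine (congrArg (assocInv _ _ _) (whiskerLeft_cancel Y₁ (assocInv_assoc Y₂ Y₃ Z) _)).trans ?_
  exact assocInv_assoc _ _ _ _

theorem tail₃_id_whisker {X : Bimodule K N} {Y₁ : Bimodule K L} {Y₂ : Bimodule L M}
    {Y₃ : Bimodule M N} (f : Hom X (Y₁ ⊗ᵇ (Y₂ ⊗ᵇ Y₃))) {Z : Bimodule N O}
    (w : (X ⊗ᵇ Z : Bimodule K O)) : tail₃ (.id _) Z ((f ▷ᵇ Z) w) = tail₃ f Z w :=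
  congrArg (fun z => (Y₁ ◁ᵇ assoc Y₂ Y₃ Z) (assoc Y₁ (Y₂ ⊗ᵇ Y₃) Z z)) (tensorHom_id _ _ _)

/-- Rebracketing is invertible. This permits equations in a left-bracketed product to be compared in
the right-bracketed one, where the herd maps are expressed. -/
theorem tail₃_id_injective (Y₁ : Bimodule K L) (Y₂ : Bimodule L M) (Y₃ : Bimodule M N)
    (Z : Bimodule N O) : Function.Injective (tail₃ (.id (Y₁ ⊗ᵇ (Y₂ ⊗ᵇ Y₃))) Z) :=
  Function.LeftInverse.injective (g := untail₃ Y₁ Y₂ Y₃ Z) fun _ =>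
    (untail₃_tail₃ _ _).trans (tensorHom_id _ _ _)

theorem tail₂_tmul {X : Bimodule K N} {Y₁ : Bimodule K L} {Y₂ : Bimodule L N}
    (f : Hom X (Y₁ ⊗ᵇ Y₂)) {Z : Bimodule N O} (x : X) (z : Z) :
    tail₂ f Z (tmul x z) = assoc Y₁ Y₂ Z (tmul (f x) z) := rfl

theorem tail₃_tmul {X : Bimodule K N} {Y₁ : Bimodule K L} {Y₂ : Bimodule L M} {Y₃ : Bimodule M N}
    (f : Hom X (Y₁ ⊗ᵇ (Y₂ ⊗ᵇ Y₃))) {Z : Bimodule N O} (x : X) (z : Z) :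
    tail₃ f Z (tmul x z) = tail₃ (.id (Y₁ ⊗ᵇ (Y₂ ⊗ᵇ Y₃))) Z (tmul (f x) z) := rfl

theorem tail₃_comp {X X' : Bimodule K N} {Y₁ : Bimodule K L} {Y₂ : Bimodule L M}
    {Y₃ : Bimodule M N} {f : Hom X (Y₁ ⊗ᵇ (Y₂ ⊗ᵇ Y₃))} {g : Hom X' X}
    {k : Hom X' (Y₁ ⊗ᵇ (Y₂ ⊗ᵇ Y₃))} (h : ∀ x, f (g x) = k x) {Z : Bimodule N O}
    (w : (X' ⊗ᵇ Z : Bimodule K O)) : tail₃ f Z ((g ▷ᵇ Z) w) = tail₃ k Z w :=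
  congrArg (fun z => (Y₁ ◁ᵇ assoc Y₂ Y₃ Z) (assoc Y₁ (Y₂ ⊗ᵇ Y₃) Z z)) (whiskerRight_comp Z h w)

/-- A form of the pentagon: adjoining `Z` and then `W` agrees with adjoining `Z ⊗ W` at once. -/
theorem tail₃_tail₂ {X : Bimodule K M} {Y₁ : Bimodule K L} {Y₂ : Bimodule L M}
    (f : Hom X (Y₁ ⊗ᵇ Y₂)) {Z : Bimodule M N} {W : Bimodule N O}
    (w : ((X ⊗ᵇ Z) ⊗ᵇ W : Bimodule K O)) :
    tail₃ (tail₂ f Z) W w = tail₂ f (Z ⊗ᵇ W) (assoc X Z W w) := by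
  induction w using induction_left with
  | h0 => simp only [map_zero]
  | ha x y hx hy => simp only [map_add, hx, hy]
  | ht x z w =>
    change tail₃ (.id _) W (tmul (assoc _ _ _ (tmul (f x) z)) w)
      = assoc _ _ _ (tmul (f x) (tmul z w))
    -- The value `f x` is not a simple tensor in general. Both sides are additive in it, so it is
    -- replaced by an arbitrary element to allow induction; the same device recurs below.
    generalize f x = u
    induction u using induction_on with
    | h0 => simp only [zero_tmul, map_zero]
    | ha x y hx hy => simp only [add_tmul, map_add, hx, hy]
    | ht x v => rfl

theorem tail₂_naturality {X : Bimodule K N} {Y₁ : Bimodule K L} {Y₂ : Bimodule L N}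
    (f : Hom X (Y₁ ⊗ᵇ Y₂)) {Z Z' : Bimodule N O} (g : Hom Z Z') (w : (X ⊗ᵇ Z : Bimodule K O)) :
    tail₂ f Z' ((X ◁ᵇ g) w) = (Y₁ ◁ᵇ Y₂ ◁ᵇ g) (tail₂ f Z w) := by
  refine (congrArg (assoc Y₁ Y₂ Z') (whisker_exchange f g w)).trans ?_
  exact assoc_naturality_right Y₁ Y₂ g _

theorem tail₃_naturality {X : Bimodule K N} {Y₁ : Bimodule K L} {Y₂ : Bimodule L M}
    {Y₃ : Bimodule M N} (f : Hom X (Y₁ ⊗ᵇ (Y₂ ⊗ᵇ Y₃))) {Z Z' : Bimodule N O} (g : Hom Z Z')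
    (w : (X ⊗ᵇ Z : Bimodule K O)) :
    tail₃ f Z' ((X ◁ᵇ g) w) = (Y₁ ◁ᵇ Y₂ ◁ᵇ Y₃ ◁ᵇ g) (tail₃ f Z w) := by
  refine (congrArg (Y₁ ◁ᵇ assoc Y₂ Y₃ Z') (tail₂_naturality f g w)).trans ?_
  exact whiskerLeft_comm Y₁ (assoc_naturality_right Y₂ Y₃ g) _

theorem head₂_naturality {X : Bimodule K N} {Y₁ : Bimodule K L} {Y₂ : Bimodule L N}
    (f : Hom (Y₁ ⊗ᵇ Y₂) X) {Z Z' : Bimodule N O} (g : Hom Z Z')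
    (w : (Y₁ ⊗ᵇ (Y₂ ⊗ᵇ Z) : Bimodule K O)) :
    head₂ f Z' ((Y₁ ◁ᵇ Y₂ ◁ᵇ g) w) = (X ◁ᵇ g) (head₂ f Z w) := by
  induction w using induction_right with
  | h0 => simp only [map_zero]
  | ht x y z => rfl
  | ha x y hx hy => simp only [map_add, hx, hy]

/-- Coproducts and coactions are specified by equations (i ⊗ j) ∘ f = g with inclusions `i`, `j`.
This extends such a specification by a right factor `Z`; `e` is kept general so that it can be the
rebracketing required by the values of `j`. -/
theorem tail₂_whisker_tail₂ {X : Bimodule K N} {Y₁ : Bimodule K M} {Y₂ : Bimodule M N}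
    {W₁ : Bimodule K L} {W₂ : Bimodule L M} {V : Bimodule M N} {Z : Bimodule N O}
    {V' : Bimodule M O} {i : Hom Y₁ (W₁ ⊗ᵇ W₂)} {j : Hom Y₂ V} (e : Hom (V ⊗ᵇ Z) V')
    {f : Hom X (Y₁ ⊗ᵇ Y₂)} {g : Hom X (W₁ ⊗ᵇ (W₂ ⊗ᵇ V))}
    (h : ∀ x, tail₂ i V ((Y₁ ◁ᵇ j) (f x)) = g x) (y : (X ⊗ᵇ Z : Bimodule K O)) :
    tail₂ i V' ((Y₁ ◁ᵇ (e.comp (j ▷ᵇ Z))) (tail₂ f Z y)) = (W₁ ◁ᵇ W₂ ◁ᵇ e) (tail₃ g Z y) := by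
  induction y using induction_on with
  | h0 => simp only [map_zero]
  | ha x y hx hy => simp only [map_add, hx, hy]
  | ht x z =>
    rw [tail₃_tmul g, ← h, tail₂_tmul]
    generalize f x = w
    induction w using induction_on with
    | h0 => simp only [zero_tmul, map_zero]
    | ha x y hx hy => simp only [add_tmul, map_add, hx, hy]
    | ht y₁ y₂ =>
      rw [assoc_tmul, tensorHom_tmul, tail₂_tmul, tensorHom_tmul, tail₂_tmul, Hom.id_apply]
      generalize i y₁ = w
      induction w using induction_on with
      | h0 => simp only [zero_tmul, map_zero]
      | ha x y hx hy => simp only [add_tmul, map_add, hx, hy]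
      | ht x v => rfl

theorem tail₃_whisker_tail₂ {X : Bimodule K N} {Y₁ : Bimodule K M} {Y₂ : Bimodule M N}
    {W₁ : Bimodule K L} {W₂ : Bimodule L Q} {W₃ : Bimodule Q M} {V : Bimodule M N}
    {Z : Bimodule N O} {V' : Bimodule M O} {i : Hom Y₁ (W₁ ⊗ᵇ (W₂ ⊗ᵇ W₃))} {j : Hom Y₂ V}
    (e : Hom (V ⊗ᵇ Z) V') {f : Hom X (Y₁ ⊗ᵇ Y₂)} {g : Hom X (W₁ ⊗ᵇ (W₂ ⊗ᵇ (W₃ ⊗ᵇ V)))}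
    (h : ∀ x, tail₃ i V ((Y₁ ◁ᵇ j) (f x)) = g x) (y : (X ⊗ᵇ Z : Bimodule K O)) :
    tail₃ i V' ((Y₁ ◁ᵇ (e.comp (j ▷ᵇ Z))) (tail₂ f Z y))
      = (W₁ ◁ᵇ W₂ ◁ᵇ W₃ ◁ᵇ e) ((W₁ ◁ᵇ tail₃ (.id _) Z) (tail₂ g Z y)) := by
  induction y using induction_on with
  | h0 => simp only [map_zero]
  | ha x y hx hy => simp only [map_add, hx, hy]
  | ht x z =>
    rw [tail₂_tmul g, ← h, tail₂_tmul]
    generalize f x = w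
    induction w using induction_on with
    | h0 => simp only [zero_tmul, map_zero]
    | ha x y hx hy => simp only [add_tmul, map_add, hx, hy]
    | ht y₁ y₂ =>
      rw [assoc_tmul, tensorHom_tmul, tail₃_tmul i, tensorHom_tmul, tail₃_tmul i, Hom.id_apply]
      generalize i y₁ = w
      induction w using induction_right with
      | h0 => simp only [zero_tmul, map_zero]
      | ha x y hx hy => simp only [add_tmul, map_add, hx, hy]
      | ht x v y => rfl

theorem tail₃_tail₂_of_eq {X : Bimodule K N} {Y₁ : Bimodule K M} {V : Bimodule M N}
    {W₁ : Bimodule K L} {W₂ : Bimodule L Q} {W₃ : Bimodule Q M} {Z : Bimodule N O}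
    {i : Hom Y₁ (W₁ ⊗ᵇ (W₂ ⊗ᵇ W₃))} {f : Hom X (Y₁ ⊗ᵇ V)} {g : Hom X (W₁ ⊗ᵇ (W₂ ⊗ᵇ (W₃ ⊗ᵇ V)))}
    (h : ∀ x, tail₃ i V (f x) = g x) (y : (X ⊗ᵇ Z : Bimodule K O)) :
    tail₃ i (V ⊗ᵇ Z) (tail₂ f Z y) = (W₁ ◁ᵇ tail₃ (.id _) Z) (tail₂ g Z y) := by
  induction y using induction_on with
  | h0 => simp only [map_zero]
  | ha x y hx hy => simp only [map_add, hx, hy]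
  | ht x z =>
    rw [tail₂_tmul g, ← h, tail₂_tmul]
    generalize f x = w
    induction w using induction_on with
    | h0 => simp only [zero_tmul, map_zero]
    | ha x y hx hy => simp only [add_tmul, map_add, hx, hy]
    | ht y₁ y₂ =>
      rw [assoc_tmul, tail₃_tmul i, tail₃_tmul i]
      generalize i y₁ = w
      induction w using induction_right with
      | h0 => simp only [zero_tmul, map_zero]
      | ha x y hx hy => simp only [add_tmul, map_add, hx, hy]
      | ht x v y => rfl

theorem whiskerLeft_tail₂ {X : Bimodule K N} {Y₁ : Bimodule K M} {Y₂ : Bimodule M N}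
    {V : Bimodule M N} {Z : Bimodule N O} {V' : Bimodule M O} {j : Hom Y₂ V}
    (e : Hom (V ⊗ᵇ Z) V') {f : Hom X (Y₁ ⊗ᵇ Y₂)} {g : Hom X (Y₁ ⊗ᵇ V)}
    (h : ∀ x, (Y₁ ◁ᵇ j) (f x) = g x) (y : (X ⊗ᵇ Z : Bimodule K O)) :
    (Y₁ ◁ᵇ (e.comp (j ▷ᵇ Z))) (tail₂ f Z y) = (Y₁ ◁ᵇ e) (tail₂ g Z y) := by
  induction y using induction_on with
  | h0 => simp only [map_zero]
  | ha x y hx hy => simp only [map_add, hx, hy]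
  | ht x z =>
    rw [tail₂_tmul g, ← h, tail₂_tmul]
    generalize f x = w
    induction w using induction_on with
    | h0 => simp only [zero_tmul, map_zero]
    | ha x y hx hy => simp only [add_tmul, map_add, hx, hy]
    | ht y₁ y₂ => rfl

theorem whiskerLeft_assoc_tail₃ {X : Bimodule K N} {W : Bimodule K L} {Y₁ : Bimodule L M}
    {Y₂ : Bimodule M Q} {Y₃ : Bimodule Q N} (f : Hom X (W ⊗ᵇ (Y₁ ⊗ᵇ (Y₂ ⊗ᵇ Y₃))))
    {Z : Bimodule N O} (y : (X ⊗ᵇ Z : Bimodule K O)) :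
    (W ◁ᵇ Y₁ ◁ᵇ assoc Y₂ Y₃ Z) (tail₃ f Z y) = (W ◁ᵇ tail₃ (.id _) Z) (tail₂ f Z y) :=
  whiskerLeft_comp W (fun z => congrArg (fun z => (Y₁ ◁ᵇ assoc Y₂ Y₃ Z)
    (assoc Y₁ (Y₂ ⊗ᵇ Y₃) Z z)) (tensorHom_id _ _ z).symm) _

theorem tail₃_whiskerLeft {X : Bimodule K N} {W : Bimodule K L} {X' : Bimodule L N}
    {Y₁ : Bimodule L M} {Y₂ : Bimodule M Q} {Y₃ : Bimodule Q N} (i : Hom X (W ⊗ᵇ X'))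
    (f : Hom X' (Y₁ ⊗ᵇ (Y₂ ⊗ᵇ Y₃))) {Z : Bimodule N O} (y : (X ⊗ᵇ Z : Bimodule K O)) :
    (W ◁ᵇ tail₃ (.id _) Z) (tail₂ ((W ◁ᵇ f).comp i) Z y) = (W ◁ᵇ tail₃ f Z) (tail₂ i Z y) := by
  induction y using induction_on with
  | h0 => simp only [map_zero]
  | ha x y hx hy => simp only [map_add, hx, hy]
  | ht x z =>
    rw [tail₂_tmul, tail₂_tmul, Hom.comp_apply]
    generalize i x = w
    induction w using induction_on with
    | h0 => simp only [zero_tmul, map_zero]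
    | ha x y hx hy => simp only [add_tmul, map_add, hx, hy]
    | ht x v => rfl

/-- Serves the maps built from `γh`, where `γ` is already extended by one factor before `Z` is
adjoined. -/
theorem tail₃_tail₃ {X : Bimodule K N} {X' : Bimodule K Q} {V : Bimodule Q N}
    {Y₁ : Bimodule K L} {Y₂ : Bimodule L M} {Y₃ : Bimodule M Q} (i : Hom X (X' ⊗ᵇ V))
    (f : Hom X' (Y₁ ⊗ᵇ (Y₂ ⊗ᵇ Y₃))) {Z : Bimodule N O} (y : (X ⊗ᵇ Z : Bimodule K O)) :
    (Y₁ ◁ᵇ Y₂ ◁ᵇ assoc Y₃ V Z) (tail₃ ((tail₃ f V).comp i) Z y)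
      = tail₃ f (V ⊗ᵇ Z) (tail₂ i Z y) := by
  induction y using induction_on with
  | h0 => simp only [map_zero]
  | ha x y hx hy => simp only [map_add, hx, hy]
  | ht x z =>
    rw [tail₃_tmul, tail₂_tmul, Hom.comp_apply]
    generalize i x = w
    induction w using induction_on with
    | h0 => simp only [zero_tmul, map_zero]
    | ha x y hx hy => simp only [add_tmul, map_add, hx, hy]
    | ht x v =>
      rw [assoc_tmul, tail₃_tmul f, tail₃_tmul f]
      generalize f x = w
      induction w using induction_right with
      | h0 => simp only [zero_tmul, map_zero]
      | ha x y hx hy => simp only [add_tmul, map_add, hx, hy]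
      | ht x v y => rfl

end

end Bimodule

end BimoduleHerds

/-! ### Equalisers, split equalisers and faithfully flat descent. -/

namespace BimoduleHerds

open Bimodule

section Exactness

variable {K L M N R S : Type u} [Ring K] [Ring L] [Ring M] [Ring N] [Ring R] [Ring S]

/-- The range of `i` is the equaliser of `f` and `g`. -/
def IsEq {X Y Z : Bimodule K L} (i : Hom X Y) (f g : Hom Y Z) : Prop :=
  ∀ y, f y = g y ↔ y ∈ Set.range i

theorem IsEq.comm {X Y Z : Bimodule K L} {i : Hom X Y} {f g : Hom Y Z} (h : IsEq i f g) (x : X) :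
    f (i x) = g (i x) := (h _).2 ⟨x, rfl⟩

theorem IsEq.mem {X Y Z : Bimodule K L} {i : Hom X Y} {f g : Hom Y Z} (h : IsEq i f g) {y : Y}
    (hy : f y = g y) : y ∈ Set.range i := (h y).1 hy

/-- Passing to the difference of the two maps turns an equaliser into an exact sequence, the form in
which faithful flatness is stated. -/
theorem isEq_iff_exact {X Y Z : Bimodule K L} (i : Hom X Y) (f g : Hom Y Z) :
    IsEq i f g ↔ Function.Exact i.left (f.left - g.left) := by
  refine forall_congr' fun y => ?_
  change (f y = g y ↔ _) ↔ (f y - g y = 0 ↔ _)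
  rw [sub_eq_zero]
  rfl

theorem isEq_iff_exact' {X Y Z : Bimodule K L} (i : Hom X Y) (f g : Hom Y Z) :
    IsEq i f g ↔ Function.Exact i.right (f.right - g.right) := by
  refine forall_congr' fun y => ?_
  change (f y = g y ↔ _) ↔ (f y - g y = 0 ↔ _)
  rw [sub_eq_zero]
  rfl

theorem BTensor.map_sub_right {R M N N' : Type u} [Ring R] [AddCommGroup M] [AddCommGroup N]
    [AddCommGroup N'] [Module Rᵐᵒᵖ M] [Module R N] [Module R N'] (f g : N →ₗ[R] N')
    (z : BTensor R M N) :
    BTensor.map (LinearMap.id : M →ₗ[Rᵐᵒᵖ] M) (f - g) z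
      = BTensor.map LinearMap.id f z - BTensor.map LinearMap.id g z := by
  induction z using BTensor.induction_on with
  | h0 => simp only [map_zero, sub_zero]
  | ht m n => exact map_sub (BTensor.mkHom R M N' m) (f n) (g n)
  | ha x y hx hy => simp only [map_add, hx, hy]; abel

theorem BTensor.map_sub_left {R M N M' : Type u} [Ring R] [AddCommGroup M] [AddCommGroup N]
    [AddCommGroup M'] [Module Rᵐᵒᵖ M] [Module R N] [Module Rᵐᵒᵖ M'] (f g : M →ₗ[Rᵐᵒᵖ] M')
    (z : BTensor R M N) :
    BTensor.map (f - g) (LinearMap.id : N →ₗ[R] N) z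
      = BTensor.map f LinearMap.id z - BTensor.map g LinearMap.id z := by
  induction z using BTensor.induction_on with
  | h0 => simp only [map_zero, sub_zero]
  | ht m n => exact map_sub ((BTensor.mkHom R M' N).flip n) (f m) (g m)
  | ha x y hx hy => simp only [map_add, hx, hy]; abel

/-- Both directions are used: preservation to recognise elements of products such as `T ⊗ C`,
reflection to descend from forks that split after tensoring with `t`. -/
theorem FaithfullyFlatRight.isEq_iff {t : Bimodule S R} (ht : FaithfullyFlatRight R t)
    {X Y Z : Bimodule R M} (i : Hom X Y) (f g : Hom Y Z) :
    IsEq i f g ↔ IsEq (t ◁ᵇ i) (t ◁ᵇ f) (t ◁ᵇ g) := by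
  rw [isEq_iff_exact, ht]
  refine forall_congr' fun y => ?_
  rw [BTensor.map_sub_right, sub_eq_zero]
  rfl

theorem FaithfullyFlatLeft.isEq_iff {t : Bimodule S R} (ht : FaithfullyFlatLeft S t)
    {X Y Z : Bimodule M S} (i : Hom X Y) (f g : Hom Y Z) :
    IsEq i f g ↔ IsEq (i ▷ᵇ t) (f ▷ᵇ t) (g ▷ᵇ t) := by
  rw [isEq_iff_exact', ht]
  refine forall_congr' fun y => ?_
  rw [BTensor.map_sub_left, sub_eq_zero]
  rfl

theorem exact_zero_iff_injective {G X Y : Type*} [AddCommGroup G] [AddCommGroup X]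
    [AddCommGroup Y] (z : G →+ X) (hz : ∀ g, z g = 0) (f : X →+ Y) :
    Function.Exact z f ↔ Function.Injective f := by
  rw [injective_iff_map_eq_zero]
  refine forall_congr' fun x => ?_
  refine ⟨fun h h' => ?_, fun h => ⟨fun h' => ⟨0, (map_zero z).trans (h h').symm⟩, ?_⟩⟩
  · obtain ⟨g, rfl⟩ := h.1 h'
    exact hz g
  · rintro ⟨g, rfl⟩
    rw [hz, map_zero]

theorem FaithfullyFlatRight.injective_iff {t : Bimodule S R} (ht : FaithfullyFlatRight R t)
    {X Y : Bimodule R M} (f : Hom X Y) :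
    Function.Injective f ↔ Function.Injective (t ◁ᵇ f) := by
  -- The zero module, in the universe over which flatness quantifies: injectivity is exactness of 0
  -- → X → Y.
  have h := ht PUnit.{u + 1} X Y 0 f.left
  have h1 := exact_zero_iff_injective (0 : PUnit.{u + 1} →+ X) (fun _ => rfl) f.toAddMonoidHom
  have h2 := exact_zero_iff_injective (BTensor.map (LinearMap.id : t →ₗ[Rᵐᵒᵖ] t)
    (0 : PUnit.{u + 1} →ₗ[R] X)) (fun z => by
      induction z using BTensor.induction_on with
      | h0 => exact map_zero _
      | ht m n => exact map_zero (BTensor.mkHom R t X m)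
      | ha x y hx hy => rw [map_add, hx, hy, add_zero]) (t ◁ᵇ f).toAddMonoidHom
  exact h1.symm.trans (h.trans h2)

theorem FaithfullyFlatLeft.injective_iff {t : Bimodule S R} (ht : FaithfullyFlatLeft S t)
    {X Y : Bimodule M S} (f : Hom X Y) :
    Function.Injective f ↔ Function.Injective (f ▷ᵇ t) := by
  have h := ht PUnit.{u + 1} X Y 0 f.right
  have h1 := exact_zero_iff_injective (0 : PUnit.{u + 1} →+ X) (fun _ => rfl) f.toAddMonoidHom
  have h2 := exact_zero_iff_injective (BTensor.map (0 : PUnit.{u + 1} →ₗ[Sᵐᵒᵖ] X)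
    (LinearMap.id : t →ₗ[S] t)) (fun z => by
      induction z using BTensor.induction_on with
      | h0 => exact map_zero _
      | ht m n => exact map_zero ((BTensor.mkHom S X t).flip n)
      | ha x y hx hy => rw [map_add, hx, hy, add_zero]) (f ▷ᵇ t).toAddMonoidHom
  exact h1.symm.trans (h.trans h2)

/-- A bimodule map with a left inverse. -/
def IsSplit {X Y : Bimodule K L} (i : Hom X Y) : Prop :=
  ∃ r : Hom Y X, ∀ x, r (i x) = x

theorem IsSplit.injective {X Y : Bimodule K L} {i : Hom X Y} (h : IsSplit i) :
    Function.Injective i := by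
  obtain ⟨r, hr⟩ := h
  exact Function.LeftInverse.injective hr

theorem IsSplit.whiskerLeft {X Y : Bimodule K L} {i : Hom X Y} (h : IsSplit i)
    (W : Bimodule M K) : IsSplit (W ◁ᵇ i) := by
  obtain ⟨r, hr⟩ := h
  exact ⟨W ◁ᵇ r, whiskerLeft_cancel W hr⟩

theorem IsSplit.whiskerRight {X Y : Bimodule K L} {i : Hom X Y} (h : IsSplit i)
    (W : Bimodule L M) : IsSplit (i ▷ᵇ W) := by
  obtain ⟨r, hr⟩ := h
  exact ⟨r ▷ᵇ W, whiskerRight_cancel W hr⟩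

theorem IsSplit.of_conj {X Y X' Y' : Bimodule K L} {i : Hom X Y} (h : IsSplit i) {i' : Hom X' Y'}
    {a : Hom X' X} (ha : IsSplit a) (b : Hom Y' Y) (hi : ∀ x, b (i' x) = i (a x)) :
    IsSplit i' := by
  obtain ⟨r, hr⟩ := h
  obtain ⟨a', ha⟩ := ha
  refine ⟨a'.comp (r.comp b), fun x => ?_⟩
  change a' (r (b (i' x))) = x
  rw [hi, hr, ha]

/-- Associativity carries `(W ⊗ -) ⊗ V` to `W ⊗ (- ⊗ V)`. -/
theorem assoc_whisker (W : Bimodule K L) {X Y : Bimodule L M} (V : Bimodule M N) (f : Hom X Y)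
    (z : ((W ⊗ᵇ X) ⊗ᵇ V : Bimodule K N)) :
    assoc W Y V (((W ◁ᵇ f) ▷ᵇ V) z) = (W ◁ᵇ (f ▷ᵇ V)) (assoc W X V z) :=
  assoc_naturality _ _ _ z

theorem assocInv_whisker (W : Bimodule K L) {X Y : Bimodule L M} (V : Bimodule M N) (f : Hom X Y)
    (z : (W ⊗ᵇ (X ⊗ᵇ V) : Bimodule K N)) :
    assocInv W Y V ((W ◁ᵇ (f ▷ᵇ V)) z) = ((W ◁ᵇ f) ▷ᵇ V) (assocInv W X V z) :=
  assocInv_naturality _ _ _ z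

theorem assoc_injective (X : Bimodule K L) (Y : Bimodule L M) (Z : Bimodule M N) :
    Function.Injective (assoc X Y Z) :=
  Function.LeftInverse.injective (assocInv_assoc X Y Z)

theorem assocInv_injective (X : Bimodule K L) (Y : Bimodule L M) (Z : Bimodule M N) :
    Function.Injective (assocInv X Y Z) :=
  Function.LeftInverse.injective (assoc_assocInv X Y Z)

/-- Whisker the retraction by `Z` and rebracket. The splittings are constructed with `V` equal to
`T`, and this makes them available for every `T ⊗ Z`. -/
theorem IsSplit.tail₂_tensor {K L M N O : Type u} [Ring K] [Ring L] [Ring M] [Ring N] [Ring O]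
    {X : Bimodule K M} {Y₁ : Bimodule K L} {Y₂ : Bimodule L M} {f : Hom X (Y₁ ⊗ᵇ Y₂)}
    {V : Bimodule M N} (h : IsSplit (tail₂ f V)) (Z : Bimodule N O) :
    IsSplit (tail₂ f (V ⊗ᵇ Z)) :=
  (h.whiskerRight Z).of_conj (a := assocInv X V Z) ⟨assoc _ _ _, assoc_assocInv _ _ _⟩
    (untail₃ _ _ _ Z) fun x => by
      rw [← untail₃_tail₃, tail₃_tail₂, assoc_assocInv]

theorem IsSplit.whiskerLeft_tail₂ {K L M N O : Type u} [Ring K] [Ring L] [Ring M] [Ring N] [Ring O]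
    {X : Bimodule L N} {Y₁ : Bimodule L M} {Y₂ : Bimodule M N} {f : Hom X (Y₁ ⊗ᵇ Y₂)}
    {W : Bimodule K L} (h : IsSplit (W ◁ᵇ f)) (Z : Bimodule N O) : IsSplit (W ◁ᵇ tail₂ f Z) :=
  (h.whiskerRight Z).of_conj (a := assocInv W X Z) ⟨assoc _ _ _, assoc_assocInv _ _ _⟩
    (untail₃ _ _ _ Z) fun x => by
      refine (congrArg (assocInv _ _ _) (whiskerLeft_comp W (k := f ▷ᵇ Z)
        (fun y => assocInv_assoc _ _ _ _) x)).trans ?_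
      exact assocInv_naturality _ _ _ _

/-- A bimodule map that stays injective under all left whiskerings. -/
def LeftPure {X Y : Bimodule K L} (f : Hom X Y) : Prop :=
  ∀ (M : Type u) [Ring M] (V : Bimodule M K), Function.Injective (V ◁ᵇ f)

theorem IsSplit.leftPure {X Y : Bimodule K L} {f : Hom X Y} (h : IsSplit f) : LeftPure f :=
  fun _ _ V => (h.whiskerLeft V).injective

theorem LeftPure.whiskerLeft {X Y : Bimodule K L} {f : Hom X Y} (h : LeftPure f)
    (W : Bimodule M K) : LeftPure (W ◁ᵇ f) := fun _ _ V x y hxy => by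
  apply assocInv_injective V W X
  apply h _ (V ⊗ᵇ W)
  apply assoc_injective V W Y
  rw [assoc_naturality_right, assoc_naturality_right, assoc_assocInv, assoc_assocInv]
  exact hxy

theorem LeftPure.comp {X Y Z : Bimodule K L} {g : Hom Y Z} {f : Hom X Y} (hg : LeftPure g)
    (hf : LeftPure f) : LeftPure (g.comp f) := fun _ _ V x y hxy => by
  rw [whiskerLeft_comp_apply, whiskerLeft_comp_apply] at hxy
  exact hf _ V (hg _ V hxy)

/-- A split equaliser of bimodule maps. -/
def IsSplitEq {X Y Z : Bimodule K L} (i : Hom X Y) (f g : Hom Y Z) : Prop :=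
  (∀ x, f (i x) = g (i x)) ∧ ∃ (r : Hom Y X) (s : Hom Z Y),
    (∀ x, r (i x) = x) ∧ (∀ y, i (r y) = s (f y)) ∧ ∀ y, s (g y) = y

namespace IsSplitEq

theorem isSplit {X Y Z : Bimodule K L} {i : Hom X Y} {f g : Hom Y Z} (h : IsSplitEq i f g) :
    IsSplit i := by
  obtain ⟨_, r, _, h, _⟩ := h
  exact ⟨r, h⟩

theorem isEq {X Y Z : Bimodule K L} {i : Hom X Y} {f g : Hom Y Z} (h : IsSplitEq i f g) :
    IsEq i f g := by
  obtain ⟨h, r, s, _, h1, h2⟩ := h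
  refine fun y => ⟨fun hy => ⟨r y, by rw [h1, hy, h2]⟩, ?_⟩
  rintro ⟨x, rfl⟩
  exact h x

theorem of_iso {X Y Z Y' Z' : Bimodule K L} {i : Hom X Y} {f g : Hom Y Z}
    {i' : Hom X Y'} {f' g' : Hom Y' Z'} (h : IsSplitEq i' f' g')
    (b : Hom Y Y') (b' : Hom Y' Y) (hbb' : ∀ x, b' (b x) = x)
    (c : Hom Z Z') (hc : Function.Injective c)
    (hi : ∀ x, b (i x) = i' x) (hf : ∀ y, c (f y) = f' (b y)) (hg : ∀ y, c (g y) = g' (b y)) :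
    IsSplitEq i f g := by
  obtain ⟨h, r, s, h0, h1, h2⟩ := h
  refine ⟨fun x => hc ?_, r.comp b, b'.comp (s.comp c), fun x => ?_, fun y => ?_, fun y => ?_⟩
  · rw [hf, hg, hi, h]
  · exact (congrArg r (hi x)).trans (h0 x)
  · change i (r (b y)) = b' (s (c (f y)))
    rw [hf, ← h1, ← hi, hbb']
  · change b' (s (c (g y))) = y
    rw [hg, h2, hbb']

theorem whiskerLeft {X Y Z : Bimodule K L} {i : Hom X Y} {f g : Hom Y Z} (h : IsSplitEq i f g)
    (W : Bimodule M K) : IsSplitEq (W ◁ᵇ i) (W ◁ᵇ f) (W ◁ᵇ g) := by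
  obtain ⟨h, r, s, h0, h1, h2⟩ := h
  exact ⟨whiskerLeft_comm W h, W ◁ᵇ r, W ◁ᵇ s, whiskerLeft_cancel W h0, whiskerLeft_comm W h1,
    whiskerLeft_cancel W h2⟩

theorem whiskerRight {X Y Z : Bimodule K L} {i : Hom X Y} {f g : Hom Y Z} (h : IsSplitEq i f g)
    (W : Bimodule L M) : IsSplitEq (i ▷ᵇ W) (f ▷ᵇ W) (g ▷ᵇ W) := by
  obtain ⟨h, r, s, h0, h1, h2⟩ := h
  exact ⟨whiskerRight_comm W h, r ▷ᵇ W, s ▷ᵇ W, whiskerRight_cancel W h0, whiskerRight_comm W h1,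
    whiskerRight_cancel W h2⟩

end IsSplitEq

theorem IsEq.of_iso {X Y Z X' Y' Z' : Bimodule K L} {i : Hom X Y} {f g : Hom Y Z}
    {i' : Hom X' Y'} {f' g' : Hom Y' Z'} (h : IsEq i f g)
    (a : Hom X X') (a' : Hom X' X) (haa : ∀ x, a (a' x) = x)
    (b : Hom Y Y') (b' : Hom Y' Y) (hbb : ∀ x, b (b' x) = x) (hbb' : ∀ x, b' (b x) = x)
    (c : Hom Z Z') (hc : Function.Injective c)
    (hi : ∀ x, b (i x) = i' (a x)) (hf : ∀ y, c (f y) = f' (b y)) (hg : ∀ y, c (g y) = g' (b y)) :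
    IsEq i' f' g' := by
  intro y
  have key : f' y = g' y ↔ f (b' y) = g (b' y) := by
    rw [← hc.eq_iff, hf, hg, hbb]
  rw [key, h]
  constructor
  · rintro ⟨x, hx⟩
    exact ⟨a x, by rw [← hi, hx, hbb]⟩
  · rintro ⟨x, rfl⟩
    exact ⟨a' x, by rw [← haa x, ← hi, hbb', haa]⟩

theorem injective_of_conj {X Y X' Y' : Type*} {i : X → Y} (h : Function.Injective i) {i' : X' → Y'}
    (a : X' → X) (ha : Function.Injective a) (b : Y' → Y) (hi : ∀ x, b (i' x) = i (a x)) :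
    Function.Injective i' := fun x y hxy =>
  ha (h (by rw [← hi, ← hi, hxy]))

/-- If `t ⊗ -` makes a fork a split equaliser, every right whiskering of the fork is an
equaliser. -/
theorem FaithfullyFlatRight.isEq_whiskerRight {t : Bimodule S R} (ht : FaithfullyFlatRight R t)
    {X Y Z : Bimodule R M} {i : Hom X Y} {f g : Hom Y Z}
    (h : IsSplitEq (t ◁ᵇ i) (t ◁ᵇ f) (t ◁ᵇ g)) (V : Bimodule M N) :
    IsEq (i ▷ᵇ V) (f ▷ᵇ V) (g ▷ᵇ V) := by
  rw [ht.isEq_iff]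
  exact (h.whiskerRight V).isEq.of_iso (assoc _ _ _) (assocInv _ _ _) (assoc_assocInv _ _ _)
    (assoc _ _ _) (assocInv _ _ _) (assoc_assocInv _ _ _) (assocInv_assoc _ _ _)
    (assoc _ _ _) (assoc_injective _ _ _) (assoc_whisker _ _ _) (assoc_whisker _ _ _)
    (assoc_whisker _ _ _)

theorem FaithfullyFlatRight.injective_whiskerRight {t : Bimodule S R}
    (ht : FaithfullyFlatRight R t) {X Y : Bimodule R M} {i : Hom X Y}
    (h : IsSplit (t ◁ᵇ i)) (V : Bimodule M N) : Function.Injective (i ▷ᵇ V) := by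
  rw [ht.injective_iff]
  exact injective_of_conj (h.whiskerRight V).injective (assocInv _ _ _) (assocInv_injective _ _ _)
    (assocInv _ _ _) (assocInv_whisker _ _ _)

theorem FaithfullyFlatLeft.isEq_whiskerLeft {t : Bimodule S R} (ht : FaithfullyFlatLeft S t)
    {X Y Z : Bimodule M S} {i : Hom X Y} {f g : Hom Y Z}
    (h : IsSplitEq (i ▷ᵇ t) (f ▷ᵇ t) (g ▷ᵇ t)) (V : Bimodule N M) :
    IsEq (V ◁ᵇ i) (V ◁ᵇ f) (V ◁ᵇ g) := by
  rw [ht.isEq_iff]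
  exact (h.whiskerLeft V).isEq.of_iso (assocInv _ _ _) (assoc _ _ _) (assocInv_assoc _ _ _)
    (assocInv _ _ _) (assoc _ _ _) (assocInv_assoc _ _ _) (assoc_assocInv _ _ _)
    (assocInv _ _ _) (assocInv_injective _ _ _) (assocInv_whisker _ _ _)
    (assocInv_whisker _ _ _) (assocInv_whisker _ _ _)

theorem FaithfullyFlatLeft.injective_whiskerLeft {t : Bimodule S R}
    (ht : FaithfullyFlatLeft S t) {X Y : Bimodule M S} {i : Hom X Y}
    (h : IsSplit (i ▷ᵇ t)) (V : Bimodule N M) : Function.Injective (V ◁ᵇ i) := by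
  rw [ht.injective_iff]
  exact injective_of_conj (h.whiskerLeft V).injective (assoc _ _ _) (assoc_injective _ _ _)
    (assoc _ _ _) (assoc_whisker _ _ _)

end Exactness

end BimoduleHerds

/-! ### Actions on T, unit maps, and the herd axioms with an extra tensor factor. -/

namespace BimoduleHerds

open Bimodule

section

variable {R S A B : Type u} [Ring R] [Ring S] [Ring A] [Ring B]

namespace FormalDual

variable {α : R →+* A} {β : S →+* B} {T : Bimodule B A} {That : Bimodule A B}
  (P : FormalDual α β T That) {M : Type u} [Ring M]

/-- The right action of `A` on `T`. -/
def actA : Hom (P.t ⊗ᵇ P.a) P.t :=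
  let f : T →+ A →+ T := AddMonoidHom.flip
    (AddMonoidHom.mk' (fun l : A => AddMonoidHom.mk' (fun x : T => op l • x) (smul_add (op l)))
      (fun l l' => by ext x; exact add_smul (op l) (op l') x))
  Bimodule.lift (X := P.t) (Y := P.a) (Z := P.t) f
    -- The `show` unfolds restriction of scalars: `r` acts on `T` and on `A` through `α r`.
    (fun r => show ∀ (x : T) (l : A), op l • op (α r) • x = op (α r * l) • x from
      fun x l => (mul_smul (op l) (op (α r)) x).symm)
    (fun k => show ∀ (x : T) (l : A), op l • β k • x = β k • op l • x from
      fun x l => (smul_comm (β k) (op l) x).symm)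
    (fun m => show ∀ (x : T) (l : A), op (l * α m.unop) • x = op (α m.unop) • op l • x from
      fun x l => mul_smul (op (α m.unop)) (op l) x)

/-- The left action of `B` on `T`. -/
def actB : Hom (P.b ⊗ᵇ P.t) P.t :=
  let f : B →+ T →+ T :=
    AddMonoidHom.mk' (fun k : B => AddMonoidHom.mk' (fun x : T => k • x) (smul_add k))
      (fun k k' => by ext x; exact add_smul k k' x)
  Bimodule.lift (X := P.b) (Y := P.t) (Z := P.t) f
    (fun r => show ∀ (k : B) (x : T), (k * β r) • x = k • β r • x from
      fun k x => mul_smul k (β r) x)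
    (fun r => show ∀ (k : B) (x : T), (β r * k) • x = β r • k • x from
      fun k x => mul_smul (β r) k x)
    (fun l => show ∀ (k : B) (x : T), k • op (α l.unop) • x = op (α l.unop) • k • x from
      fun k x => smul_comm k (op (α l.unop)) x)

theorem actA_tmul (x : T) (l : A) : P.actA (tmul (X := P.t) (Y := P.a) x l) = (op l • x : T) := rfl

theorem actB_tmul (k : B) (x : T) : P.actB (tmul (X := P.b) (Y := P.t) k x) = (k • x : T) := rfl

/-- The map `x ↦ 1 ⊗ x` to `A ⊗_R X`. -/
def unitA (X : Bimodule R M) : Hom X (P.a ⊗ᵇ X) := (unitHom α ▷ᵇ X).comp (lunitInv X)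

/-- The map `x ↦ 1 ⊗ x` to `B ⊗_S X`. -/
def unitB (X : Bimodule S M) : Hom X (P.b ⊗ᵇ X) := (unitHom β ▷ᵇ X).comp (lunitInv X)

/-- The map `x ↦ x ⊗ 1` to `X ⊗_R A`. -/
def unitRA (X : Bimodule M R) : Hom X (X ⊗ᵇ P.a) := (X ◁ᵇ unitHom α).comp (runitInv X)

/-- The map `x ↦ x ⊗ 1` to `X ⊗_S B`. -/
def unitRB (X : Bimodule M S) : Hom X (X ⊗ᵇ P.b) := (X ◁ᵇ unitHom β).comp (runitInv X)

theorem unitA_naturality {X Y : Bimodule R M} (f : Hom X Y) (x : X) :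
    P.unitA Y (f x) = (P.a ◁ᵇ f) (P.unitA X x) := rfl

theorem actA_unit (x : P.t) : P.actA (P.unitRA P.t x) = x := by
  refine (P.actA_tmul x (α 1)).trans ?_
  rw [map_one, MulOpposite.op_one]
  exact one_smul Aᵐᵒᵖ (show T from x)

theorem actB_unit (x : P.t) : P.actB (P.unitB P.t x) = x := by
  refine (P.actB_tmul (β 1) x).trans ?_
  rw [map_one]
  exact one_smul B (show T from x)

/-- Since `T` is already an A-module, `T ⊗ -` splits the unit map into `A ⊗ Z`. This is the
contraction behind the split forks for `C` and for `α`. -/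
theorem actA_unit_tail (Z : Bimodule R M) (z : (P.t ⊗ᵇ Z : Bimodule S M)) :
    head₂ P.actA Z ((P.t ◁ᵇ P.unitA Z) z) = z := by
  induction z using induction_on with
  | h0 => simp only [map_zero]
  | ht x y => exact congrArg (fun s => tmul s y) (P.actA_unit x)
  | ha x y hx hy => simp only [map_add, hx, hy]

theorem actB_unit_tail (Z : Bimodule R M) (z : (P.t ⊗ᵇ Z : Bimodule S M)) :
    head₂ P.actB Z (P.unitB (P.t ⊗ᵇ Z) z) = z := by
  induction z using induction_on with
  | h0 => simp only [map_zero]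
  | ht x y => exact congrArg (fun s => tmul s y) (P.actB_unit x)
  | ha x y hx hy => simp only [map_add, hx, hy]

/-- The first compatibility of the two evaluations, as an identity of maps. -/
theorem act_ev (z : (P.t ⊗ᵇ (P.h ⊗ᵇ P.t) : Bimodule S R)) :
    P.actB (head₂ P.evHatS P.t z) = P.actA ((P.t ◁ᵇ P.evR) z) := by
  induction z using induction_right with
  | h0 => simp only [map_zero]
  | ht x v y => exact P.diag_T x v y
  | ha x y hx hy => simp only [map_add, hx, hy]

end FormalDual

namespace Shepherd

variable {α : R →+* A} {β : S →+* B} {T : Bimodule B A} {That : Bimodule A B}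
  {P : FormalDual α β T That} (G : Shepherd P) {M : Type u} [Ring M]

theorem coev_apply (x : P.t) : head₂ P.evHatS P.t (G.γ x) = P.unitB P.t x :=
  Hom.congr G.coev x

theorem ev_apply (x : P.t) : (P.t ◁ᵇ P.evR) (G.γ x) = P.unitRA P.t x :=
  Hom.congr G.ev x

theorem coassoc_apply (x : P.t) :
    tail₃ G.γ (P.h ⊗ᵇ P.t) (G.γ x) = (P.t ◁ᵇ P.h ◁ᵇ G.γ) (G.γ x) :=
  Hom.congr G.coassoc x

/-- This and the next two results are the herd axioms with a spectator factor `Z`, the form in which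
they apply inside longer products. -/
theorem coev_tail (Z : Bimodule R M) (z : (P.t ⊗ᵇ Z : Bimodule S M)) :
    head₂ P.evHatS (P.t ⊗ᵇ Z) (tail₃ G.γ Z z) = P.unitB (P.t ⊗ᵇ Z) z := by
  induction z using induction_on with
  | h0 => simp only [map_zero]
  | ha x y hx hy => simp only [map_add, hx, hy]
  | ht x z =>
    -- The rebracketing is proved for an arbitrary `w`; the herd axiom is used only afterwards, at
    -- `w = γ(x)`.
    have key : ∀ w : (P.t ⊗ᵇ (P.h ⊗ᵇ P.t) : Bimodule S R),
        head₂ P.evHatS (P.t ⊗ᵇ Z) (tail₃ (.id _) Z (tmul w z))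
          = assoc _ _ _ (tmul (head₂ P.evHatS P.t w) z) := fun w => by
      induction w using induction_right with
      | h0 => simp only [zero_tmul, map_zero]
      | ht x y z => rfl
      | ha x y hx hy => simp only [add_tmul, map_add, hx, hy]
    rw [tail₃_tmul G.γ x, key, coev_apply]
    rfl

theorem ev_tail (Z : Bimodule R M) (z : (P.t ⊗ᵇ Z : Bimodule S M)) :
    (P.t ◁ᵇ head₂ P.evR Z) (tail₃ G.γ Z z) = (P.t ◁ᵇ P.unitA Z) z := by
  induction z using induction_on with
  | h0 => simp only [map_zero]
  | ha x y hx hy => simp only [map_add, hx, hy]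
  | ht x z =>
    have key : ∀ w : (P.t ⊗ᵇ (P.h ⊗ᵇ P.t) : Bimodule S R),
        (P.t ◁ᵇ head₂ P.evR Z) (tail₃ (.id _) Z (tmul w z))
          = assoc _ _ _ (tmul ((P.t ◁ᵇ P.evR) w) z) := fun w => by
      induction w using induction_right with
      | h0 => simp only [zero_tmul, map_zero]
      | ht x y z => rfl
      | ha x y hx hy => simp only [add_tmul, map_add, hx, hy]
    rw [tail₃_tmul G.γ x, key, ev_apply]
    rfl

theorem coassoc_tail (Z : Bimodule R M) (z : (P.t ⊗ᵇ Z : Bimodule S M)) :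
    tail₃ G.γ (P.h ⊗ᵇ (P.t ⊗ᵇ Z)) (tail₃ G.γ Z z)
      = (P.t ◁ᵇ P.h ◁ᵇ tail₃ G.γ Z) (tail₃ G.γ Z z) := by
  induction z using induction_on with
  | h0 => simp only [map_zero]
  | ha x y hx hy => simp only [map_add, hx, hy]
  | ht x z =>
    have key₁ : ∀ w : (P.t ⊗ᵇ (P.h ⊗ᵇ P.t) : Bimodule S R),
        tail₃ G.γ (P.h ⊗ᵇ (P.t ⊗ᵇ Z)) (tail₃ (.id _) Z (tmul w z))
          = (P.t ◁ᵇ P.h ◁ᵇ tail₃ (.id _) Z)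
            (tail₃ (.id _) Z (tmul (tail₃ G.γ (P.h ⊗ᵇ P.t) w) z)) := fun w => by
      induction w using induction_right with
      | h0 => simp only [zero_tmul, map_zero]
      | ha x y hx hy => simp only [add_tmul, map_add, hx, hy]
      | ht x v y =>
        change tail₃ G.γ (P.h ⊗ᵇ (P.t ⊗ᵇ Z)) (tmul x (tmul v (tmul y z))) = _
        rw [tail₃_tmul G.γ x, tail₃_tmul G.γ x]
        generalize G.γ x = w
        induction w using induction_right with
        | h0 => simp only [zero_tmul, map_zero]
        | ha x y hx hy => simp only [add_tmul, map_add, hx, hy]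
        | ht x v y => rfl
    have key₂ : ∀ w : (P.t ⊗ᵇ (P.h ⊗ᵇ P.t) : Bimodule S R),
        (P.t ◁ᵇ P.h ◁ᵇ tail₃ G.γ Z) (tail₃ (.id _) Z (tmul w z))
          = (P.t ◁ᵇ P.h ◁ᵇ tail₃ (.id _) Z)
            (tail₃ (.id _) Z (tmul ((P.t ◁ᵇ P.h ◁ᵇ G.γ) w) z)) := fun w => by
      induction w using induction_right with
      | h0 => simp only [zero_tmul, map_zero]
      | ha x y hx hy => simp only [add_tmul, map_add, hx, hy]
      | ht x v y => rfl
    rw [tail₃_tmul G.γ x, key₁, key₂, coassoc_apply]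

end Shepherd

end

end BimoduleHerds

/-! ### The equalisers C and D, the coactions on T, and descent for C and D. -/

namespace BimoduleHerds

open Bimodule

namespace Shepherd

variable {R S A B : Type u} [Ring R] [Ring S] [Ring A] [Ring B]
  {α : R →+* A} {β : S →+* B} {T : Bimodule B A} {That : Bimodule A B}
  {P : FormalDual α β T That} (G : Shepherd P) {M N : Type u} [Ring M] [Ring N]

/-- The map `v ⊗ x ↦ ev (v ⊗ x⁽¹⁾) ⊗ x⁽²⁾ ⊗ x⁽³⁾`. -/
def evγ : Hom (P.h ⊗ᵇ P.t) (P.a ⊗ᵇ (P.h ⊗ᵇ P.t)) :=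
  (head₂ P.evR (P.h ⊗ᵇ P.t)).comp G.hγ

/-- The map `v ⊗ x ⊗ z ↦ ev (v ⊗ x⁽¹⁾) ⊗ x⁽²⁾ ⊗ x⁽³⁾ ⊗ z`. -/
def evγTail (Z : Bimodule R M) : Hom (P.h ⊗ᵇ (P.t ⊗ᵇ Z)) (P.a ⊗ᵇ (P.h ⊗ᵇ (P.t ⊗ᵇ Z))) :=
  (head₂ P.evR (P.h ⊗ᵇ (P.t ⊗ᵇ Z))).comp (P.h ◁ᵇ tail₃ G.γ Z)

/-- The map `x ⊗ v ⊗ z ↦ x⁽¹⁾ ⊗ x⁽²⁾ ⊗ evHat (x⁽³⁾ ⊗ v) ⊗ z`. -/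
def γEvHatTail (Z : Bimodule S M) : Hom (P.t ⊗ᵇ (P.h ⊗ᵇ Z)) (P.t ⊗ᵇ (P.h ⊗ᵇ (P.b ⊗ᵇ Z))) :=
  (P.t ◁ᵇ P.h ◁ᵇ head₂ P.evHatS Z).comp (tail₃ G.γ (P.h ⊗ᵇ Z))

theorem isEq_ιC : IsEq G.ιC G.evγ (P.unitA (P.h ⊗ᵇ P.t)) := fun y =>
  ⟨fun h => ⟨⟨y, h⟩, rfl⟩, by rintro ⟨x, rfl⟩; exact x.2⟩

theorem isEq_ιD : IsEq G.ιD G.γEvHat (P.t ◁ᵇ P.unitRB P.h) := fun y =>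
  ⟨fun h => ⟨⟨y, h⟩, rfl⟩, by rintro ⟨x, rfl⟩; exact x.2⟩

theorem ιC_injective : Function.Injective G.ιC := Subtype.val_injective

theorem ιD_injective : Function.Injective G.ιD := Subtype.val_injective

theorem ιTbar_injective : Function.Injective G.ιTbar := Subtype.val_injective

theorem evγ_tail (Z : Bimodule R M) (w : ((P.h ⊗ᵇ P.t) ⊗ᵇ Z : Bimodule R M)) :
    tail₃ G.evγ Z w = G.evγTail Z (assoc _ _ _ w) := by
  induction w using induction_left with
  | h0 => simp only [map_zero]
  | ha x y hx hy => simp only [map_add, hx, hy]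
  | ht v x z =>
    change tail₃ (.id _) Z (tmul (head₂ P.evR (P.h ⊗ᵇ P.t) (tmul v (G.γ x))) z)
      = head₂ P.evR (P.h ⊗ᵇ (P.t ⊗ᵇ Z)) (tmul v (tail₃ (.id _) Z (tmul (G.γ x) z)))
    generalize G.γ x = w
    induction w using induction_right with
    | h0 => simp only [zero_tmul, tmul_zero, map_zero]
    | ha x y hx hy => simp only [add_tmul, tmul_add, map_add, hx, hy]
    | ht x v y => rfl

theorem γEvHat_tail (Z : Bimodule S M) (w : ((P.t ⊗ᵇ P.h) ⊗ᵇ Z : Bimodule S M)) :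
    tail₃ G.γEvHat Z w = G.γEvHatTail Z (assoc _ _ _ w) := by
  induction w using induction_left with
  | h0 => simp only [map_zero]
  | ha x y hx hy => simp only [map_add, hx, hy]
  | ht x v z =>
    change tail₃ (.id _) Z (tmul ((P.t ◁ᵇ P.h ◁ᵇ P.evHatS)
        (tail₃ (.id _) P.h (tmul (G.γ x) v))) z)
      = (P.t ◁ᵇ P.h ◁ᵇ head₂ P.evHatS Z) (tail₃ (.id _) (P.h ⊗ᵇ Z) (tmul (G.γ x) (tmul v z)))
    generalize G.γ x = w
    induction w using induction_right with
    | h0 => simp only [zero_tmul, map_zero]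
    | ha x y hx hy => simp only [add_tmul, map_add, hx, hy]
    | ht x v y => rfl

theorem unitRB_tail (Z : Bimodule S M) (w : ((P.t ⊗ᵇ P.h) ⊗ᵇ Z : Bimodule S M)) :
    tail₃ (P.t ◁ᵇ P.unitRB P.h) Z w = (P.t ◁ᵇ P.h ◁ᵇ P.unitB Z) (assoc _ _ _ w) := by
  induction w using induction_left with
  | h0 => simp only [map_zero]
  | ha x y hx hy => simp only [map_add, hx, hy]
  | ht x v z => rfl

/-- Coassociativity moves the second `γ` from the third factor to the first, where the axiom for ev
contracts it. This puts γ(x) in T ⊗ C. -/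
theorem evγ_γ (x : P.t) : (P.t ◁ᵇ G.evγ) (G.γ x) = (P.t ◁ᵇ P.unitA _) (G.γ x) := by
  refine (whiskerLeft_comp_apply _ _ _ _).trans ?_
  refine (congrArg _ (G.coassoc_apply x).symm).trans ?_
  exact G.ev_tail (P.h ⊗ᵇ P.t) (G.γ x)

/-- Here coassociativity is used in the opposite direction, so that the coevaluation axiom applies
to the third factor. This puts γ(x) in D ⊗ T. -/
theorem γEvHatTail_γ (x : P.t) :
    G.γEvHatTail P.t (G.γ x) = (P.t ◁ᵇ P.h ◁ᵇ P.unitB P.t) (G.γ x) := by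
  refine (congrArg (P.t ◁ᵇ P.h ◁ᵇ head₂ P.evHatS P.t) (G.coassoc_apply x)).trans ?_
  exact whiskerLeft_comp _ (whiskerLeft_comp _ G.coev_apply) _

theorem whiskerLeft_ιC_injective (hG : G.Tame) : Function.Injective (P.t ◁ᵇ G.ιC) :=
  (hG.flat_right.injective_iff _).1 G.ιC_injective

theorem isEq_whiskerLeft_ιC (hG : G.Tame) :
    IsEq (P.t ◁ᵇ G.ιC) (P.t ◁ᵇ G.evγ) (P.t ◁ᵇ P.unitA (P.h ⊗ᵇ P.t)) :=
  (hG.flat_right.isEq_iff _ _ _).1 G.isEq_ιC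

theorem isEq_tail_ιD (hG : G.Tame) :
    IsEq (tail₂ G.ιD P.t) (G.γEvHatTail P.t) (P.t ◁ᵇ P.h ◁ᵇ P.unitB P.t) :=
  ((hG.flat_left.isEq_iff _ _ _).1 G.isEq_ιD).of_iso (.id _) (.id _) (fun _ => rfl)
    (assoc _ _ _) (assocInv _ _ _) (assoc_assocInv _ _ _) (assocInv_assoc _ _ _)
    (tail₃ (.id _) P.t)
    (tail₃_id_injective _ _ _ _)
    (fun _ => rfl)
    (fun y => (tail₃_id_whisker _ y).trans (G.γEvHat_tail P.t y))
    (fun y => (tail₃_id_whisker _ y).trans (unitRB_tail P.t y))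

theorem tail_ιD_injective (hG : G.Tame) : Function.Injective (tail₂ G.ιD P.t) := fun _ _ h =>
  (hG.flat_left.injective_iff _).1 G.ιD_injective (assoc_injective _ _ _ h)

/-- The right coaction of `C` on `T`. -/
def γC (hG : G.Tame) : Hom P.t (P.t ⊗ᵇ G.C) :=
  liftThrough (P.t ◁ᵇ G.ιC) (G.whiskerLeft_ιC_injective hG) G.γ
    (fun x => (G.isEq_whiskerLeft_ιC hG).mem (G.evγ_γ x))

/-- The left coaction of `D` on `T`. -/
def γD (hG : G.Tame) : Hom P.t (G.D ⊗ᵇ P.t) :=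
  liftThrough (tail₂ G.ιD P.t) (G.tail_ιD_injective hG) G.γ
    (fun x => (G.isEq_tail_ιD hG).mem (G.γEvHatTail_γ x))

theorem ιC_γC (hG : G.Tame) (x : P.t) : (P.t ◁ᵇ G.ιC) (G.γC hG x) = G.γ x := liftThrough_apply _ _ _ _ x

theorem ιD_γD (hG : G.Tame) (x : P.t) : tail₂ G.ιD P.t (G.γD hG x) = G.γ x := liftThrough_apply _ _ _ _ x

theorem ιD_γD_tail (hG : G.Tame) (Z : Bimodule R M) (z : (P.t ⊗ᵇ Z : Bimodule S M)) :
    tail₂ G.ιD (P.t ⊗ᵇ Z) (tail₂ (G.γD hG) Z z) = tail₃ G.γ Z z := by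
  induction z using induction_on with
  | h0 => simp only [map_zero]
  | ha x y hx hy => simp only [map_add, hx, hy]
  | ht x z =>
    rw [tail₃_tmul G.γ, ← G.ιD_γD hG, tail₂_tmul]
    generalize G.γD hG x = w
    induction w using induction_on with
    | h0 => simp only [zero_tmul, map_zero]
    | ha x y hx hy => simp only [add_tmul, map_add, hx, hy]
    | ht d y =>
      rw [assoc_tmul, tail₂_tmul, tail₂_tmul]
      generalize G.ιD d = w
      induction w using induction_on with
      | h0 => simp only [zero_tmul, map_zero]
      | ha x y hx hy => simp only [add_tmul, map_add, hx, hy]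
      | ht x v => rfl

/-- The action of `A` on `T` contracts the fork, and the coaction `γC` lifts the resulting
idempotent to a retraction onto T ⊗ C. -/
theorem isSplitEq_whiskerLeft_ιC (hG : G.Tame) :
    IsSplitEq (P.t ◁ᵇ G.ιC) (P.t ◁ᵇ G.evγ) (P.t ◁ᵇ P.unitA (P.h ⊗ᵇ P.t)) := by
  -- Because γ takes values in T ⊗ C, the map `evγ` factors through A ⊗ C. Then `r` is x ⊗ v ⊗ y ↦ x
  -- ev(v ⊗ y₁) ⊗ (y₂ ⊗ y₃), with the last two factors read in C.
  let ψ : Hom (P.h ⊗ᵇ P.t) (P.a ⊗ᵇ G.C) := (head₂ P.evR G.C).comp (P.h ◁ᵇ G.γC hG)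
  let r := (head₂ P.actA G.C).comp (P.t ◁ᵇ ψ)
  have hψ : ∀ w, (P.a ◁ᵇ G.ιC) (ψ w) = G.evγ w := fun w => by
    refine (head₂_naturality P.evR G.ιC _).symm.trans ?_
    exact congrArg _ (whiskerLeft_comp P.h (G.ιC_γC hG) w)
  have hr : ∀ y, (P.t ◁ᵇ G.ιC) (r y) = head₂ P.actA (P.h ⊗ᵇ P.t) ((P.t ◁ᵇ G.evγ) y) := fun y => by
    refine (head₂_naturality P.actA G.ιC _).symm.trans ?_
    exact congrArg _ (whiskerLeft_comp P.t hψ y)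
  have h0 := whiskerLeft_comm P.t G.isEq_ιC.comm
  refine ⟨h0, r, head₂ P.actA (P.h ⊗ᵇ P.t), fun x => ?_, hr, P.actA_unit_tail _⟩
  apply G.whiskerLeft_ιC_injective hG
  rw [hr, h0, P.actA_unit_tail]

/-- The mirror argument: the action of `B` contracts the fork and `γD` supplies the retraction. -/
theorem isSplitEq_tail_ιD (hG : G.Tame) :
    IsSplitEq (tail₂ G.ιD P.t) (G.γEvHatTail P.t) (P.t ◁ᵇ P.h ◁ᵇ P.unitB P.t) := by
  -- On simple tensors, x ⊗ v ⊗ y ↦ (x₁ ⊗ x₂) ⊗ evHat(x₃ ⊗ v) y, with the first two factors read in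
  -- D.
  let r := (G.D ◁ᵇ P.actB).comp ((G.D ◁ᵇ head₂ P.evHatS P.t).comp (tail₂ (G.γD hG) (P.h ⊗ᵇ P.t)))
  have hr : ∀ y, tail₂ G.ιD P.t (r y) = (P.t ◁ᵇ P.h ◁ᵇ P.actB) (G.γEvHatTail P.t y) := fun y => by
    change tail₂ G.ιD P.t ((G.D ◁ᵇ P.actB) ((G.D ◁ᵇ head₂ P.evHatS P.t)
      (tail₂ (G.γD hG) (P.h ⊗ᵇ P.t) y))) = _
    rw [tail₂_naturality, tail₂_naturality, ιD_γD_tail]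
    rfl
  have h0 := (G.isEq_tail_ιD hG).comm
  have h1 := whiskerLeft_cancel P.t (whiskerLeft_cancel P.h P.actB_unit)
  refine ⟨h0, r, P.t ◁ᵇ P.h ◁ᵇ P.actB, fun x => ?_, hr, h1⟩
  apply G.tail_ιD_injective hG
  rw [hr, h0, h1]

theorem isSplitEq_whiskerRight_ιD (hG : G.Tame) :
    IsSplitEq (G.ιD ▷ᵇ P.t) (G.γEvHat ▷ᵇ P.t) ((P.t ◁ᵇ P.unitRB P.h) ▷ᵇ P.t) :=
  (G.isSplitEq_tail_ιD hG).of_iso (assoc _ _ _) (assocInv _ _ _) (assocInv_assoc _ _ _)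
    (tail₃ (.id _) P.t)
    (tail₃_id_injective _ _ _ _)
    (fun _ => rfl)
    (fun y => (tail₃_id_whisker _ y).trans (G.γEvHat_tail P.t y))
    (fun y => (tail₃_id_whisker _ y).trans (unitRB_tail P.t y))

/-- After `T ⊗ -` the fork is split, hence remains an equaliser after `- ⊗ Z`; `T ⊗ -` then reflects
this. No flatness of `Z` enters. -/
theorem isEq_tail_ιC (hG : G.Tame) (Z : Bimodule R M) :
    IsEq (tail₂ G.ιC Z) (G.evγTail Z) (P.unitA (P.h ⊗ᵇ (P.t ⊗ᵇ Z))) :=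
  (hG.flat_right.isEq_whiskerRight (G.isSplitEq_whiskerLeft_ιC hG) Z).of_iso
    (.id _) (.id _) (fun _ => rfl)
    (assoc _ _ _) (assocInv _ _ _) (assoc_assocInv _ _ _) (assocInv_assoc _ _ _)
    (tail₃ (.id _) Z)
    (tail₃_id_injective _ _ _ _)
    (fun _ => rfl)
    (fun y => (tail₃_id_whisker _ y).trans (G.evγ_tail Z y))
    (fun y => by
      induction y using induction_left with
      | h0 => simp only [map_zero]
      | ha x y hx hy => simp only [map_add, hx, hy]
      | ht x v z => rfl)

theorem tail_ιC_injective (hG : G.Tame) (Z : Bimodule R M) : Function.Injective (tail₂ G.ιC Z) := fun _ _ h =>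
  hG.flat_right.injective_whiskerRight (G.isSplitEq_whiskerLeft_ιC hG).isSplit Z
    (assoc_injective _ _ _ h)

/-- Descent along `- ⊗ T`, whose effect on the fork of D is split. -/
theorem isEq_whiskerLeft_ιD (hG : G.Tame) (Z : Bimodule M S) :
    IsEq (Z ◁ᵇ G.ιD) (Z ◁ᵇ G.γEvHat) (Z ◁ᵇ P.t ◁ᵇ P.unitRB P.h) :=
  hG.flat_left.isEq_whiskerLeft (G.isSplitEq_whiskerRight_ιD hG) Z

theorem whiskerLeft_ιD_injective (hG : G.Tame) (Z : Bimodule M S) : Function.Injective (Z ◁ᵇ G.ιD) :=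
  hG.flat_left.injective_whiskerLeft (G.isSplitEq_whiskerRight_ιD hG).isSplit Z

end Shepherd

end BimoduleHerds

/-! ### Tbar as an equaliser, the companion maps, and the splittings they provide. -/

namespace BimoduleHerds

open Bimodule

namespace Shepherd

variable {R S A B : Type u} [Ring R] [Ring S] [Ring A] [Ring B]
  {α : R →+* A} {β : S →+* B} {T : Bimodule B A} {That : Bimodule A B}
  {P : FormalDual α β T That} (G : Shepherd P) {M N : Type u} [Ring M] [Ring N]

theorem evγTail_naturality {Z Z' : Bimodule R M} (g : Hom Z Z')
    (w : (P.h ⊗ᵇ (P.t ⊗ᵇ Z) : Bimodule R M)) :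
    G.evγTail Z' ((P.h ◁ᵇ P.t ◁ᵇ g) w) = (P.a ◁ᵇ P.h ◁ᵇ P.t ◁ᵇ g) (G.evγTail Z w) := by
  refine (congrArg (head₂ P.evR _) (whiskerLeft_comm P.h (tail₃_naturality G.γ g) w)).trans ?_
  exact head₂_naturality P.evR _ _

theorem evγTail_hγ (w : (P.h ⊗ᵇ P.t : Bimodule R R)) :
    G.evγTail (P.h ⊗ᵇ P.t) (G.hγ w) = (P.a ◁ᵇ G.hγ) (G.evγ w) := by
  refine (congrArg (head₂ P.evR _) (whiskerLeft_comm P.h G.coassoc_apply w)).trans ?_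
  exact head₂_naturality P.evR _ _

theorem evγTail_tail_γ (Z : Bimodule R M) (w : (P.t ⊗ᵇ Z : Bimodule S M)) :
    (P.t ◁ᵇ G.evγTail Z) (tail₃ G.γ Z w) = (P.t ◁ᵇ P.unitA _) (tail₃ G.γ Z w) := by
  refine (whiskerLeft_comp_apply _ _ _ _).trans ?_
  refine (congrArg _ (G.coassoc_tail Z w).symm).trans ?_
  exact G.ev_tail _ _

theorem γEvHat_γh (w : (P.t ⊗ᵇ P.h : Bimodule S S)) :
    (P.t ◁ᵇ P.h ◁ᵇ G.γEvHat) (G.γh w) = tail₃ G.γ (P.h ⊗ᵇ P.b) (G.γEvHat w) := by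
  have h := whiskerLeft_comp P.t (whiskerLeft_comp P.h (g := P.t ◁ᵇ P.h ◁ᵇ P.evHatS) (f := G.γh)
    (k := G.γEvHat) fun _ => rfl) (G.γh w)
  refine h.symm.trans ?_
  refine (congrArg _ (G.coassoc_tail P.h w).symm).trans ?_
  exact (tail₃_naturality G.γ (P.h ◁ᵇ P.evHatS) _).symm

/-- By coassociativity, testing the D-condition on the last two factors of γ(x) ⊗ v amounts to
applying γ to the D-condition on x ⊗ v itself. -/
theorem γEvHat_γh_ιD (d : G.D) :
    (P.t ◁ᵇ P.h ◁ᵇ G.γEvHat) (G.γh (G.ιD d))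
      = (P.t ◁ᵇ P.h ◁ᵇ P.t ◁ᵇ P.unitRB P.h) (G.γh (G.ιD d)) := by
  rw [γEvHat_γh, G.isEq_ιD.comm]
  exact tail₃_naturality G.γ (P.unitRB P.h) _

theorem evγTail_hγ_ιC (c : G.C) :
    G.evγTail (P.h ⊗ᵇ P.t) (G.hγ (G.ιC c)) = P.unitA _ (G.hγ (G.ιC c)) := by
  rw [evγTail_hγ, G.isEq_ιC.comm]
  rfl

theorem leftIncl_injective (hG : G.Tame) : Function.Injective G.leftIncl :=
  G.tail_ιC_injective hG P.h

theorem rightIncl_injective (hG : G.Tame) : Function.Injective G.rightIncl :=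
  G.whiskerLeft_ιD_injective hG P.h

/-- The inclusion of `Tbar` in `C ⊗ That`. -/
def κC (hG : G.Tame) : Hom G.Tbar (G.C ⊗ᵇ P.h) :=
  liftThrough G.leftIncl (G.leftIncl_injective hG) G.ιTbar fun z => z.2.1

/-- The inclusion of `Tbar` in `That ⊗ D`. -/
def κD (hG : G.Tame) : Hom G.Tbar (P.h ⊗ᵇ G.D) :=
  liftThrough G.rightIncl (G.rightIncl_injective hG) G.ιTbar fun z => z.2.2

theorem leftIncl_κC (hG : G.Tame) (z : G.Tbar) : tail₂ G.ιC P.h (G.κC hG z) = G.ιTbar z :=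
  liftThrough_apply _ _ _ _ z

theorem rightIncl_κD (hG : G.Tame) (z : G.Tbar) : (P.h ◁ᵇ G.ιD) (G.κD hG z) = G.ιTbar z :=
  liftThrough_apply _ _ _ _ z

theorem evγTail_ιTbar (hG : G.Tame) (z : G.Tbar) :
    G.evγTail P.h (G.ιTbar z) = P.unitA _ (G.ιTbar z) := by
  rw [← G.leftIncl_κC hG, (G.isEq_tail_ιC hG P.h).comm]

theorem γEvHat_ιTbar (hG : G.Tame) (z : G.Tbar) :
    (P.h ◁ᵇ G.γEvHat) (G.ιTbar z) = (P.h ◁ᵇ P.t ◁ᵇ P.unitRB P.h) (G.ιTbar z) := by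
  rw [← G.rightIncl_κD hG, (G.isEq_whiskerLeft_ιD hG P.h).comm]

/-- An element of That ⊗ D belongs to `Tbar` when its image lies in C ⊗ That, and the latter is
itself an equaliser. The intersection thus becomes an equaliser, to which flatness applies. -/
theorem isEq_κD (hG : G.Tame) : IsEq (G.κD hG) ((G.evγTail P.h).comp G.rightIncl)
    ((P.unitA _).comp G.rightIncl) := fun y => by
  constructor
  · intro h
    refine ⟨⟨G.rightIncl y, (G.isEq_tail_ιC hG P.h).mem h, y, rfl⟩, ?_⟩
    exact G.rightIncl_injective hG (liftThrough_apply _ _ _ _ _)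
  · rintro ⟨z, rfl⟩
    change G.evγTail P.h ((P.h ◁ᵇ G.ιD) (G.κD hG z)) = P.unitA _ ((P.h ◁ᵇ G.ιD) (G.κD hG z))
    rw [rightIncl_κD, G.evγTail_ιTbar hG]

theorem isEq_κC (hG : G.Tame) : IsEq (G.κC hG) ((P.h ◁ᵇ G.γEvHat).comp G.leftIncl)
    ((P.h ◁ᵇ P.t ◁ᵇ P.unitRB P.h).comp G.leftIncl) := fun y => by
  constructor
  · intro h
    refine ⟨⟨G.leftIncl y, ⟨y, rfl⟩, (G.isEq_whiskerLeft_ιD hG P.h).mem h⟩, ?_⟩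
    exact G.leftIncl_injective hG (liftThrough_apply _ _ _ _ _)
  · rintro ⟨z, rfl⟩
    change (P.h ◁ᵇ G.γEvHat) (tail₂ G.ιC P.h (G.κC hG z))
      = (P.h ◁ᵇ P.t ◁ᵇ P.unitRB P.h) (tail₂ G.ιC P.h (G.κC hG z))
    rw [leftIncl_κC, G.γEvHat_ιTbar hG]

/-- Flatness of `T` over `S` applied to `isEq_κC`, with the target rebracketed. -/
theorem isEq_tail_κC (hG : G.Tame) : IsEq (tail₂ (G.κC hG) P.t)
    ((P.h ◁ᵇ G.γEvHatTail P.t).comp (tail₂ G.ιC (P.h ⊗ᵇ P.t)))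
    ((P.h ◁ᵇ P.t ◁ᵇ P.h ◁ᵇ P.unitB P.t).comp (tail₂ G.ιC (P.h ⊗ᵇ P.t))) := by
  have hi : ∀ y, (P.h ◁ᵇ assoc _ _ _) (assoc _ _ _ ((G.leftIncl ▷ᵇ P.t) y))
      = tail₂ G.ιC (P.h ⊗ᵇ P.t) (assoc _ _ _ y) := tail₃_tail₂ G.ιC
  have hc : Function.Injective ((P.h ◁ᵇ tail₃ (.id (P.t ⊗ᵇ (P.h ⊗ᵇ P.b))) P.t).comp
      (assoc _ _ _)) := by
    have h : IsSplit (tail₃ (.id (P.t ⊗ᵇ (P.h ⊗ᵇ P.b))) P.t) :=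
      ⟨untail₃ _ _ _ _, fun z => (untail₃_tail₃ _ _).trans (tensorHom_id _ _ _)⟩
    exact (h.whiskerLeft P.h).injective.comp (assoc_injective _ _ _)
  refine ((hG.flat_left.isEq_iff _ _ _).1 (G.isEq_κC hG)).of_iso (.id _) (.id _) (fun _ => rfl)
    (assoc _ _ _) (assocInv _ _ _) (assoc_assocInv _ _ _) (assocInv_assoc _ _ _)
    ((P.h ◁ᵇ tail₃ (.id _) P.t).comp (assoc _ _ _)) hc (fun _ => rfl)
    (fun y => ?_) (fun y => ?_)
  · rw [Hom.comp_apply, Hom.comp_apply, whiskerRight_comp_apply, assoc_whisker, ← hi]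
    refine whiskerLeft_comm P.h (fun z => ?_) _
    exact (tail₃_id_whisker _ z).trans (G.γEvHat_tail P.t z)
  · rw [Hom.comp_apply, Hom.comp_apply, whiskerRight_comp_apply, assoc_whisker, ← hi]
    refine whiskerLeft_comm P.h (fun z => ?_) _
    exact (tail₃_id_whisker _ z).trans (unitRB_tail P.t z)

theorem whiskerLeft_ιTbar_injective (hG : G.Tame) : Function.Injective (P.t ◁ᵇ G.ιTbar) :=
  (hG.flat_right.injective_iff _).1 G.ιTbar_injective

theorem tail_ιTbar_injective (hG : G.Tame) : Function.Injective (tail₃ G.ιTbar P.t) := by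
  intro x y h
  apply (hG.flat_left.injective_iff _).1 G.ιTbar_injective
  rw [← untail₃_tail₃, ← untail₃_tail₃, h]

theorem tail_ιC_tail_κC (hG : G.Tame) (Z : Bimodule S M) (u : (G.Tbar ⊗ᵇ Z : Bimodule R M)) :
    tail₂ G.ιC (P.h ⊗ᵇ Z) (tail₂ (G.κC hG) Z u) = tail₃ G.ιTbar Z u :=
  (tail₃_tail₂ G.ιC _).symm.trans (tail₃_comp (G.leftIncl_κC hG) u)

/-- The map `D → T ⊗ Tbar` given by `γ ⊗ That`. -/
def covBar (hG : G.Tame) : Hom G.D (P.t ⊗ᵇ G.Tbar) :=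
  liftThrough (P.t ◁ᵇ G.ιTbar) (G.whiskerLeft_ιTbar_injective hG) (G.γh.comp G.ιD) fun d => by
    -- Membership is obtained in two stages: the D-condition on the last two factors gives T ⊗ That
    -- ⊗ D, and the C-condition on the second and third then gives T ⊗ Tbar.
    obtain ⟨y, hy⟩ := ((hG.flat_right.isEq_iff _ _ _).1 (G.isEq_whiskerLeft_ιD hG P.h)).mem
      (G.γEvHat_γh_ιD d)
    have hy' : (P.t ◁ᵇ (G.evγTail P.h).comp G.rightIncl) y
        = (P.t ◁ᵇ (P.unitA _).comp G.rightIncl) y := by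
      rw [whiskerLeft_comp_apply, whiskerLeft_comp_apply]
      refine (congrArg _ hy).trans (Eq.trans ?_ (congrArg _ hy.symm))
      exact G.evγTail_tail_γ P.h _
    obtain ⟨z, rfl⟩ := ((hG.flat_right.isEq_iff _ _ _).1 (G.isEq_κD hG)).mem hy'
    exact ⟨z, (whiskerLeft_comp P.t (G.rightIncl_κD hG) z).symm.trans hy⟩

theorem ιTbar_covBar (hG : G.Tame) (d : G.D) :
    (P.t ◁ᵇ G.ιTbar) (G.covBar hG d) = G.γh (G.ιD d) := liftThrough_apply _ _ _ _ d

/-- The map `C → Tbar ⊗ T` given by `That ⊗ γ`. -/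
def cov (hG : G.Tame) : Hom G.C (G.Tbar ⊗ᵇ P.t) :=
  liftThrough (tail₃ G.ιTbar P.t) (G.tail_ιTbar_injective hG) (G.hγ.comp G.ιC) fun c => by
    -- First the C-condition on the leading factors gives C ⊗ That ⊗ T; the D-condition on the
    -- second and third factors then gives Tbar ⊗ T.
    obtain ⟨y, hy⟩ := (G.isEq_tail_ιC hG (P.h ⊗ᵇ P.t)).mem (G.evγTail_hγ_ιC c)
    have hy' : (P.h ◁ᵇ G.γEvHatTail P.t) (tail₂ G.ιC (P.h ⊗ᵇ P.t) y)
        = (P.h ◁ᵇ P.t ◁ᵇ P.h ◁ᵇ P.unitB P.t) (tail₂ G.ιC (P.h ⊗ᵇ P.t) y) := by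
      rw [hy]
      exact whiskerLeft_comm P.h G.γEvHatTail_γ _
    obtain ⟨z, rfl⟩ := (G.isEq_tail_κC hG).mem hy'
    exact ⟨z, (G.tail_ιC_tail_κC hG P.t z).symm.trans hy⟩

theorem ιTbar_cov (hG : G.Tame) (c : G.C) :
    tail₃ G.ιTbar P.t (G.cov hG c) = G.hγ (G.ιC c) := liftThrough_apply _ _ _ _ c

theorem ιTbar_cov_tail (hG : G.Tame) (Z : Bimodule R M) (y : (G.C ⊗ᵇ Z : Bimodule R M)) :
    tail₃ G.ιTbar (P.t ⊗ᵇ Z) (tail₂ (G.cov hG) Z y) = (P.h ◁ᵇ tail₃ G.γ Z) (tail₂ G.ιC Z y) := by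
  refine (tail₃_tail₂_of_eq (g := G.hγ.comp G.ιC) (G.ιTbar_cov hG) y).trans ?_
  exact tail₃_whiskerLeft G.ιC G.γ y

/-- The construction used for T ⊗ C, with `covBar` in the role of `γC`: evaluate against the leading
T-factor of `covBar d`, then let the result act on T. -/
theorem isSplit_whiskerLeft_κD (hG : G.Tame) : IsSplit (P.t ◁ᵇ G.κD hG) := by
  let ψ : Hom (P.h ⊗ᵇ G.D) (P.a ⊗ᵇ G.Tbar) := (head₂ P.evR G.Tbar).comp (P.h ◁ᵇ G.covBar hG)
  have hψ : ∀ w, (P.a ◁ᵇ G.ιTbar) (ψ w) = ((G.evγTail P.h).comp G.rightIncl) w := fun w => by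
    refine (head₂_naturality P.evR G.ιTbar _).symm.trans ?_
    exact congrArg _ (whiskerLeft_comm P.h (G.ιTbar_covBar hG) w)
  refine ⟨(head₂ P.actA G.Tbar).comp (P.t ◁ᵇ ψ), fun x => ?_⟩
  apply G.whiskerLeft_ιTbar_injective hG
  refine (head₂_naturality P.actA G.ιTbar _).symm.trans ?_
  refine (congrArg _ (whiskerLeft_comp P.t hψ _)).trans ?_
  rw [whiskerLeft_comm P.t (G.isEq_κD hG).comm,
    whiskerLeft_comp_apply, P.actA_unit_tail]
  exact whiskerLeft_comp P.t (G.rightIncl_κD hG) x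

/-- The retraction applies `cov` to C, evaluates the new T-factor against That, and lets the result
act on T. It is the identity on Tbar ⊗ T by the D-condition. -/
theorem isSplit_tail_κC (hG : G.Tame) : IsSplit (tail₂ (G.κC hG) P.t) := by
  refine ⟨(G.Tbar ◁ᵇ P.actB).comp ((G.Tbar ◁ᵇ head₂ P.evHatS P.t).comp
    (tail₂ (G.cov hG) (P.h ⊗ᵇ P.t))), fun x => ?_⟩
  apply G.tail_ιTbar_injective hG
  rw [Hom.comp_apply, Hom.comp_apply, tail₃_naturality, tail₃_naturality, ιTbar_cov_tail]
  have h1 := whiskerLeft_comp P.h (g := P.t ◁ᵇ P.h ◁ᵇ head₂ P.evHatS P.t)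
    (f := tail₃ G.γ (P.h ⊗ᵇ P.t)) (k := G.γEvHatTail P.t) (fun _ => rfl)
  have h2 := (G.isEq_tail_κC hG).comm x
  rw [Hom.comp_apply, Hom.comp_apply] at h2
  rw [h1, h2, whiskerLeft_cancel P.h (whiskerLeft_cancel P.t (whiskerLeft_cancel P.h P.actB_unit))]
  exact G.tail_ιC_tail_κC hG P.t x

end Shepherd

end BimoduleHerds

/-! ### Descent for α and β, and injectivity of all the inclusions. -/

namespace BimoduleHerds

open Bimodule

section

variable {R S A B : Type u} [Ring R] [Ring S] [Ring A] [Ring B]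
  {α : R →+* A} {β : S →+* B} {T : Bimodule B A} {That : Bimodule A B}
  {P : FormalDual α β T That} {M N : Type u} [Ring M] [Ring N]

namespace FormalDual

/-- The unit map has a left inverse after `T ⊗ -`, and faithful flatness reflects injectivity. -/
theorem unitA_injective (ht : FaithfullyFlatRight R P.t) (X : Bimodule R M) :
    Function.Injective (P.unitA X) :=
  (ht.injective_iff _).2 (Function.LeftInverse.injective (P.actA_unit_tail X))

theorem unitRB_injective (ht : FaithfullyFlatLeft S P.t) (X : Bimodule M S) :
    Function.Injective (P.unitRB X) := by
  refine (ht.injective_iff _).2 (Function.LeftInverse.injective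
    (g := (X ◁ᵇ P.actB).comp (assoc X P.b P.t)) fun z => ?_)
  induction z using induction_on with
  | h0 => simp only [map_zero]
  | ha x y hx hy => simp only [map_add, hx, hy]
  | ht x y => exact congrArg (tmul x) (P.actB_unit y)

theorem unitB_tensor_injective (Z : Bimodule R M) : Function.Injective (P.unitB (P.t ⊗ᵇ Z)) :=
  Function.LeftInverse.injective (P.actB_unit_tail Z)

theorem assoc_unitRA (X : Bimodule M S) (z : (X ⊗ᵇ P.t : Bimodule M R)) :
    assoc X P.t P.a (P.unitRA (X ⊗ᵇ P.t) z) = (X ◁ᵇ P.unitRA P.t) z := by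
  induction z using induction_on with
  | h0 => simp only [map_zero]
  | ha x y hx hy => simp only [map_add, hx, hy]
  | ht x y => rfl

theorem assoc_unitRB (X : Bimodule M R) (z : (X ⊗ᵇ P.h : Bimodule M S)) :
    assoc X P.h P.b (P.unitRB (X ⊗ᵇ P.h) z) = (X ◁ᵇ P.unitRB P.h) z := by
  induction z using induction_on with
  | h0 => simp only [map_zero]
  | ha x y hx hy => simp only [map_add, hx, hy]
  | ht x y => rfl

theorem unitRA_tensor_injective (X : Bimodule M S) :
    Function.Injective (P.unitRA (X ⊗ᵇ P.t)) :=
  Function.LeftInverse.injective (g := (X ◁ᵇ P.actA).comp (assoc X P.t P.a)) fun z =>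
    (congrArg _ (P.assoc_unitRA X z)).trans (whiskerLeft_cancel X P.actA_unit z)

theorem actA_whiskerLeft_unitHom (z : (P.t ⊗ᵇ reg R : Bimodule S R)) :
    P.actA ((P.t ◁ᵇ unitHom α) z) = runit P.t z := by
  induction z using induction_on with
  | h0 => simp only [map_zero]
  | ha x y hx hy => simp only [map_add, hx, hy]
  | ht x y => rfl

theorem actB_whiskerRight_unitHom (z : (reg S ⊗ᵇ P.t : Bimodule S R)) :
    P.actB ((unitHom β ▷ᵇ P.t) z) = lunit P.t z := by
  induction z using induction_on with
  | h0 => simp only [map_zero]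
  | ha x y hx hy => simp only [map_add, hx, hy]
  | ht x y => rfl

theorem unitRA_unitHom (r : R) :
    P.unitRA P.a (unitHom α (r : reg R)) = P.unitA P.a (unitHom α (r : reg R)) := by
  let u : P.a := α 1
  have h1 : (α r : A) = op r • u := show α r = α 1 * α r by rw [map_one, one_mul]
  have h2 : r • u = (α r : A) := show α r * α 1 = α r by rw [map_one, mul_one]
  exact (congrArg (fun z => tmul (X := P.a) (Y := P.a) z u) h1).trans
    ((smul_tmul (X := P.a) (Y := P.a) r u u).trans (congrArg (tmul (X := P.a) (Y := P.a) u) h2))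

theorem unitRB_unitHom (r : S) :
    P.unitB P.b (unitHom β (r : reg S)) = P.unitRB P.b (unitHom β (r : reg S)) := by
  let u : P.b := β 1
  have h1 : (β r : B) = op r • u := show β r = β 1 * β r by rw [map_one, one_mul]
  have h2 : r • u = (β r : B) := show β r * β 1 = β r by rw [map_one, mul_one]
  exact ((congrArg (fun z => tmul (X := P.b) (Y := P.b) z u) h1).trans
    ((smul_tmul (X := P.b) (Y := P.b) r u u).trans
      (congrArg (tmul (X := P.b) (Y := P.b) u) h2))).symm

/-- The start of the Amitsur complex, R → A ⇉ A ⊗ A, is contracted after `T ⊗ -` by the action of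
`A` on `T`. Descent then identifies the image of α with the elements satisfying a ⊗ 1 = 1 ⊗ a. -/
theorem isSplitEq_unitHom_α : IsSplitEq (P.t ◁ᵇ unitHom α) (P.t ◁ᵇ P.unitRA P.a)
    (P.t ◁ᵇ P.unitA P.a) := by
  refine ⟨whiskerLeft_comm P.t P.unitRA_unitHom, (runitInv P.t).comp P.actA, head₂ P.actA P.a,
    fun x => ?_, fun y => ?_, P.actA_unit_tail P.a⟩
  · rw [Hom.comp_apply, actA_whiskerLeft_unitHom, runitInv_runit]
  · induction y using induction_on with
    | h0 => simp only [map_zero]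
    | ha x y hx hy => simp only [map_add, hx, hy]
    | ht x y => rfl

theorem isSplitEq_unitHom_β : IsSplitEq (unitHom β ▷ᵇ P.t) (P.unitB P.b ▷ᵇ P.t)
    (P.unitRB P.b ▷ᵇ P.t) := by
  refine ⟨whiskerRight_comm P.t P.unitRB_unitHom, (lunitInv P.t).comp P.actB,
    (P.b ◁ᵇ P.actB).comp (assoc P.b P.b P.t), fun x => ?_, fun y => ?_, fun y => ?_⟩
  · rw [Hom.comp_apply, actB_whiskerRight_unitHom, lunitInv_lunit]
  · induction y using induction_on with
    | h0 => simp only [map_zero]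
    | ha x y hx hy => simp only [map_add, hx, hy]
    | ht x y => rfl
  · induction y using induction_on with
    | h0 => simp only [map_zero]
    | ha x y hx hy => simp only [map_add, hx, hy]
    | ht x y => exact congrArg (tmul x) (P.actB_unit y)

theorem isEq_unitHom_α (ht : FaithfullyFlatRight R P.t) :
    IsEq (unitHom α) (P.unitRA P.a) (P.unitA P.a) :=
  (ht.isEq_iff _ _ _).2 P.isSplitEq_unitHom_α.isEq

theorem isEq_unitHom_β (ht : FaithfullyFlatLeft S P.t) :
    IsEq (unitHom β) (P.unitB P.b) (P.unitRB P.b) :=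
  (ht.isEq_iff _ _ _).2 P.isSplitEq_unitHom_β.isEq

theorem unitHom_α_injective (ht : FaithfullyFlatRight R P.t) : Function.Injective (unitHom α) :=
  (ht.injective_iff _).2 P.isSplitEq_unitHom_α.isSplit.injective

theorem unitHom_β_injective (ht : FaithfullyFlatLeft S P.t) : Function.Injective (unitHom β) :=
  (ht.injective_iff _).2 P.isSplitEq_unitHom_β.isSplit.injective

end FormalDual

namespace Shepherd

variable (G : Shepherd P)

theorem leftPure_ιD (hG : G.Tame) : LeftPure G.ιD := fun _ _ V => G.whiskerLeft_ιD_injective hG V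

theorem leftPure_tail_ιD (hG : G.Tame) (Z : Bimodule R M) : LeftPure (tail₂ G.ιD (P.t ⊗ᵇ Z)) :=
  ((G.isSplitEq_tail_ιD hG).isSplit.tail₂_tensor Z).leftPure

/-- Stability of `ιC` under left tensoring is claimed only with a factor `T` adjacent to C. In the
embeddings of C ⊗ C and of T ⊗ C such a factor is present. -/
theorem leftPure_whiskerLeft_ιC (hG : G.Tame) : LeftPure (P.t ◁ᵇ G.ιC) :=
  (G.isSplitEq_whiskerLeft_ιC hG).isSplit.leftPure

theorem leftPure_whiskerLeft_tail_ιC (hG : G.Tame) (Z : Bimodule R M) :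
    LeftPure (P.t ◁ᵇ tail₂ G.ιC Z) :=
  ((G.isSplitEq_whiskerLeft_ιC hG).isSplit.whiskerLeft_tail₂ Z).leftPure

theorem tail_ιD_tail_κD (hG : G.Tame) (Z : Bimodule S M) (u : (G.Tbar ⊗ᵇ Z : Bimodule R M)) :
    (P.h ◁ᵇ tail₂ G.ιD Z) (tail₂ (G.κD hG) Z u) = tail₃ G.ιTbar Z u :=
  whiskerLeft_tail₂ (assoc P.t P.h Z) (G.rightIncl_κD hG) u

/-- Factor through T ⊗ That ⊗ D: the first map splits, and `ιD` is injective after any left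
tensoring. -/
theorem leftPure_whiskerLeft_ιTbar (hG : G.Tame) : LeftPure (P.t ◁ᵇ G.ιTbar) := by
  have h : P.t ◁ᵇ G.ιTbar = (P.t ◁ᵇ P.h ◁ᵇ G.ιD).comp (P.t ◁ᵇ G.κD hG) :=
    Hom.ext fun x => (whiskerLeft_comp P.t (G.rightIncl_κD hG) x).symm
  rw [h]
  exact (((G.leftPure_ιD hG).whiskerLeft P.h).whiskerLeft P.t).comp
    (G.isSplit_whiskerLeft_κD hG).leftPure

theorem leftPure_whiskerLeft_tail_ιTbar (hG : G.Tame) : LeftPure (P.t ◁ᵇ tail₃ G.ιTbar P.t) := by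
  have h : P.t ◁ᵇ tail₃ G.ιTbar P.t
      = (P.t ◁ᵇ P.h ◁ᵇ tail₂ G.ιD P.t).comp (P.t ◁ᵇ tail₂ (G.κD hG) P.t) :=
    Hom.ext fun x => (whiskerLeft_comp P.t (G.tail_ιD_tail_κD hG P.t) x).symm
  rw [h]
  exact ((((G.isSplitEq_tail_ιD hG).isSplit.whiskerLeft P.h).whiskerLeft P.t).leftPure).comp
    ((G.isSplit_whiskerLeft_κD hG).whiskerLeft_tail₂ P.t).leftPure

theorem leftPure_whiskerLeft_tail_ιTbar_tensor (hG : G.Tame) (Z : Bimodule R M) :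
    LeftPure (P.t ◁ᵇ tail₃ G.ιTbar (P.t ⊗ᵇ Z)) := by
  have h : P.t ◁ᵇ tail₃ G.ιTbar (P.t ⊗ᵇ Z) = (P.t ◁ᵇ P.h ◁ᵇ tail₂ G.ιD (P.t ⊗ᵇ Z)).comp
      (P.t ◁ᵇ tail₂ (G.κD hG) (P.t ⊗ᵇ Z)) :=
    Hom.ext fun x => (whiskerLeft_comp P.t (G.tail_ιD_tail_κD hG _) x).symm
  rw [h]
  exact (((G.leftPure_tail_ιD hG Z).whiskerLeft P.h).whiskerLeft P.t).comp
    ((G.isSplit_whiskerLeft_κD hG).whiskerLeft_tail₂ _).leftPure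

/-- Here the factorisation goes through C ⊗ That: `κC` splits once `T` stands on its right, and `ιC`
is injective after any right tensoring. -/
theorem tail_ιTbar_tensor_injective (hG : G.Tame) (Z : Bimodule R M) :
    Function.Injective (tail₃ G.ιTbar (P.t ⊗ᵇ Z)) := fun x y hxy => by
  rw [← G.tail_ιC_tail_κC hG, ← G.tail_ιC_tail_κC hG] at hxy
  exact ((G.isSplit_tail_κC hG).tail₂_tensor Z).injective (G.tail_ιC_injective hG _ hxy)

theorem inclCC_apply (y : (G.C ⊗ᵇ G.C : Bimodule R R)) :
    G.inclCC y = tail₂ G.ιC (P.h ⊗ᵇ P.t) ((G.C ◁ᵇ G.ιC) y) :=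
  congrArg (assoc _ _ _) (tensorHom_eq_right _ _ y)

theorem inclDD_apply (y : (G.D ⊗ᵇ G.D : Bimodule S S)) :
    G.inclDD y = tail₂ G.ιD (P.t ⊗ᵇ P.h) ((G.D ◁ᵇ G.ιD) y) :=
  congrArg (assoc _ _ _) (tensorHom_eq_right _ _ y)

theorem inclCTbar_apply (y : (G.C ⊗ᵇ G.Tbar : Bimodule R S)) :
    G.inclCTbar y = tail₂ G.ιC (P.h ⊗ᵇ (P.t ⊗ᵇ P.h)) ((G.C ◁ᵇ G.ιTbar) y) :=
  congrArg (assoc _ _ _) (tensorHom_eq_right _ _ y)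

theorem inclTbarD_apply (y : (G.Tbar ⊗ᵇ G.D : Bimodule R S)) :
    G.inclTbarD y = tail₃ G.ιTbar (P.t ⊗ᵇ P.h) ((G.Tbar ◁ᵇ G.ιD) y) :=
  congrArg (fun z => (P.h ◁ᵇ assoc P.t P.h (P.t ⊗ᵇ P.h)) (assoc P.h (P.t ⊗ᵇ P.h) (P.t ⊗ᵇ P.h) z))
    (tensorHom_eq_right _ _ y)

theorem inclCC_apply' (y : (G.C ⊗ᵇ G.C : Bimodule R R)) :
    G.inclCC y = (P.h ◁ᵇ P.t ◁ᵇ G.ιC) (tail₂ G.ιC G.C y) :=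
  (G.inclCC_apply y).trans (tail₂_naturality _ _ _)

theorem inclCTbar_apply' (y : (G.C ⊗ᵇ G.Tbar : Bimodule R S)) :
    G.inclCTbar y = (P.h ◁ᵇ P.t ◁ᵇ G.ιTbar) (tail₂ G.ιC G.Tbar y) :=
  (G.inclCTbar_apply y).trans (tail₂_naturality _ _ _)

/-- The two copies of C are embedded one at a time. Embedding the left one first creates the factor
`T` that the right one needs. -/
theorem inclCC_injective (hG : G.Tame) : Function.Injective G.inclCC := fun x y hxy => by
  rw [inclCC_apply', inclCC_apply'] at hxy
  exact G.tail_ιC_injective hG _ (G.leftPure_whiskerLeft_ιC hG _ _ hxy)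

theorem leftPure_inclDD (hG : G.Tame) : LeftPure G.inclDD := by
  rw [show G.inclDD = (tail₂ G.ιD (P.t ⊗ᵇ P.h)).comp (G.D ◁ᵇ G.ιD) from Hom.ext G.inclDD_apply]
  exact (G.leftPure_tail_ιD hG P.h).comp ((G.leftPure_ιD hG).whiskerLeft _)

theorem inclDD_injective (hG : G.Tame) : Function.Injective G.inclDD := fun x y hxy => by
  rw [inclDD_apply, inclDD_apply] at hxy
  exact G.leftPure_ιD hG _ _
    (((G.isSplitEq_tail_ιD hG).isSplit.tail₂_tensor P.h).injective hxy)

theorem inclCTbar_injective (hG : G.Tame) : Function.Injective G.inclCTbar := fun x y hxy => by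
  rw [inclCTbar_apply', inclCTbar_apply'] at hxy
  exact G.tail_ιC_injective hG _ (G.leftPure_whiskerLeft_ιTbar hG _ _ hxy)

theorem inclTbarD_injective (hG : G.Tame) : Function.Injective G.inclTbarD := fun x y hxy => by
  rw [inclTbarD_apply, inclTbarD_apply] at hxy
  exact G.leftPure_ιD hG _ _ (G.tail_ιTbar_tensor_injective hG _ hxy)

theorem leftPure_whiskerLeft_inclCC (hG : G.Tame) : LeftPure (P.t ◁ᵇ G.inclCC) := by
  have h : P.t ◁ᵇ G.inclCC = (P.t ◁ᵇ P.h ◁ᵇ P.t ◁ᵇ G.ιC).comp (P.t ◁ᵇ tail₂ G.ιC G.C) :=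
    Hom.ext fun x => (whiskerLeft_comp P.t (fun y => (G.inclCC_apply' y).symm) x).symm
  rw [h]
  exact (((G.leftPure_whiskerLeft_ιC hG).whiskerLeft _).whiskerLeft _).comp
    (G.leftPure_whiskerLeft_tail_ιC hG _)

theorem leftPure_whiskerLeft_inclCTbar (hG : G.Tame) : LeftPure (P.t ◁ᵇ G.inclCTbar) := by
  have h : P.t ◁ᵇ G.inclCTbar
      = (P.t ◁ᵇ P.h ◁ᵇ P.t ◁ᵇ G.ιTbar).comp (P.t ◁ᵇ tail₂ G.ιC G.Tbar) :=
    Hom.ext fun x => (whiskerLeft_comp P.t (fun y => (G.inclCTbar_apply' y).symm) x).symm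
  rw [h]
  exact (((G.leftPure_whiskerLeft_ιTbar hG).whiskerLeft _).whiskerLeft _).comp
    (G.leftPure_whiskerLeft_tail_ιC hG _)

theorem leftPure_whiskerLeft_inclTbarD (hG : G.Tame) : LeftPure (P.t ◁ᵇ G.inclTbarD) := by
  have h : P.t ◁ᵇ G.inclTbarD
      = (P.t ◁ᵇ tail₃ G.ιTbar (P.t ⊗ᵇ P.h)).comp (P.t ◁ᵇ G.Tbar ◁ᵇ G.ιD) :=
    Hom.ext fun x => (whiskerLeft_comp P.t (fun y => (G.inclTbarD_apply y).symm) x).symm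
  rw [h]
  exact (G.leftPure_whiskerLeft_tail_ιTbar_tensor hG _).comp
    (((G.leftPure_ιD hG).whiskerLeft _).whiskerLeft _)

theorem inclusionsInjective (hG : G.Tame) : G.InclusionsInjective where
  α := FormalDual.unitHom_α_injective hG.flat_right
  β := FormalDual.unitHom_β_injective hG.flat_left
  left := G.leftIncl_injective hG
  right := G.rightIncl_injective hG
  CC := G.inclCC_injective hG
  DD := G.inclDD_injective hG
  TC := G.whiskerLeft_ιC_injective hG
  DT := G.tail_ιD_injective hG
  CTbar := G.inclCTbar_injective hG
  TbarD := G.inclTbarD_injective hG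
  TbarT := G.tail_ιTbar_injective hG
  TTbar := G.whiskerLeft_ιTbar_injective hG

end Shepherd

end

end BimoduleHerds

/-! ### Coproducts, counits and coactions as factorisations through the inclusions. -/

namespace BimoduleHerds

open Bimodule

namespace Shepherd

variable {R S A B : Type u} [Ring R] [Ring S] [Ring A] [Ring B]
  {α : R →+* A} {β : S →+* B} {T : Bimodule B A} {That : Bimodule A B}
  {P : FormalDual α β T That} (G : Shepherd P) {M N : Type u} [Ring M] [Ring N]

theorem evγTail_whiskerLeft_tail_γ (Z : Bimodule R M) (w : (P.h ⊗ᵇ (P.t ⊗ᵇ Z) : Bimodule R M)) :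
    G.evγTail (P.h ⊗ᵇ (P.t ⊗ᵇ Z)) ((P.h ◁ᵇ tail₃ G.γ Z) w)
      = (P.a ◁ᵇ P.h ◁ᵇ tail₃ G.γ Z) (G.evγTail Z w) := by
  refine (congrArg (head₂ P.evR _) (whiskerLeft_comm P.h (G.coassoc_tail Z) w)).trans ?_
  exact head₂_naturality P.evR _ _

/-- The coaction on T already puts That ⊗ γ in That ⊗ T ⊗ C; the descended equaliser then moves the
first two factors into C. -/
theorem comulC_mem (hG : G.Tame) (c : G.C) : G.hγ (G.ιC c) ∈ Set.range G.inclCC := by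
  have h : (P.h ◁ᵇ P.t ◁ᵇ G.ιC) ((P.h ◁ᵇ G.γC hG) (G.ιC c)) = G.hγ (G.ιC c) :=
    whiskerLeft_comp P.h (G.ιC_γC hG) _
  -- The equaliser condition is tested after embedding the last C, which is legitimate because that
  -- C stands next to a factor `T`.
  obtain ⟨y, hy⟩ := (G.isEq_tail_ιC hG G.C).mem (y := (P.h ◁ᵇ G.γC hG) (G.ιC c)) (by
    apply (G.leftPure_whiskerLeft_ιC hG).whiskerLeft P.h _ P.a
    rw [← evγTail_naturality, ← FormalDual.unitA_naturality, h]
    exact G.evγTail_hγ_ιC c)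
  exact ⟨y, by rw [inclCC_apply', hy, h]⟩

/-- The order is reversed: `γD` supplies the left D, and the equaliser D ⊗ D inside D ⊗ T ⊗ That
supplies the right one. -/
theorem comulD_mem (hG : G.Tame) (d : G.D) : G.γh (G.ιD d) ∈ Set.range G.inclDD := by
  have h := G.ιD_γD_tail hG P.h (G.ιD d)
  obtain ⟨y, hy⟩ := (G.isEq_whiskerLeft_ιD hG G.D).mem (y := tail₂ (G.γD hG) P.h (G.ιD d)) (by
    apply ((G.isSplitEq_tail_ιD hG).isSplit.tail₂_tensor (P.h ⊗ᵇ P.b)).injective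
    rw [tail₂_naturality, tail₂_naturality, h]
    exact G.γEvHat_γh_ιD d)
  exact ⟨y, by rw [inclDD_apply, hy, h]; rfl⟩

/-- Viewing `Tbar` in That ⊗ D, `covBar` produces the right-hand Tbar; descent for C then produces
the left factor. -/
theorem lcoactTbar_mem (hG : G.Tame) (z : G.Tbar) :
    G.hγh (G.ιTbar z) ∈ Set.range G.inclCTbar := by
  have h : (P.h ◁ᵇ P.t ◁ᵇ G.ιTbar) ((P.h ◁ᵇ G.covBar hG) (G.κD hG z)) = G.hγh (G.ιTbar z) := by
    rw [← G.rightIncl_κD hG]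
    exact whiskerLeft_comm P.h (G.ιTbar_covBar hG) _
  obtain ⟨y, hy⟩ := (G.isEq_tail_ιC hG G.Tbar).mem (y := (P.h ◁ᵇ G.covBar hG) (G.κD hG z)) (by
    apply (G.leftPure_whiskerLeft_ιTbar hG).whiskerLeft P.h _ P.a
    rw [← evγTail_naturality, ← FormalDual.unitA_naturality, h]
    refine (G.evγTail_whiskerLeft_tail_γ P.h _).trans ?_
    rw [G.evγTail_ιTbar hG]
    rfl)
  exact ⟨y, by rw [inclCTbar_apply', hy, h]⟩

/-- Viewing `Tbar` in C ⊗ That, `cov` produces the left-hand Tbar; descent for D then produces the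
right factor. -/
theorem rcoactTbar_mem (hG : G.Tame) (z : G.Tbar) :
    G.hγh (G.ιTbar z) ∈ Set.range G.inclTbarD := by
  have h : tail₃ G.ιTbar (P.t ⊗ᵇ P.h) (tail₂ (G.cov hG) P.h (G.κC hG z))
      = G.hγh (G.ιTbar z) := by
    rw [ιTbar_cov_tail, leftIncl_κC]
    rfl
  obtain ⟨y, hy⟩ := (G.isEq_whiskerLeft_ιD hG G.Tbar).mem
    (y := tail₂ (G.cov hG) P.h (G.κC hG z)) (by
      apply G.tail_ιTbar_tensor_injective hG
      rw [tail₃_naturality, tail₃_naturality, h]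
      refine (whiskerLeft_comm P.h G.γEvHat_γh _).trans ?_
      rw [G.γEvHat_ιTbar hG]
      exact whiskerLeft_comm P.h (tail₃_naturality G.γ (P.unitRB P.h)) _)
  exact ⟨y, by rw [inclTbarD_apply, hy, h]⟩

/-- Applying A ⊗ ev to the equation defining C, and using the axiom for ev on γ(x), gives ev(c) ⊗ 1
= 1 ⊗ ev(c) in A ⊗ A. Descent for α places ev(c) in its image. -/
theorem counitC_mem (hG : G.Tame) (c : G.C) :
    P.evR (G.ιC c) ∈ Set.range (unitHom α) := by
  refine (P.isEq_unitHom_α hG.flat_right).mem ?_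
  rw [FormalDual.unitA_naturality, ← G.isEq_ιC.comm]
  refine Eq.trans ?_ (head₂_naturality P.evR P.evR _)
  refine Eq.trans ?_ (congrArg _ (whiskerLeft_comp P.h G.ev_apply _).symm)
  generalize G.ιC c = w
  induction w using induction_on with
  | h0 => simp only [map_zero]
  | ha x y hx hy => simp only [map_add, hx, hy]
  | ht x y => rfl

theorem counitD_mem (hG : G.Tame) (d : G.D) :
    P.evHatS (G.ιD d) ∈ Set.range (unitHom β) := by
  refine (P.isEq_unitHom_β hG.flat_left).mem ?_
  -- Contracting `γEvHat` once more gives 1 ⊗ evHat(d) by coevaluation; the equation defining D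
  -- turns the same contraction into evHat(d) ⊗ 1.
  have h1 : head₂ P.evHatS P.b (G.γEvHat (G.ιD d)) = P.unitB P.b (P.evHatS (G.ιD d)) := by
    refine (head₂_naturality P.evHatS P.evHatS (G.γh (G.ιD d))).trans ?_
    exact congrArg _ (G.coev_tail P.h _)
  rw [← h1, G.isEq_ιD.comm]
  generalize G.ιD d = w
  induction w using induction_on with
  | h0 => simp only [map_zero]
  | ha x y hx hy => simp only [map_add, hx, hy]
  | ht x y => rfl

/-- The comultiplication of `C`. -/
def comulC (hG : G.Tame) : Hom G.C (G.C ⊗ᵇ G.C) :=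
  liftThrough G.inclCC (G.inclCC_injective hG) (G.hγ.comp G.ιC) (G.comulC_mem hG)

/-- The comultiplication of `D`. -/
def comulD (hG : G.Tame) : Hom G.D (G.D ⊗ᵇ G.D) :=
  liftThrough G.inclDD (G.inclDD_injective hG) (G.γh.comp G.ιD) (G.comulD_mem hG)

/-- The left coaction of `C` on `Tbar`. -/
def lcoactTbar (hG : G.Tame) : Hom G.Tbar (G.C ⊗ᵇ G.Tbar) :=
  liftThrough G.inclCTbar (G.inclCTbar_injective hG) (G.hγh.comp G.ιTbar) (G.lcoactTbar_mem hG)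

/-- The right coaction of `D` on `Tbar`. -/
def rcoactTbar (hG : G.Tame) : Hom G.Tbar (G.Tbar ⊗ᵇ G.D) :=
  liftThrough G.inclTbarD (G.inclTbarD_injective hG) (G.hγh.comp G.ιTbar) (G.rcoactTbar_mem hG)

/-- The counit of `C`. -/
def counitC (hG : G.Tame) : Hom G.C (reg R) :=
  liftThrough (unitHom α) (P.unitHom_α_injective hG.flat_right) (P.evR.comp G.ιC)
    (G.counitC_mem hG)

/-- The counit of `D`. -/
def counitD (hG : G.Tame) : Hom G.D (reg S) :=
  liftThrough (unitHom β) (P.unitHom_β_injective hG.flat_left) (P.evHatS.comp G.ιD)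
    (G.counitD_mem hG)

theorem inclCC_comulC (hG : G.Tame) (c : G.C) : G.inclCC (G.comulC hG c) = G.hγ (G.ιC c) :=
  liftThrough_apply _ _ _ _ c

theorem inclDD_comulD (hG : G.Tame) (d : G.D) : G.inclDD (G.comulD hG d) = G.γh (G.ιD d) :=
  liftThrough_apply _ _ _ _ d

theorem inclCTbar_lcoactTbar (hG : G.Tame) (z : G.Tbar) :
    G.inclCTbar (G.lcoactTbar hG z) = G.hγh (G.ιTbar z) := liftThrough_apply _ _ _ _ z

theorem inclTbarD_rcoactTbar (hG : G.Tame) (z : G.Tbar) :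
    G.inclTbarD (G.rcoactTbar hG z) = G.hγh (G.ιTbar z) := liftThrough_apply _ _ _ _ z

theorem unitHom_counitC (hG : G.Tame) (c : G.C) :
    unitHom α (G.counitC hG c) = P.evR (G.ιC c) := liftThrough_apply _ _ _ _ c

theorem unitHom_counitD (hG : G.Tame) (d : G.D) :
    unitHom β (G.counitD hG d) = P.evHatS (G.ιD d) := liftThrough_apply _ _ _ _ d

theorem ιC_comulC (hG : G.Tame) (c : G.C) :
    tail₂ G.ιC (P.h ⊗ᵇ P.t) ((G.C ◁ᵇ G.ιC) (G.comulC hG c)) = G.hγ (G.ιC c) := by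
  rw [← inclCC_apply, inclCC_comulC]

theorem ιD_comulD (hG : G.Tame) (d : G.D) :
    tail₂ G.ιD (P.t ⊗ᵇ P.h) ((G.D ◁ᵇ G.ιD) (G.comulD hG d)) = G.γh (G.ιD d) := by
  rw [← inclDD_apply, inclDD_comulD]

theorem ιC_lcoactTbar (hG : G.Tame) (z : G.Tbar) :
    tail₂ G.ιC (P.h ⊗ᵇ (P.t ⊗ᵇ P.h)) ((G.C ◁ᵇ G.ιTbar) (G.lcoactTbar hG z))
      = G.hγh (G.ιTbar z) := by
  rw [← inclCTbar_apply, inclCTbar_lcoactTbar]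

theorem ιTbar_rcoactTbar (hG : G.Tame) (z : G.Tbar) :
    tail₃ G.ιTbar (P.t ⊗ᵇ P.h) ((G.Tbar ◁ᵇ G.ιD) (G.rcoactTbar hG z)) = G.hγh (G.ιTbar z) := by
  rw [← inclTbarD_apply, inclTbarD_rcoactTbar]

/-- Once embedded, the coproduct next to a spectator `Z` is an insertion of γ. This and its
analogues below reduce iterated coactions to iterates of γ. -/
theorem ιC_comulC_tail (hG : G.Tame) (Z : Bimodule R M) (y : (G.C ⊗ᵇ Z : Bimodule R M)) :
    tail₂ G.ιC (P.h ⊗ᵇ (P.t ⊗ᵇ Z)) ((G.C ◁ᵇ tail₂ G.ιC Z) (tail₂ (G.comulC hG) Z y))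
      = (P.h ◁ᵇ tail₃ G.γ Z) (tail₂ G.ιC Z y) :=
  (tail₂_whisker_tail₂ (assoc P.h P.t Z) (g := G.hγ.comp G.ιC) (G.ιC_comulC hG) y).trans
    ((whiskerLeft_assoc_tail₃ _ y).trans (tail₃_whiskerLeft G.ιC G.γ y))

theorem ιD_comulD_tail (hG : G.Tame) (Z : Bimodule S M) (y : (G.D ⊗ᵇ Z : Bimodule S M)) :
    tail₂ G.ιD (P.t ⊗ᵇ (P.h ⊗ᵇ Z)) ((G.D ◁ᵇ tail₂ G.ιD Z) (tail₂ (G.comulD hG) Z y))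
      = tail₃ G.γ (P.h ⊗ᵇ Z) (tail₂ G.ιD Z y) :=
  (tail₂_whisker_tail₂ (assoc P.t P.h Z) (g := G.γh.comp G.ιD) (G.ιD_comulD hG) y).trans
    (tail₃_tail₃ G.ιD G.γ y)

theorem ιC_γC_tail (hG : G.Tame) (Z : Bimodule R M) (y : (P.t ⊗ᵇ Z : Bimodule S M)) :
    (P.t ◁ᵇ tail₂ G.ιC Z) (tail₂ (G.γC hG) Z y) = tail₃ G.γ Z y :=
  whiskerLeft_tail₂ (assoc P.h P.t Z) (G.ιC_γC hG) y

theorem ιTbar_covBar_tail (hG : G.Tame) (Z : Bimodule S M) (y : (G.D ⊗ᵇ Z : Bimodule S M)) :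
    (P.t ◁ᵇ tail₃ G.ιTbar Z) (tail₂ (G.covBar hG) Z y)
      = tail₃ G.γ (P.h ⊗ᵇ Z) (tail₂ G.ιD Z y) := by
  refine (whiskerLeft_tail₂ ((P.h ◁ᵇ assoc P.t P.h Z).comp (assoc P.h (P.t ⊗ᵇ P.h) Z))
    (g := G.γh.comp G.ιD) (G.ιTbar_covBar hG) y).trans ?_
  rw [whiskerLeft_comp_apply]
  exact tail₃_tail₃ G.ιD G.γ y

theorem ιC_lcoactTbar_tail (hG : G.Tame) (Z : Bimodule S M) (y : (G.Tbar ⊗ᵇ Z : Bimodule R M)) :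
    tail₂ G.ιC (P.h ⊗ᵇ (P.t ⊗ᵇ (P.h ⊗ᵇ Z)))
        ((G.C ◁ᵇ tail₃ G.ιTbar Z) (tail₂ (G.lcoactTbar hG) Z y))
      = (P.h ◁ᵇ tail₃ G.γ (P.h ⊗ᵇ Z)) (tail₃ G.ιTbar Z y) := by
  refine (tail₂_whisker_tail₂ ((P.h ◁ᵇ assoc P.t P.h Z).comp (assoc P.h (P.t ⊗ᵇ P.h) Z))
    (g := G.hγh.comp G.ιTbar) (G.ιC_lcoactTbar hG) y).trans ?_
  induction y using induction_on with
  | h0 => simp only [map_zero]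
  | ha x y hx hy => simp only [map_add, hx, hy]
  | ht x z =>
    rw [tail₃_tmul (G.hγh.comp G.ιTbar), tail₃_tmul G.ιTbar, Hom.comp_apply]
    generalize G.ιTbar x = w
    induction w using induction_right with
    | h0 => simp only [zero_tmul, map_zero]
    | ha x y hx hy => simp only [add_tmul, map_add, hx, hy]
    | ht v x w =>
      change (P.h ◁ᵇ P.t ◁ᵇ (P.h ◁ᵇ assoc P.t P.h Z).comp (assoc P.h (P.t ⊗ᵇ P.h) Z))
        (tail₃ (.id _) Z (tmul (tmul v (tail₃ (.id _) P.h (tmul (G.γ x) w))) z))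
        = tmul v (tail₃ (.id _) (P.h ⊗ᵇ Z) (tmul (G.γ x) (tmul w z)))
      generalize G.γ x = u
      induction u using induction_right with
      | h0 => simp only [zero_tmul, tmul_zero, map_zero]
      | ha x y hx hy => simp only [add_tmul, tmul_add, map_add, hx, hy]
      | ht x v y => rfl

theorem ιTbar_rcoactTbar_tail (hG : G.Tame) (Z : Bimodule S M)
    (y : (G.Tbar ⊗ᵇ Z : Bimodule R M)) :
    tail₃ G.ιTbar (P.t ⊗ᵇ (P.h ⊗ᵇ Z))
        ((G.Tbar ◁ᵇ tail₂ G.ιD Z) (tail₂ (G.rcoactTbar hG) Z y))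
      = (P.h ◁ᵇ tail₃ G.γ (P.h ⊗ᵇ Z)) (tail₃ G.ιTbar Z y) := by
  refine (tail₃_whisker_tail₂ (assoc P.t P.h Z) (g := G.hγh.comp G.ιTbar)
    (G.ιTbar_rcoactTbar hG) y).trans ?_
  induction y using induction_on with
  | h0 => simp only [map_zero]
  | ha x y hx hy => simp only [map_add, hx, hy]
  | ht x z =>
    rw [tail₂_tmul, tail₃_tmul G.ιTbar, Hom.comp_apply]
    generalize G.ιTbar x = w
    induction w using induction_right with
    | h0 => simp only [zero_tmul, map_zero]
    | ha x y hx hy => simp only [add_tmul, map_add, hx, hy]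
    | ht v x w =>
      change (P.h ◁ᵇ P.t ◁ᵇ P.h ◁ᵇ assoc P.t P.h Z)
        (tmul v (tail₃ (.id _) Z (tmul (tail₃ (.id _) P.h (tmul (G.γ x) w)) z)))
        = tmul v (tail₃ (.id _) (P.h ⊗ᵇ Z) (tmul (G.γ x) (tmul w z)))
      generalize G.γ x = u
      induction u using induction_right with
      | h0 => simp only [zero_tmul, tmul_zero, map_zero]
      | ha x y hx hy => simp only [add_tmul, tmul_add, map_add, hx, hy]
      | ht x v y => rfl

end Shepherd

end BimoduleHerds

/-! ### Verification of the coring, bicomodule and companion axioms. -/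

namespace BimoduleHerds

open Bimodule

namespace Shepherd

variable {R S A B : Type u} [Ring R] [Ring S] [Ring A] [Ring B]
  {α : R →+* A} {β : S →+* B} {T : Bimodule B A} {That : Bimodule A B}
  {P : FormalDual α β T That} (G : Shepherd P) {M N : Type u} [Ring M] [Ring N]

/-! ### Counits -/

theorem unitA_lunit (X : Bimodule R M) (z : (reg R ⊗ᵇ X : Bimodule R M)) :
    P.unitA X (lunit X z) = (unitHom α ▷ᵇ X) z :=
  congrArg (unitHom α ▷ᵇ X) (lunitInv_lunit X z)

theorem unitB_lunit (X : Bimodule S M) (z : (reg S ⊗ᵇ X : Bimodule S M)) :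
    P.unitB X (lunit X z) = (unitHom β ▷ᵇ X) z :=
  congrArg (unitHom β ▷ᵇ X) (lunitInv_lunit X z)

theorem unitRA_runit (X : Bimodule M R) (z : (X ⊗ᵇ reg R : Bimodule M R)) :
    P.unitRA X (runit X z) = (X ◁ᵇ unitHom α) z :=
  congrArg (X ◁ᵇ unitHom α) (runitInv_runit X z)

theorem unitRB_runit (X : Bimodule M S) (z : (X ⊗ᵇ reg S : Bimodule M S)) :
    P.unitRB X (runit X z) = (X ◁ᵇ unitHom β) z :=
  congrArg (X ◁ᵇ unitHom β) (runitInv_runit X z)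

/-- The counit is known only through its composite with α, so counit laws are read in A ⊗ Z, where
the counit becomes ev. -/
theorem unitA_lunit_counitC (hG : G.Tame) (Z : Bimodule R M) (z : (G.C ⊗ᵇ Z : Bimodule R M)) :
    P.unitA Z (lunit Z ((G.counitC hG ▷ᵇ Z) z)) = head₂ P.evR Z (tail₂ G.ιC Z z) := by
  rw [unitA_lunit, whiskerRight_comm Z (k := P.evR) (l := G.ιC) (G.unitHom_counitC hG)]
  exact congrArg _ (assocInv_assoc _ _ _ _).symm

theorem unitB_lunit_counitD (hG : G.Tame) (Z : Bimodule S M) (z : (G.D ⊗ᵇ Z : Bimodule S M)) :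
    P.unitB Z (lunit Z ((G.counitD hG ▷ᵇ Z) z)) = head₂ P.evHatS Z (tail₂ G.ιD Z z) := by
  rw [unitB_lunit, whiskerRight_comm Z (k := P.evHatS) (l := G.ιD) (G.unitHom_counitD hG)]
  exact congrArg _ (assocInv_assoc _ _ _ _).symm

theorem lunit_naturality {K L : Type u} [Ring K] [Ring L] {X Y : Bimodule K L} (f : Hom X Y)
    (z : (reg K ⊗ᵇ X : Bimodule K L)) : f (lunit X z) = lunit Y ((reg K ◁ᵇ f) z) := by
  induction z using induction_on with
  | h0 => simp only [map_zero]
  | ha x y hx hy => simp only [map_add, hx, hy]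
  | ht k x => exact f.map_smul k x

theorem runit_naturality {K L : Type u} [Ring K] [Ring L] {X Y : Bimodule K L} (f : Hom X Y)
    (z : (X ⊗ᵇ reg L : Bimodule K L)) : f (runit X z) = runit Y ((f ▷ᵇ reg L) z) := by
  induction z using induction_on with
  | h0 => simp only [map_zero]
  | ha x y hx hy => simp only [map_add, hx, hy]
  | ht x k => exact f.map_op_smul (op k) x

/-- In A ⊗ That ⊗ T this is exactly the equation defining C. The right counit law rests instead on
the axiom for ev; for D the two roles are exchanged. -/
theorem counitC_left (hG : G.Tame) (c : G.C) :
    lunit G.C ((G.counitC hG ▷ᵇ G.C) (G.comulC hG c)) = c := by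
  apply G.ιC_injective
  apply P.unitA_injective hG.flat_right
  rw [lunit_naturality, ← whisker_exchange, unitA_lunit_counitC, ιC_comulC, ← G.isEq_ιC.comm]
  rfl

theorem counitC_right (hG : G.Tame) (c : G.C) :
    runit G.C ((G.C ◁ᵇ G.counitC hG) (G.comulC hG c)) = c := by
  apply G.ιC_injective
  apply P.unitRA_tensor_injective P.h
  apply assoc_injective
  rw [runit_naturality, unitRA_runit, whisker_exchange,
    whiskerLeft_comm _ (k := P.evR) (l := G.ιC) (G.unitHom_counitC hG), assoc_naturality_right,
    ← whisker_exchange, FormalDual.assoc_unitRA]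
  refine (congrArg _ (G.ιC_comulC hG c)).trans ?_
  exact whiskerLeft_comp P.h G.ev_apply _

theorem counitD_left (hG : G.Tame) (d : G.D) :
    lunit G.D ((G.counitD hG ▷ᵇ G.D) (G.comulD hG d)) = d := by
  apply G.ιD_injective
  apply P.unitB_tensor_injective
  rw [lunit_naturality, ← whisker_exchange, unitB_lunit_counitD, ιD_comulD]
  exact G.coev_tail P.h _

theorem counitD_right (hG : G.Tame) (d : G.D) :
    runit G.D ((G.D ◁ᵇ G.counitD hG) (G.comulD hG d)) = d := by
  apply G.ιD_injective
  apply P.unitRB_injective hG.flat_left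
  apply assoc_injective
  rw [runit_naturality, unitRB_runit, whisker_exchange,
    whiskerLeft_comm _ (k := P.evHatS) (l := G.ιD) (G.unitHom_counitD hG), assoc_naturality_right,
    ← whisker_exchange, FormalDual.assoc_unitRB]
  refine (congrArg _ (G.ιD_comulD hG d)).trans ?_
  exact G.isEq_ιD.comm d

theorem counitD_γD (hG : G.Tame) (x : P.t) :
    lunit P.t ((G.counitD hG ▷ᵇ P.t) (G.γD hG x)) = x := by
  apply Function.LeftInverse.injective P.actB_unit
  rw [unitB_lunit_counitD, ιD_γD, coev_apply]

theorem counitC_γC (hG : G.Tame) (x : P.t) :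
    runit P.t ((P.t ◁ᵇ G.counitC hG) (G.γC hG x)) = x := by
  apply Function.LeftInverse.injective P.actA_unit
  rw [unitRA_runit, whiskerLeft_comm _ (k := P.evR) (l := G.ιC) (G.unitHom_counitC hG), ιC_γC,
    ev_apply]

theorem counitC_lcoactTbar (hG : G.Tame) (z : G.Tbar) :
    lunit G.Tbar ((G.counitC hG ▷ᵇ G.Tbar) (G.lcoactTbar hG z)) = z := by
  apply G.ιTbar_injective
  apply P.unitA_injective hG.flat_right
  rw [lunit_naturality, ← whisker_exchange, unitA_lunit_counitC, ιC_lcoactTbar,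
    ← G.evγTail_ιTbar hG]
  rfl

theorem counitD_rcoactTbar (hG : G.Tame) (z : G.Tbar) :
    runit G.Tbar ((G.Tbar ◁ᵇ G.counitD hG) (G.rcoactTbar hG z)) = z := by
  apply G.ιTbar_injective
  apply P.unitRB_injective hG.flat_left
  apply tail₃_id_injective
  have h : ∀ w : (P.h ⊗ᵇ (P.t ⊗ᵇ P.h) : Bimodule R S), tail₃ (.id _) P.b (P.unitRB _ w)
      = (P.h ◁ᵇ P.t ◁ᵇ P.unitRB P.h) w := fun w => by
    induction w using induction_right with
    | h0 => simp only [map_zero]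
    | ha x y hx hy => simp only [map_add, hx, hy]
    | ht x v y => rfl
  rw [h (G.ιTbar z), runit_naturality, unitRB_runit, whisker_exchange,
    whiskerLeft_comm _ (k := P.evHatS) (l := G.ιD) (G.unitHom_counitD hG), tail₃_naturality,
    ← whisker_exchange, tail₃_id_whisker, ιTbar_rcoactTbar, ← G.γEvHat_ιTbar hG]
  exact whiskerLeft_comp P.h (fun _ => rfl) _

/-! ### Coassociativity -/

theorem coassoc_hγ (w : (P.h ⊗ᵇ P.t : Bimodule R R)) :
    (P.h ◁ᵇ tail₃ G.γ (P.h ⊗ᵇ P.t)) (G.hγ w) = (P.h ◁ᵇ P.t ◁ᵇ G.hγ) (G.hγ w) :=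
  whiskerLeft_comm P.h G.coassoc_apply w

theorem coassoc_hγh (w : (P.h ⊗ᵇ (P.t ⊗ᵇ P.h) : Bimodule R S)) :
    (P.h ◁ᵇ tail₃ G.γ (P.h ⊗ᵇ (P.t ⊗ᵇ P.h))) (G.hγh w) = (P.h ◁ᵇ P.t ◁ᵇ G.hγh) (G.hγh w) :=
  whiskerLeft_comm P.h (G.coassoc_tail P.h) w

/-- The model for the remaining diagrams: the target is embedded in two stages, the leftmost factor
first, whereupon both sides are two insertions of γ and agree by its coassociativity. -/
theorem comulC_coassoc (hG : G.Tame) (c : G.C) :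
    tail₂ (G.comulC hG) G.C (G.comulC hG c) = (G.C ◁ᵇ G.comulC hG) (G.comulC hG c) := by
  apply G.tail_ιC_injective hG
  apply (G.leftPure_whiskerLeft_inclCC hG) _ P.h
  rw [← tail₂_naturality, ← tail₂_naturality, whiskerLeft_comm _ (G.inclCC_comulC hG),
    tail₂_naturality G.ιC G.hγ, ιC_comulC, ← coassoc_hγ, ← G.ιC_comulC hG, ← G.ιC_comulC_tail hG,
    tail₂_naturality (G.comulC hG)]
  exact congrArg _ (whiskerLeft_comp _ (fun y => (G.inclCC_apply y).symm) _).symm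

theorem comulD_coassoc (hG : G.Tame) (d : G.D) :
    tail₂ (G.comulD hG) G.D (G.comulD hG d) = (G.D ◁ᵇ G.comulD hG) (G.comulD hG d) := by
  apply G.leftPure_inclDD hG
  apply ((G.isSplitEq_tail_ιD hG).isSplit.tail₂_tensor (P.h ⊗ᵇ (P.t ⊗ᵇ P.h))).injective
  rw [whiskerLeft_comm _ (G.inclDD_comulD hG), tail₂_naturality G.ιD G.γh, ιD_comulD]
  refine Eq.trans ?_ (G.coassoc_tail P.h _)
  refine Eq.trans ?_ (congrArg _ (G.ιD_comulD hG d))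
  rw [← G.ιD_comulD_tail hG, tail₂_naturality (G.comulD hG)]
  exact congrArg _ (whiskerLeft_comp _ (fun y => (G.inclDD_apply y).symm) _).symm

theorem γD_coassoc (hG : G.Tame) (x : P.t) :
    tail₂ (G.comulD hG) P.t (G.γD hG x) = (G.D ◁ᵇ G.γD hG) (G.γD hG x) := by
  have h : LeftPure (tail₂ G.ιD P.t) := (G.isSplitEq_tail_ιD hG).isSplit.leftPure
  apply h
  apply ((G.isSplitEq_tail_ιD hG).isSplit.tail₂_tensor (P.h ⊗ᵇ P.t)).injective
  rw [ιD_comulD_tail, whiskerLeft_comp _ (G.ιD_γD hG), tail₂_naturality, ιD_γD, coassoc_apply]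

theorem γC_coassoc (hG : G.Tame) (x : P.t) :
    tail₂ (G.γC hG) G.C (G.γC hG x) = (P.t ◁ᵇ G.comulC hG) (G.γC hG x) := by
  have h : Function.Injective (P.t ◁ᵇ G.inclCC) :=
    (hG.flat_right.injective_iff _).1 (G.inclCC_injective hG)
  apply h
  rw [whiskerLeft_comm _ (G.inclCC_comulC hG), ιC_γC]
  refine Eq.trans ?_ (G.coassoc_apply x)
  rw [← ιC_γC_tail G hG]
  refine Eq.trans ?_ (congrArg (fun y => (P.t ◁ᵇ tail₂ G.ιC (P.h ⊗ᵇ P.t))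
    (tail₂ (G.γC hG) (P.h ⊗ᵇ P.t) y)) (G.ιC_γC hG x))
  rw [tail₂_naturality (G.γC hG)]
  exact (whiskerLeft_comp _ (fun y => (G.inclCC_apply y).symm) _).symm

theorem γD_γC (hG : G.Tame) (x : P.t) :
    tail₂ (G.γD hG) G.C (G.γC hG x) = (G.D ◁ᵇ G.γC hG) (G.γD hG x) := by
  apply G.leftPure_whiskerLeft_ιC hG
  apply ((G.isSplitEq_tail_ιD hG).isSplit.tail₂_tensor (P.h ⊗ᵇ P.t)).injective
  rw [← tail₂_naturality, ιD_γD_tail, ιC_γC, whiskerLeft_comp _ (G.ιC_γC hG), tail₂_naturality,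
    ιD_γD, coassoc_apply]

theorem lcoactTbar_coassoc (hG : G.Tame) (z : G.Tbar) :
    tail₂ (G.comulC hG) G.Tbar (G.lcoactTbar hG z)
      = (G.C ◁ᵇ G.lcoactTbar hG) (G.lcoactTbar hG z) := by
  apply G.tail_ιC_injective hG
  apply (G.leftPure_whiskerLeft_inclCTbar hG) _ P.h
  rw [← tail₂_naturality, ← tail₂_naturality, whiskerLeft_comm _ (G.inclCTbar_lcoactTbar hG),
    tail₂_naturality G.ιC G.hγh, ιC_lcoactTbar, ← coassoc_hγh, ← G.ιC_lcoactTbar hG, ← G.ιC_comulC_tail hG,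
    tail₂_naturality (G.comulC hG)]
  exact congrArg _ (whiskerLeft_comp _ (fun y => (G.inclCTbar_apply y).symm) _).symm

theorem rcoactTbar_coassoc (hG : G.Tame) (z : G.Tbar) :
    tail₂ (G.rcoactTbar hG) G.D (G.rcoactTbar hG z)
      = (G.Tbar ◁ᵇ G.comulD hG) (G.rcoactTbar hG z) := by
  apply G.leftPure_inclDD hG
  apply G.tail_ιTbar_tensor_injective hG
  rw [whiskerLeft_comm _ (G.inclDD_comulD hG), tail₃_naturality G.ιTbar G.γh, ιTbar_rcoactTbar]
  refine Eq.trans ?_ (G.coassoc_hγh _)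
  rw [← G.ιTbar_rcoactTbar hG, ← G.ιTbar_rcoactTbar_tail hG, tail₂_naturality (G.rcoactTbar hG)]
  exact congrArg _ (whiskerLeft_comp _ (fun y => (G.inclDD_apply y).symm) _).symm

theorem lcoactTbar_rcoactTbar (hG : G.Tame) (z : G.Tbar) :
    tail₂ (G.lcoactTbar hG) G.D (G.rcoactTbar hG z)
      = (G.C ◁ᵇ G.rcoactTbar hG) (G.lcoactTbar hG z) := by
  apply G.tail_ιC_injective hG
  apply (G.leftPure_whiskerLeft_inclTbarD hG) _ P.h
  rw [← tail₂_naturality, ← tail₂_naturality, whiskerLeft_comm _ (G.inclTbarD_rcoactTbar hG),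
    tail₂_naturality G.ιC G.hγh, ιC_lcoactTbar, ← coassoc_hγh, ← G.ιTbar_rcoactTbar hG, ← G.ιC_lcoactTbar_tail hG,
    tail₂_naturality (G.lcoactTbar hG)]
  exact congrArg _ (whiskerLeft_comp _ (fun y => (G.inclTbarD_apply y).symm) _).symm

/-! ### The companion -/

theorem cov_left (hG : G.Tame) (c : G.C) :
    tail₂ (G.lcoactTbar hG) P.t (G.cov hG c) = (G.C ◁ᵇ G.cov hG) (G.comulC hG c) := by
  apply G.tail_ιC_injective hG
  apply (G.leftPure_whiskerLeft_tail_ιTbar hG) _ P.h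
  rw [← tail₂_naturality, ← tail₂_naturality, whiskerLeft_comm _ (G.ιTbar_cov hG),
    tail₂_naturality G.ιC G.hγ, ιC_comulC, ← coassoc_hγ, ← G.ιTbar_cov hG, ← G.ιC_lcoactTbar_tail hG]

theorem cov_right (hG : G.Tame) (c : G.C) :
    (G.Tbar ◁ᵇ G.γC hG) (G.cov hG c) = tail₂ (G.cov hG) G.C (G.comulC hG c) := by
  apply G.leftPure_whiskerLeft_ιC hG
  apply G.tail_ιTbar_tensor_injective hG
  rw [whiskerLeft_comp _ (G.ιC_γC hG), tail₃_naturality, ιTbar_cov, ← tail₂_naturality,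
    ιTbar_cov_tail, ιC_comulC, coassoc_hγ]
  exact whiskerLeft_comm P.h (g := P.t ◁ᵇ P.h ◁ᵇ G.γ) (k := P.t ◁ᵇ G.hγ) (fun _ => rfl) _

theorem covBar_left (hG : G.Tame) (d : G.D) :
    tail₂ (G.γD hG) G.Tbar (G.covBar hG d) = (G.D ◁ᵇ G.covBar hG) (G.comulD hG d) := by
  apply G.leftPure_whiskerLeft_ιTbar hG
  apply ((G.isSplitEq_tail_ιD hG).isSplit.tail₂_tensor (P.h ⊗ᵇ (P.t ⊗ᵇ P.h))).injective
  rw [← tail₂_naturality, ιD_γD_tail, ιTbar_covBar, whiskerLeft_comm _ (G.ιTbar_covBar hG),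
    tail₂_naturality, ιD_comulD]
  exact G.coassoc_tail P.h _

theorem covBar_right (hG : G.Tame) (d : G.D) :
    (P.t ◁ᵇ G.rcoactTbar hG) (G.covBar hG d) = tail₂ (G.covBar hG) G.D (G.comulD hG d) := by
  have h : Function.Injective (P.t ◁ᵇ G.inclTbarD) :=
    (hG.flat_right.injective_iff _).1 (G.inclTbarD_injective hG)
  apply h
  rw [whiskerLeft_comm _ (G.inclTbarD_rcoactTbar hG), ιTbar_covBar]
  refine (G.coassoc_tail P.h _).symm.trans ?_
  refine (congrArg _ (G.ιD_comulD hG d)).symm.trans ?_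
  rw [← G.ιTbar_covBar_tail hG, tail₂_naturality (G.covBar hG)]
  exact whiskerLeft_comp _ (fun y => (G.inclTbarD_apply y).symm) _

/-- Both composites embed as the two sides of the coassociativity of γ, through T ⊗ C and D ⊗ T
respectively. -/
theorem diag_T (hG : G.Tame) (x : P.t) :
    (P.t ◁ᵇ G.cov hG) (G.γC hG x) = tail₂ (G.covBar hG) P.t (G.γD hG x) := by
  have h : Function.Injective (P.t ◁ᵇ tail₃ G.ιTbar P.t) :=
    (hG.flat_right.injective_iff _).1 (G.tail_ιTbar_injective hG)
  apply h
  rw [whiskerLeft_comm _ (G.ιTbar_cov hG), ιC_γC, ιTbar_covBar_tail, ιD_γD, coassoc_apply]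
  rfl

theorem diag_Tbar (hG : G.Tame) (z : G.Tbar) :
    tail₂ (G.cov hG) G.Tbar (G.lcoactTbar hG z) = (G.Tbar ◁ᵇ G.covBar hG) (G.rcoactTbar hG z) := by
  apply G.leftPure_whiskerLeft_ιTbar hG
  apply G.tail_ιTbar_tensor_injective hG
  rw [← tail₂_naturality, ιTbar_cov_tail, ιC_lcoactTbar, coassoc_hγh,
    whiskerLeft_comm _ (G.ιTbar_covBar hG), tail₃_naturality, ιTbar_rcoactTbar]
  exact whiskerLeft_comm P.h (g := P.t ◁ᵇ G.hγh) (k := P.t ◁ᵇ P.h ◁ᵇ G.γh) (fun _ => rfl) _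

end Shepherd

end BimoduleHerds

/-! ### The contraction χ, the coherd axioms, and assembly of the structures. -/

namespace BimoduleHerds

open Bimodule

section

variable {R S A B : Type u} [Ring R] [Ring S] [Ring A] [Ring B]
  {α : R →+* A} {β : S →+* B} {T : Bimodule B A} {That : Bimodule A B}

namespace FormalDual

variable (P : FormalDual α β T That)

theorem pair_op_smul (v : That) (x : T) (l : A) : P.pair v (op l • x) = P.pair v x * l :=
  P.ev.map_op_smul' (op l)
    (Bimodule.tmul (X := That.restrict (.id A) β) (Y := T.restrict β (.id A)) v x)

theorem pairHat_smul (x : T) (v : That) (y : T) : P.pairHat x v • y = op (P.pair v y) • x :=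
  P.diag_T x v y

/-- The map `x ⊗ v ⊗ y ⊗ w ⊗ z ↦ evHat (x ⊗ v) y ev (w ⊗ z)`. -/
def contract : Hom (P.t ⊗ᵇ (P.h ⊗ᵇ (P.t ⊗ᵇ (P.h ⊗ᵇ P.t)))) P.t :=
  P.actB.comp ((head₂ P.evHatS P.t).comp (P.t ◁ᵇ P.h ◁ᵇ P.actA.comp (P.t ◁ᵇ P.evR)))

end FormalDual

namespace Shepherd

variable {P : FormalDual α β T That} (G : Shepherd P)

/-- The coring structure on `C`. -/
def coringC (hG : G.Tame) : Coring G.C where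
  comul := G.comulC hG
  counit := G.counitC hG
  coassoc := Hom.ext (G.comulC_coassoc hG)
  counit_left := Hom.ext (G.counitC_left hG)
  counit_right := Hom.ext (G.counitC_right hG)

/-- The coring structure on `D`. -/
def coringD (hG : G.Tame) : Coring G.D where
  comul := G.comulD hG
  counit := G.counitD hG
  coassoc := Hom.ext (G.comulD_coassoc hG)
  counit_left := Hom.ext (G.counitD_left hG)
  counit_right := Hom.ext (G.counitD_right hG)

/-- The bicomodule structure on `T`. -/
def bicomoduleT (hG : G.Tame) : Bicomodule (G.coringD hG) (G.coringC hG) P.t where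
  lcoact := G.γD hG
  rcoact := G.γC hG
  lcoassoc := Hom.ext (G.γD_coassoc hG)
  lcounit := Hom.ext (G.counitD_γD hG)
  rcoassoc := Hom.ext (G.γC_coassoc hG)
  rcounit := Hom.ext (G.counitC_γC hG)
  coact_comm := Hom.ext (G.γD_γC hG)

/-- The bicomodule structure on `Tbar`. -/
def bicomoduleTbar (hG : G.Tame) : Bicomodule (G.coringC hG) (G.coringD hG) G.Tbar where
  lcoact := G.lcoactTbar hG
  rcoact := G.rcoactTbar hG
  lcoassoc := Hom.ext (G.lcoactTbar_coassoc hG)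
  lcounit := Hom.ext (G.counitC_lcoactTbar hG)
  rcoassoc := Hom.ext (G.rcoactTbar_coassoc hG)
  rcounit := Hom.ext (G.counitD_rcoactTbar hG)
  coact_comm := Hom.ext (G.lcoactTbar_rcoactTbar hG)

/-- The companion structure on `Tbar`. -/
def companion (hG : G.Tame) : Companion (G.bicomoduleT hG) (G.bicomoduleTbar hG) where
  cov := G.cov hG
  covBar := G.covBar hG
  cov_left := Hom.ext (G.cov_left hG)
  cov_right := Hom.ext fun c =>
    (congrArg (assocInv _ _ _) (G.cov_right hG c)).trans (assocInv_assoc _ _ _ _)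
  covBar_left := Hom.ext (G.covBar_left hG)
  covBar_right := Hom.ext fun d =>
    (congrArg (assocInv _ _ _) (G.covBar_right hG d)).trans (assocInv_assoc _ _ _ _)
  diag_X := Hom.ext (G.diag_T hG)
  diag_Y := Hom.ext (G.diag_Tbar hG)

/-- The map `x ⊗ (v ⊗ y ⊗ w) ⊗ z ↦ evHat (x ⊗ v) y ev (w ⊗ z)`. -/
def chi : Hom (P.t ⊗ᵇ (G.Tbar ⊗ᵇ P.t)) P.t :=
  P.contract.comp (P.t ◁ᵇ tail₃ G.ιTbar P.t)

theorem chi_tmul (x : P.t) (s : G.Tbar) (z : P.t) :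
    G.chi (tmul x (tmul s z)) = P.contract (tmul x (tail₃ (.id _) P.t (tmul (G.ιTbar s) z))) := rfl

/-- For c = v ⊗ y (sums suppressed), the left side is evHat(x ⊗ v) y₁ ev(y₂ ⊗ y₃) = evHat(x ⊗ v) y.
Compatibility of the evaluations rewrites this as x ev(v ⊗ y). -/
theorem chi_cov (hG : G.Tame) (z : (P.t ⊗ᵇ G.C : Bimodule S R)) :
    G.chi ((P.t ◁ᵇ G.cov hG) z) = runit P.t ((P.t ◁ᵇ G.counitC hG) z) := by
  have h : ∀ y, (P.actA.comp (P.t ◁ᵇ P.evR)) (G.γ y) = y := fun y =>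
    (congrArg P.actA (G.ev_apply y)).trans (P.actA_unit y)
  rw [← FormalDual.actA_whiskerLeft_unitHom,
    whiskerLeft_comm _ (k := P.evR) (l := G.ιC) (G.unitHom_counitC hG), ← FormalDual.act_ev]
  refine congrArg (fun y => P.actB (head₂ P.evHatS P.t y)) ?_
  refine (congrArg _ (whiskerLeft_comm P.t (G.ιTbar_cov hG) z)).trans ?_
  exact whiskerLeft_cancel P.t (whiskerLeft_cancel P.h h) _

/-- For d = x ⊗ v, the left side is evHat(x₁ ⊗ x₂) x₃ ev(v ⊗ z) = x ev(v ⊗ z) by coevaluation, which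
compatibility identifies with evHat(x ⊗ v) z. -/
theorem chi_covBar (hG : G.Tame) (z : (G.D ⊗ᵇ P.t : Bimodule S R)) :
    G.chi (tail₂ (G.covBar hG) P.t z) = lunit P.t ((G.counitD hG ▷ᵇ P.t) z) := by
  refine Eq.trans ?_ (P.actB_unit _)
  rw [unitB_lunit_counitD]
  refine Eq.trans ?_ (P.act_ev _).symm
  refine (congrArg P.contract (G.ιTbar_covBar_tail hG P.t z)).trans ?_
  refine Eq.trans ?_ (P.actB_unit _)
  refine congrArg P.actB ?_
  refine (head₂_naturality P.evHatS (P.actA.comp (P.t ◁ᵇ P.evR)) _).trans ?_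
  exact congrArg _ (G.coev_tail (P.h ⊗ᵇ P.t) _)

/-- Associativity already holds for arbitrary `q` and `q'` in That ⊗ T ⊗ That, so membership in
`Tbar` plays no role and simple tensors suffice. -/
theorem contract_contract (x z u : P.t) (q q' : (P.h ⊗ᵇ (P.t ⊗ᵇ P.h) : Bimodule R S)) :
    P.contract (tmul x (tail₃ (.id _) P.t (tmul q (P.contract
      (tmul z (tail₃ (.id _) P.t (tmul q' u)))))))
    = P.contract (tmul (P.contract (tmul x (tail₃ (.id _) P.t (tmul q z))))
      (tail₃ (.id _) P.t (tmul q' u))) := by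
  induction q using induction_right with
  | h0 => simp only [zero_tmul, tmul_zero, map_zero]
  | ha x y hx hy => simp only [add_tmul, tmul_add, map_add, hx, hy]
  | ht v y w =>
    induction q' using induction_right with
    | h0 => simp only [zero_tmul, tmul_zero, map_zero]
    | ha x y hx hy => simp only [add_tmul, tmul_add, map_add, hx, hy]
    | ht v' y' w' =>
      -- Stated over `T` itself, where the full rings A and B act. Compatibility turns the inner
      -- action of evHat(z ⊗ v') into a right action of A on z; right A-linearity of ev carries that
      -- action out, and compatibility together with commuting left and right actions reassembles
      -- the other side.
      have key : ∀ (x z u y y' : T) (v w v' w' : That),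
          P.pairHat x v • op (P.pair w (P.pairHat z v' • op (P.pair w' u) • y')) • y
            = P.pairHat (P.pairHat x v • op (P.pair w z) • y) v' • op (P.pair w' u) • y' := by
        intro x z u y y' v w v' w'
        rw [P.pairHat_smul z, P.pair_op_smul, MulOpposite.op_mul, mul_smul,
          P.pairHat_smul (P.pairHat x v • _), smul_comm]
      exact key x z u y y' v w v' w'

theorem chi_assoc (w : (P.t ⊗ᵇ (G.Tbar ⊗ᵇ (P.t ⊗ᵇ (G.Tbar ⊗ᵇ P.t))) : Bimodule S R)) :
    G.chi ((P.t ◁ᵇ G.Tbar ◁ᵇ G.chi) w) = G.chi ((G.chi ▷ᵇ (G.Tbar ⊗ᵇ P.t))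
      (assocInv P.t (G.Tbar ⊗ᵇ P.t) (G.Tbar ⊗ᵇ P.t)
        ((P.t ◁ᵇ assocInv G.Tbar P.t (G.Tbar ⊗ᵇ P.t)) w))) := by
  induction w using induction_right with
  | h0 => simp only [map_zero]
  | ha x y hx hy => simp only [map_add, hx, hy]
  | ht x s w =>
    induction w using induction_right with
    | h0 => simp only [tmul_zero, map_zero]
    | ha x y hx hy => simp only [tmul_add, map_add, hx, hy]
    | ht z s' u => exact contract_contract x z u (G.ιTbar s) (G.ιTbar s')

/-- The coherd structure on `T`. -/
def coherd (hG : G.Tame) : Coherd (G.companion hG) where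
  chi := G.chi
  chi_cov := Hom.ext (G.chi_cov hG)
  chi_covBar := Hom.ext (G.chi_covBar hG)
  chi_assoc := Hom.ext G.chi_assoc

theorem chi_tmul_sum (x z : T) (s : G.Tbar) (n : ℕ) (v : Fin n → That) (y : Fin n → T)
    (w : Fin n → That)
    (h : G.ιTbar s = ∑ i, tmul (X := P.h) (v i) (tmul (X := P.t) (Y := P.h) (y i) (w i))) :
    G.chi (tmul (X := P.t) x (tmul (Y := P.t) s z))
      = (∑ i, P.pairHat x (v i) • op (P.pair (w i) z) • y i : T) := by
  -- Single terms of the sum need not lie in `Tbar`, so additivity is applied to the contraction on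
  -- all of That ⊗ T ⊗ That.
  let f : (P.h ⊗ᵇ (P.t ⊗ᵇ P.h) : Bimodule R S) →+ P.t :=
    (P.contract.toAddMonoidHom.comp (mkHom P.t _ x)).comp
      ((tail₃ (.id (P.h ⊗ᵇ (P.t ⊗ᵇ P.h))) P.t).toAddMonoidHom.comp ((mkHom _ P.t).flip z))
  refine (G.chi_tmul x s z).trans ?_
  refine (congrArg f h).trans ?_
  exact map_sum f _ _

end Shepherd

end

end BimoduleHerds

end

theorem mainTheorem4 {R S A B : Type u} [Ring R] [Ring S] [Ring A] [Ring B]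
    (α : R →+* A) (β : S →+* B) (T : Bimodule B A) (That : Bimodule A B)
    (P : FormalDual α β T That) (G : Shepherd P) (hG : G.Tame) :
    G.InclusionsInjective ∧
    ∃ (cC : Coring G.C) (cD : Coring G.D)
      (bT : Bicomodule cD cC P.t) (bTbar : Bicomodule cC cD G.Tbar)
      (comp : Companion bT bTbar) (coherd : Coherd comp),
      G.IsCoringC cC ∧ G.IsCoringD cD ∧
      (∀ x : P.t, G.inclTC (bT.rcoact x) = G.γ x) ∧
      (∀ x : P.t, G.inclDT (bT.lcoact x) = G.γ x) ∧
      (∀ t : G.Tbar, G.inclCTbar (bTbar.lcoact t) = G.hγh (G.ιTbar t)) ∧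
      (∀ t : G.Tbar, G.inclTbarD (bTbar.rcoact t) = G.hγh (G.ιTbar t)) ∧
      (∀ c : G.C, G.inclTbarT (comp.cov c) = G.inclCC (cC.comul c)) ∧
      (∀ d : G.D, G.inclTTbar (comp.covBar d) = G.inclDD (cD.comul d)) ∧
      (∀ (x z : T) (t : G.Tbar) (n : ℕ) (v : Fin n → That) (y : Fin n → T) (w : Fin n → That),
        G.ιTbar t = ∑ i, tmul (X := P.h) (v i) (tmul (X := P.t) (Y := P.h) (y i) (w i)) →
        coherd.chi (tmul (X := P.t) x (tmul (Y := P.t) t z))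
          = ∑ i, P.pairHat x (v i) • (op (P.pair (w i) z) • y i)) :=
  ⟨G.inclusionsInjective hG, G.coringC hG, G.coringD hG, G.bicomoduleT hG, G.bicomoduleTbar hG,
    G.companion hG, G.coherd hG, ⟨G.inclCC_comulC hG, G.unitHom_counitC hG⟩,
    ⟨G.inclDD_comulD hG, G.unitHom_counitD hG⟩, G.ιC_γC hG, G.ιD_γD hG,
    G.inclCTbar_lcoactTbar hG, G.inclTbarD_rcoactTbar hG,
    fun c => (G.ιTbar_cov hG c).trans (G.inclCC_comulC hG c).symm,
    fun d => (G.ιTbar_covBar hG d).trans (G.inclDD_comulD hG d).symm, G.chi_tmul_sum⟩
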